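/- **Setting.** Let $K$ be a finite unramified extension of $\mathbb{Q}_2$, $d=[K:\mathbb{Q}_2]$, with ring of integers $\mathcal{O}_K$ and maximal ideal $\mathfrak{m}_K=(2)$; put $R=\mathcal{O}_K/\mathfrak{m}_K^2$, with trace $\mathrm{tr}:R\to\mathbb{Z}/4$, and $\psi(z)=e^{\frac{2\pi i}{4}\mathrm{tr}(z)}$. Let $(\widetilde V,\widetilde\omega)$ be a free symplectic $R$-module of finite rank $2n$ (alternating perfect form), with a fixed splitting $\widetilde V=\widetilde L_0\times\widetilde M_0$ into Lagrangian submodules, and $\widetilde\beta((l_1,m_1),(l_2,m_2))=\widetilde\omega(l_1,m_2)$. Let $V=\widetilde V/2\widetilde V$ and let $\omega,\beta:V\times V\to R$ be the forms induced by $2\widetilde\omega$, $2\widetilde\beta$. * $H(V)=V\times R$ with $(v_1,z_1)(v_2,z_2)=(v_1+v_2,z_1+z_2+\beta(v_1,v_2))$ is the Heisenberg group. $ASp(V)$ is the group of pairs $(g,\alpha)$, $g\in Sp(V,\omega)$, $\alpha:V\to R$ with $\alpha(v_1+v_2)-\alpha(v_1)-\alpha(v_2)=\beta(gv_1,gv_2)-\beta(v_1,v_2)$,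 with product $(g,\alpha_g)(h,\alpha_h)=(gh,\alpha_g\circ h+\alpha_h)$. It acts on $H(V)$ by $(v,z)\mapsto(gv,z+\alpha(v))$. * The natural homomorphism $Sp(\widetilde V)\to ASp(V)$ sends $\widetilde g$ to $(g,\alpha_{\widetilde g})$, where $g$ is the reduction of $\widetilde g$ mod $2$ and $\alpha_{\widetilde g}$ is the function on $V$ induced by $\widetilde v\mapsto\widetilde\beta(\widetilde g\widetilde v,\widetilde g\widetilde v)-\widetilde\beta(\widetilde v,\widetilde v)$. * An enhanced Lagrangian is a homomorphic section $\tau:L\to H(V)$ over a Lagrangian subspace $L=L^\perp\subset V$; $ELag(V)$ is the set of these (written $L$ for short), on which $g\in ASp(V)$ acts by $\tau\mapsto g\circ\tau\circ g^{-1}$. To $L$ is attached the space $\mathcal{H}_L$ of functions $f:H(V)\to\mathbb{C}$ with $f(z\,\tau(l)\,h)=\psi(z)f(h)$, on which $H(V)$ acts by right translations. These form a bundle $\mathfrak{H}$ on $ELag(V)$, with isomorphisms $\theta_g:\mathcal{H}_{gL}\to\mathcal{H}_L$, $f\mapsto f\circ g$. A trivialization of a bundle with fibrewise group action is a system of equivariant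 isomorphisms $E_{M,L}:\mathfrak{E}_L\to\mathfrak{E}_M$ with $E_{N,M}E_{M,L}=E_{N,L}$. * If $M+L=V$, put $F_{M,L}[f](h)=\sum_{m\in M}f(\tau(m)h)$ and $T_{M,L}=\frac{(-1)^{dn}}{|M|^2}F_{M,L}^{\otimes4}:\mathcal{H}_L^{\otimes4}\to\mathcal{H}_M^{\otimes4}$. The canonical trivialization $\{T_{M,L}\}$ of $\mathfrak{H}^{\otimes4}$ (a bundle with action of $H(V)^4$) is the unique trivialization extending these. * The Weil gerbe $\mathcal{W}$ is the category of triples $(\mathfrak{E},\{E_{M,L}\},\varphi)$: an $H(V)$-vector bundle $\mathfrak{E}$ on $ELag(V)$, a trivialization of it, and an isomorphism $\varphi:\mathfrak{E}\to\mathfrak{H}$ of $H(V)$-vector bundles such that $\varphi^{\otimes4}$ carries $\{E_{M,L}^{\otimes4}\}$ to $\{T_{M,L}\}$; morphisms are isomorphisms $f$ of trivialized $H(V)$-vector bundles with $\varphi_2^{\otimes4}f^{\otimes4}=\varphi_1^{\otimes4}$. $g\in ASp(V)$ acts by the pull-back functor $g^*$: $(g^*\mathfrak{E})_L=\mathfrak{E}_{gL}$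 with action $h\mapsto\pi_{gL}(g(h))$, trivialization $E_{gM,gL}$ and isomorphism $\theta_g\circ g^*\varphi$. * $AMp(V)$ is the group of pairs $(g,\iota)$ with $g\in ASp(V)$ and $\iota:g^*\cong\mathrm{Id}$ an isomorphism of functors on $\mathcal{W}$, with $(g,\iota_g)(h,\iota_h)=(gh,\iota_h\circ h^*(\iota_g))$. It contains $\mu_4$ as $\zeta\mapsto(1,\zeta)$. * For $\mathfrak{E}\in\mathcal{W}$, $\Gamma(\mathfrak{E})$ is the space of horizontal sections $(f_L)$, $E_{M,L}f_L=f_M$, with the action $\pi$ of $H(V)$ induced from the fibres, and $\rho_{\mathfrak{E}}:AMp(V)\to GL(\Gamma(\mathfrak{E}))$ sends $(g,\iota)$ to the inverse of the operator $(f_L)_L\mapsto(\iota_L(f_{gL}))_L$. **Theorem.** The canonical trivialization of $\mathfrak{H}^{\otimes4}$ exists and is unique, $\mathcal{W}$ is non-empty, and $AMp(V)$ is a central extension of $ASp(V)$ by $\mu_4$. Moreover, there exist a group $Mp(\widetilde V)$ which is a central extension $$1\to\mu_2\to Mp(\widetilde V)\xrightarrow{\,p\,}Sp(\widetilde V)\to1,\qquad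 \mu_2=\{\pm1\},$$ and a homomorphism of central extensions $s:Mp(\widetilde V)\to AMp(V)$, i.e. $s$ restricts to the inclusion $\mu_2\subset\mu_4$ and covers the natural homomorphism $Sp(\widetilde V)\to ASp(V)$. Consequently, for every $\mathfrak{E}\in\mathcal{W}$, $\rho_{\widetilde V}=\rho_{\mathfrak{E}}\circ s$ is a representation of $Mp(\widetilde V)$ on $\Gamma(\mathfrak{E})$ in which $\mu_2$ acts by scalars $\pm1$ and which satisfies $$\rho_{\widetilde V}(m)\,\pi(h)=\pi\big(g(h)\big)\,\rho_{\widetilde V}(m),\qquad m\in Mp(\widetilde V),\ h\in H(V),$$ where $g\in ASp(V)$ is the image of $p(m)$. -/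

import Mathlib

open CategoryTheory
open scoped TensorProduct

universe u

set_option linter.unusedSectionVars false

namespace WeilTwo

noncomputable section

/-! ## The ring `𝓞_K / 𝔪_K²` -/

section Ring

/-- The ring of integers of an extension `K` of `ℚ₂`. -/
abbrev RingOfInt (K : Type u) [Field K] [Algebra ℤ_[2] K] : Type u :=
  integralClosure ℤ_[2] K

/-- The ring `R = 𝓞_K / (2)²`; when `K` is unramified over `ℚ₂`, `(2) = 𝔪_K`. -/
abbrev TruncRing (K : Type u) [Field K] [Algebra ℤ_[2] K] : Type u :=
  RingOfInt K ⧸ (Ideal.span {(2 : RingOfInt K)} ^ 2)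

theorem four_eq_zero_truncRing (K : Type u) [Field K] [Algebra ℤ_[2] K] :
    ((4 : ℕ) : TruncRing K) = 0 := by
  have h : (4 : RingOfInt K) ∈ Ideal.span {(2 : RingOfInt K)} ^ 2 := by
    rw [Ideal.span_singleton_pow, Ideal.mem_span_singleton]
    exact ⟨1, by norm_num⟩
  rw [← map_natCast (Ideal.Quotient.mk (Ideal.span {(2 : RingOfInt K)} ^ 2))]
  exact Ideal.Quotient.eq_zero_iff_mem.mpr (by exact_mod_cast h)

/-- The (unique) `ℤ/4`-algebra structure of `𝓞_K / 𝔪_K²`. -/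
instance truncRingAlgebra (K : Type u) [Field K] [Algebra ℤ_[2] K] :
    Algebra (ZMod 4) (TruncRing K) :=
  haveI := ringChar.charP (TruncRing K)
  ZMod.algebra' (TruncRing K) (ringChar (TruncRing K))
    (ringChar.dvd (four_eq_zero_truncRing K))

instance truncRingFinite (K : Type u) [Field K] [Algebra ℚ_[2] K] [FiniteDimensional ℚ_[2] K]
    [Algebra ℤ_[2] K] [IsScalarTower ℤ_[2] ℚ_[2] K] : Finite (TruncRing K) := by
  have hfin : Module.Finite ℤ_[2] (RingOfInt K) :=
    IsIntegralClosure.finite ℤ_[2] ℚ_[2] K (RingOfInt K)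
  obtain ⟨n, s, hs⟩ := Module.Finite.exists_fin (R := ℤ_[2]) (M := RingOfInt K)
  let q : RingOfInt K → TruncRing K := Ideal.Quotient.mk _
  have hq : Function.Surjective q := Ideal.Quotient.mk_surjective
  let F : (Fin n → ZMod 4) → TruncRing K := fun c => ∑ i, ((c i).val : TruncRing K) * q (s i)
  refine Finite.of_surjective F ?_
  intro y
  obtain ⟨x, rfl⟩ := hq y
  have hx : x ∈ Submodule.span ℤ_[2] (Set.range s) := hs ▸ Submodule.mem_top
  obtain ⟨c, rfl⟩ := (Submodule.mem_span_range_iff_exists_fun ℤ_[2]).mp hx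
  refine ⟨fun i => PadicInt.toZModPow 2 (c i), ?_⟩
  show _ = Ideal.Quotient.mk _ (∑ i, c i • s i)
  rw [map_sum]
  refine Finset.sum_congr rfl fun i _ => ?_
  have h1 : c i - ((PadicInt.toZModPow 2 (c i) : ZMod (2 ^ 2)).val : ℤ_[2]) ∈
      RingHom.ker (PadicInt.toZModPow (p := 2) 2) := by
    rw [RingHom.mem_ker, map_sub, map_natCast, ZMod.natCast_zmod_val, sub_self]
  rw [PadicInt.ker_toZModPow, Ideal.mem_span_singleton] at h1
  obtain ⟨e, he⟩ := h1
  rw [sub_eq_iff_eq_add] at he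
  set m := (PadicInt.toZModPow 2 (c i) : ZMod (2 ^ 2)).val with hm
  have h4 := four_eq_zero_truncRing K
  rw [he, Algebra.smul_def, map_mul, map_add, map_add, map_mul, map_mul]
  have : (Ideal.Quotient.mk (Ideal.span {(2 : RingOfInt K)} ^ 2))
      ((algebraMap ℤ_[2] (RingOfInt K)) ((2 : ℕ) ^ 2 : ℤ_[2])) = 0 := by
    rw [← Nat.cast_pow, map_natCast, map_natCast]
    exact h4
  rw [this]
  simp [q]

end Ring

/-- `1 → A → G → Q → 1`, given by `i` and `p`, is a central extension of `Q` by `A`. -/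
structure IsCentralExtension {A G Q : Type*} [Group A] [Group G] [Group Q]
    (i : A →* G) (p : G →* Q) : Prop where
  injective : Function.Injective i
  surjective : Function.Surjective p
  exact : i.range = p.ker
  central : i.range ≤ Subgroup.center G

/-! ## Symplectic modules and the cocycle of a Lagrangian splitting -/

/-- `L` is Lagrangian for `ω`: it equals its own orthogonal complement. -/
def IsLagrangian {R M : Type*} [CommRing R] [AddCommGroup M] [Module R M]
    (ω : LinearMap.BilinForm R M) (L : Submodule R M) : Prop :=
  ∀ v, v ∈ L ↔ ∀ l ∈ L, ω v l = 0

/-- A symplectic form `ω` on the `R`-module `W`, with a Lagrangian splitting `W = L₀ × M₀`. -/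
structure SplitSymplectic (R W : Type u) [CommRing R] [AddCommGroup W] [Module R W] where
  /-- the symplectic form -/
  ω : LinearMap.BilinForm R W
  isAlt : ω.IsAlt
  isPerfPair : ω.IsPerfPair
  /-- first Lagrangian of the splitting -/
  L₀ : Submodule R W
  /-- second Lagrangian of the splitting -/
  M₀ : Submodule R W
  isCompl : IsCompl L₀ M₀
  isLagrangian_L₀ : IsLagrangian ω L₀
  isLagrangian_M₀ : IsLagrangian ω M₀

/-- The reduction `V = W / 2W`. -/
abbrev Red (R W : Type u) [CommRing R] [AddCommGroup W] [Module R W] : Type u :=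
  W ⧸ (Ideal.span {(2 : R)} • (⊤ : Submodule R W))

section Reduction

variable {R W : Type u} [CommRing R] [Algebra (ZMod 4) R] [AddCommGroup W] [Module R W]

variable (R) in
theorem four_eq_zero : (4 : R) = 0 := by
  have h : algebraMap (ZMod 4) R 4 = algebraMap (ZMod 4) R 0 := congrArg _ (by decide)
  rwa [map_zero, map_ofNat] at h

theorem mem_two_smul_top {x : W} (hx : x ∈ Ideal.span {(2 : R)} • (⊤ : Submodule R W)) :
    ∃ y : W, x = (2 : R) • y := by
  rw [Submodule.ideal_span_singleton_smul] at hx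
  obtain ⟨y, -, rfl⟩ := hx
  exact ⟨y, rfl⟩

/-- For a bilinear form `B` on `W`, the form `2 B` factored through `V = W / 2W`. -/
def twice (B : LinearMap.BilinForm R W) : LinearMap.BilinForm R (Red R W) :=
  LinearMap.liftQ₂ _ _ ((2 : R) • B)
    (by
      intro x hx
      obtain ⟨y, rfl⟩ := mem_two_smul_top hx
      ext w
      have : (2 : R) * (2 * B y w) = 0 := by
        rw [← mul_assoc]; norm_num; simp [four_eq_zero R]
      simpa using this)
    (by
      intro x hx
      obtain ⟨y, rfl⟩ := mem_two_smul_top hx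
      ext w
      have : (2 : R) * (2 * B w y) = 0 := by
        rw [← mul_assoc]; norm_num; simp [four_eq_zero R]
      simpa using this)

/-- The reduction map `W → V`. -/
abbrev red : W →ₗ[R] Red R W := Submodule.mkQ _

@[simp] theorem twice_red (B : LinearMap.BilinForm R W) (v w : W) :
    twice B (red v) (red w) = 2 * B v w := rfl

/-- The group of linear automorphisms preserving a bilinear form. -/
def SpGroup {M : Type*} [AddCommGroup M] [Module R M] (ω : LinearMap.BilinForm R M) :
    Subgroup (M ≃ₗ[R] M) where
  carrier := {g | ∀ v w, ω (g v) (g w) = ω v w}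
  mul_mem' {a b} ha hb v w := by
    rw [LinearEquiv.mul_apply, LinearEquiv.mul_apply, ha, hb]
  one_mem' v w := rfl
  inv_mem' {a} ha v w := by
    have := ha (a⁻¹ v) (a⁻¹ w)
    rwa [← LinearEquiv.mul_apply, ← LinearEquiv.mul_apply, mul_inv_cancel,
      eq_comm] at this

end Reduction

/-! ## Vector bundles on a set, with a fibrewise group action

A complex vector bundle on a set `X` is a family `E : X → Type u` of complex vector spaces; a
fibrewise action of `G` is a family of representations `π x : Representation ℂ G (E x)`. -/

section Bundles

variable {G : Type u} [Group G] {X : Type u} {E : X → Type u}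
  [∀ x, AddCommGroup (E x)] [∀ x, Module ℂ (E x)]

/-- The action of `G ^ m` on the `m`-th tensor power of a bundle with an action of `G`. -/
def tensorRep (m : ℕ) (π : ∀ x, Representation ℂ G (E x)) (x : X) :
    Representation ℂ (Fin m → G) (⨂[ℂ] _ : Fin m, E x) where
  toFun h := PiTensorProduct.map fun i => π x (h i)
  map_one' := by simp
  map_mul' h k := by
    simp only [Pi.mul_apply, map_mul]
    exact PiTensorProduct.map_mul _ _

/-- A trivialization: intertwining isomorphisms `E_{M,L} : E_L → E_M` with
`E_{N,M} ∘ E_{M,L} = E_{N,L}`. -/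
structure Trivialization (π : ∀ x, Representation ℂ G (E x)) : Type u where
  /-- the isomorphism `E_{M,L}` -/
  map : ∀ M L : X, E L ≃ₗ[ℂ] E M
  intertwines : ∀ M L (h : G) (x : E L), map M L (π L h x) = π M h (map M L x)
  mul : ∀ N M L (x : E L), map N M (map M L x) = map N L x

theorem Trivialization.ext {π : ∀ x, Representation ℂ G (E x)} {S T : Trivialization π}
    (h : ∀ M L, S.map M L = T.map M L) : S = T := by
  obtain ⟨S, _, _⟩ := S
  obtain ⟨T, _, _⟩ := T
  obtain rfl : S = T := funext fun M => funext fun L => h M L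
  rfl

theorem Trivialization.map_self {π : ∀ x, Representation ℂ G (E x)} (T : Trivialization π)
    (L : X) (x : E L) : T.map L L x = x :=
  (T.map L L).injective (T.mul L L L x)

variable (E) in
/-- The identification of two fibres over equal points. -/
def fiberCast {x y : X} (h : x = y) : E x ≃ₗ[ℂ] E y :=
  h ▸ LinearEquiv.refl ℂ (E x)

@[simp] theorem fiberCast_rfl {x : X} (h : x = x) (v : E x) : fiberCast E h v = v := rfl

end Bundles

/-- The tensor power `f^{⊗m}` of a linear map. -/
abbrev tpow (m : ℕ) {E F : Type*} [AddCommGroup E] [Module ℂ E] [AddCommGroup F] [Module ℂ F]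
    (f : E →ₗ[ℂ] F) : (⨂[ℂ] _ : Fin m, E) →ₗ[ℂ] (⨂[ℂ] _ : Fin m, F) :=
  PiTensorProduct.map fun _ => f

theorem tpow_comp (m : ℕ) {E F H : Type*} [AddCommGroup E] [Module ℂ E] [AddCommGroup F]
    [Module ℂ F] [AddCommGroup H] [Module ℂ H] (g : F →ₗ[ℂ] H) (f : E →ₗ[ℂ] F) :
    tpow m (g ∘ₗ f) = tpow m g ∘ₗ tpow m f := by
  refine PiTensorProduct.ext (MultilinearMap.ext fun x => ?_)
  simp [tpow]

theorem tpow_id (m : ℕ) {E : Type*} [AddCommGroup E] [Module ℂ E] :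
    tpow m (LinearMap.id : E →ₗ[ℂ] E) = LinearMap.id :=
  PiTensorProduct.map_id

theorem tpow_smul (m : ℕ) {E : Type*} [AddCommGroup E] [Module ℂ E] (c : ℂ) :
    tpow m (c • LinearMap.id : E →ₗ[ℂ] E) = c ^ m • LinearMap.id := by
  refine PiTensorProduct.ext (MultilinearMap.ext fun x => ?_)
  simp [tpow, MultilinearMap.map_smul_univ]

section CastLemmas

variable {G : Type u} [Group G] {X : Type u} {E F : X → Type u}
  [∀ x, AddCommGroup (E x)] [∀ x, Module ℂ (E x)] [∀ x, AddCommGroup (F x)] [∀ x, Module ℂ (F x)]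

theorem fiberCast_rep (π : ∀ x, Representation ℂ G (E x)) {x y : X} (h : x = y) (k : G)
    (v : E x) : fiberCast E h (π x k v) = π y k (fiberCast E h v) := by
  subst h; rfl

theorem fiberCast_map (f : ∀ x, E x ≃ₗ[ℂ] F x) {x y : X} (h : x = y) (v : E x) :
    fiberCast F h (f x v) = f y (fiberCast E h v) := by
  subst h; rfl

theorem fiberCast_triv {π : ∀ x, Representation ℂ G (E x)} (T : Trivialization π)
    {x y x' y' : X} (h : x = y) (h' : x' = y') (v : E x') :
    fiberCast E h (T.map x x' v) = T.map y y' (fiberCast E h' v) := by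
  subst h; subst h'; rfl

theorem fiberCast_section (f : ∀ x, E x) {x y : X} (h : x = y) :
    fiberCast E h (f x) = f y := by
  subst h; rfl

theorem fiberCast_trans {x y z : X} (h : x = y) (h' : y = z) (v : E x) :
    fiberCast E h' (fiberCast E h v) = fiberCast E (h.trans h') v := by
  subst h; subst h'; rfl

end CastLemmas

namespace SplitSymplectic

variable {R W : Type u} [CommRing R] [Algebra (ZMod 4) R] [AddCommGroup W] [Module R W]
variable (D : SplitSymplectic R W)

/-- The bilinear form `β̃((l₁, m₁), (l₂, m₂)) = ω̃(l₁, m₂)` on `W = L₀ × M₀`. -/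
def betaTilde : LinearMap.BilinForm R W :=
  D.ω.compl₁₂ (D.L₀.projection D.M₀ D.isCompl) (D.M₀.projection D.L₀ D.isCompl.symm)

/-- The form `ω = 2 ω̃` on `V`. -/
def omega : LinearMap.BilinForm R (Red R W) := twice D.ω

/-- The cocycle `β = 2 β̃` on `V`. -/
def beta : LinearMap.BilinForm R (Red R W) := twice D.betaTilde

theorem betaTilde_sub (v w : W) : D.betaTilde v w - D.betaTilde w v = D.ω v w := by
  have hv : v = D.L₀.projection D.M₀ D.isCompl v + D.M₀.projection D.L₀ D.isCompl.symm v :=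
    (Submodule.projection_add_projection_eq_self D.isCompl v).symm
  have hw : w = D.L₀.projection D.M₀ D.isCompl w + D.M₀.projection D.L₀ D.isCompl.symm w :=
    (Submodule.projection_add_projection_eq_self D.isCompl w).symm
  have h1 : D.ω (D.L₀.projection D.M₀ D.isCompl v) (D.L₀.projection D.M₀ D.isCompl w) = 0 :=
    (D.isLagrangian_L₀ _).1 (Submodule.projection_apply_mem _ _) _
      (Submodule.projection_apply_mem _ _)
  have h2 : D.ω (D.M₀.projection D.L₀ D.isCompl.symm v)
      (D.M₀.projection D.L₀ D.isCompl.symm w) = 0 :=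
    (D.isLagrangian_M₀ _).1 (Submodule.projection_apply_mem _ _) _
      (Submodule.projection_apply_mem _ _)
  conv_rhs => rw [hv, hw]
  simp only [map_add, LinearMap.add_apply, h1, h2, betaTilde, LinearMap.compl₁₂_apply]
  rw [← D.isAlt.neg_eq (D.M₀.projection D.L₀ D.isCompl.symm v) (D.L₀.projection D.M₀ D.isCompl w)]
  ring

/-- `Sp(W)`, for the symplectic form `ω̃` on `W`. -/
abbrev SpW : Subgroup (W ≃ₗ[R] W) := SpGroup D.ω

/-- `Sp(V)`, for the form `ω = 2 ω̃` on `V`. -/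
abbrev SpV : Subgroup (Red R W ≃ₗ[R] Red R W) := SpGroup D.omega

/-! ## The Heisenberg group and the affine symplectic group -/

/-- The Heisenberg group `H(V) = V × R`. -/
@[ext] structure Heis (D : SplitSymplectic R W) : Type u where
  /-- the component in `V` -/
  v : Red R W
  /-- the component in `R` -/
  z : R

namespace Heis

variable {D}

instance : Mul D.Heis := ⟨fun a b => ⟨a.v + b.v, a.z + b.z + D.beta a.v b.v⟩⟩
instance : One D.Heis := ⟨⟨0, 0⟩⟩
instance : Inv D.Heis := ⟨fun a => ⟨-a.v, -a.z + D.beta a.v a.v⟩⟩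

@[simp] theorem mul_v (a b : D.Heis) : (a * b).v = a.v + b.v := rfl
@[simp] theorem mul_z (a b : D.Heis) : (a * b).z = a.z + b.z + D.beta a.v b.v := rfl
@[simp] theorem one_v : (1 : D.Heis).v = 0 := rfl
@[simp] theorem one_z : (1 : D.Heis).z = 0 := rfl
@[simp] theorem inv_v (a : D.Heis) : (a⁻¹).v = -a.v := rfl
@[simp] theorem inv_z (a : D.Heis) : (a⁻¹).z = -a.z + D.beta a.v a.v := rfl

instance : Group D.Heis :=
  Group.ofLeftAxioms
    (fun a b c => by
      ext <;> simp [add_assoc]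
      ring)
    (fun a => by ext <;> simp)
    (fun a => by ext <;> simp)

/-- The central element `(0, z)`. -/
def central (z : R) : D.Heis := ⟨0, z⟩

@[simp] theorem central_v (z : R) : (central z : D.Heis).v = 0 := rfl
@[simp] theorem central_z (z : R) : (central z : D.Heis).z = z := rfl

theorem central_comm (z : R) (a : D.Heis) : central z * a = a * central z := by
  ext <;> simp [add_comm]

end Heis

/-- The affine symplectic group `ASp(V)`: pairs `(g, α)` with `g ∈ Sp(V)` and `α : V → R`
satisfying `α(v₁+v₂) - α(v₁) - α(v₂) = β(g v₁, g v₂) - β(v₁, v₂)`. -/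
@[ext] structure ASp (D : SplitSymplectic R W) : Type u where
  /-- the linear part -/
  g : D.SpV
  /-- the quadratic function -/
  α : Red R W → R
  quad : ∀ v w, α (v + w) - α v - α w = D.beta (g.1 v) (g.1 w) - D.beta v w

namespace ASp

variable {D}

instance : Mul D.ASp := ⟨fun a b => ⟨a.g * b.g, fun v => a.α (b.g.1 v) + b.α v, fun v w => by
  have h1 := a.quad (b.g.1 v) (b.g.1 w)
  have h2 := b.quad v w
  simp only [map_add, Subgroup.coe_mul, LinearEquiv.mul_apply]
  linear_combination h1 + h2⟩⟩

instance : One D.ASp := ⟨⟨1, 0, fun v w => by simp⟩⟩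

theorem apply_inv_apply (g : D.SpV) (v : Red R W) : g.1 ((g⁻¹).1 v) = v := by
  rw [← LinearEquiv.mul_apply, ← Subgroup.coe_mul, mul_inv_cancel]; rfl

theorem inv_apply_apply (g : D.SpV) (v : Red R W) : (g⁻¹).1 (g.1 v) = v := by
  rw [← LinearEquiv.mul_apply, ← Subgroup.coe_mul, inv_mul_cancel]; rfl

instance : Inv D.ASp := ⟨fun a => ⟨a.g⁻¹, fun v => - a.α ((a.g⁻¹).1 v), fun v w => by
  have h1 := a.quad ((a.g⁻¹).1 v) ((a.g⁻¹).1 w)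
  rw [apply_inv_apply, apply_inv_apply] at h1
  rw [map_add]
  linear_combination -h1⟩⟩

@[simp] theorem mul_g (a b : D.ASp) : (a * b).g = a.g * b.g := rfl
@[simp] theorem mul_α (a b : D.ASp) (v) : (a * b).α v = a.α (b.g.1 v) + b.α v := rfl
@[simp] theorem one_g : (1 : D.ASp).g = 1 := rfl
@[simp] theorem one_α (v) : (1 : D.ASp).α v = 0 := rfl
@[simp] theorem inv_g (a : D.ASp) : (a⁻¹).g = a.g⁻¹ := rfl
@[simp] theorem inv_α (a : D.ASp) (v) : (a⁻¹).α v = - a.α ((a.g⁻¹).1 v) := rfl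

instance : Group D.ASp :=
  Group.ofLeftAxioms
    (fun a b c => by
      refine ASp.ext (by simp [mul_assoc]) (funext fun v => ?_)
      simp [add_assoc])
    (fun a => by
      refine ASp.ext (by simp) (funext fun v => ?_)
      simp)
    (fun a => by
      refine ASp.ext (by simp) (funext fun v => ?_)
      rw [mul_α, inv_α, inv_apply_apply]
      simp)

/-- The automorphism `(v, z) ↦ (g v, z + α(v))` of `H(V)` defined by `(g, α) ∈ ASp(V)`. -/
def toMulAut : D.ASp →* MulAut D.Heis where
  toFun a :=
    { toFun := fun h => ⟨a.g.1 h.v, h.z + a.α h.v⟩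
      invFun := fun h => ⟨(a⁻¹).g.1 h.v, h.z + (a⁻¹).α h.v⟩
      left_inv := fun h => by
        ext
        · exact inv_apply_apply _ _
        · simp only [inv_α, inv_apply_apply]; ring
      right_inv := fun h => by
        ext
        · exact apply_inv_apply _ _
        · simp only [inv_α, inv_g]; ring
      map_mul' := fun h k => by
        ext
        · simp
        · have := a.quad h.v k.v
          simp only [Heis.mul_z, Heis.mul_v]
          linear_combination this }
  map_one' := by
    ext h
    · rfl
    · exact add_zero _
  map_mul' a b := by
    ext h
    · rfl
    · show h.z + (a.α (b.g.1 h.v) + b.α h.v) = h.z + b.α h.v + a.α (b.g.1 h.v)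
      ring

@[simp] theorem toMulAut_v (a : D.ASp) (h : D.Heis) : (toMulAut a h).v = a.g.1 h.v := rfl
@[simp] theorem toMulAut_z (a : D.ASp) (h : D.Heis) : (toMulAut a h).z = h.z + a.α h.v := rfl

theorem α_zero (a : D.ASp) : a.α 0 = 0 := by
  have := a.quad 0 0
  simpa using this

@[simp] theorem toMulAut_central (a : D.ASp) (z : R) :
    toMulAut a (Heis.central z) = Heis.central z := by
  ext <;> simp [α_zero]

end ASp

/-! ## The homomorphism `Sp(W) → ASp(V)` -/

/-- The reduction of an element of `Sp(W)`. -/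
def redSp (g : D.SpW) : D.SpV :=
  ⟨Submodule.Quotient.equiv _ _ g.1 (by
      rw [Submodule.map_smul'', Submodule.map_top, LinearEquiv.range]), by
    intro v w
    obtain ⟨v, rfl⟩ := Submodule.mkQ_surjective _ v
    obtain ⟨w, rfl⟩ := Submodule.mkQ_surjective _ w
    show 2 * D.ω (g.1 v) (g.1 w) = 2 * D.ω v w
    rw [g.2 v w]⟩

@[simp] theorem redSp_red (g : D.SpW) (v : W) : (D.redSp g).1 (red v) = red (g.1 v) := rfl

/-- The quadratic form `α̃(v) = β̃(g̃ v, g̃ v) - β̃(v, v)` on `W`. -/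
def alphaTilde (g : D.SpW) (v : W) : R :=
  D.betaTilde (g.1 v) (g.1 v) - D.betaTilde v v

theorem alphaTilde_add (g : D.SpW) (v w : W) :
    D.alphaTilde g (v + w) - D.alphaTilde g v - D.alphaTilde g w =
      2 * D.betaTilde (g.1 v) (g.1 w) - 2 * D.betaTilde v w := by
  have h1 := D.betaTilde_sub (g.1 v) (g.1 w)
  have h2 := D.betaTilde_sub v w
  have h3 := g.2 v w
  simp only [alphaTilde, map_add, LinearMap.add_apply]
  linear_combination h2 - h1 - h3

theorem alphaTilde_two_smul (g : D.SpW) (v : W) : D.alphaTilde g ((2 : R) • v) = 0 := by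
  simp only [alphaTilde, map_smul, LinearMap.smul_apply, smul_eq_mul]
  linear_combination (D.betaTilde (g.1 v) (g.1 v) - D.betaTilde v v) * four_eq_zero R

/-- The function `α_g̃ : V → R` through which `α̃` factors. -/
def alphaRed (g : D.SpW) : Red R W → R :=
  Quotient.lift (D.alphaTilde g) (by
    intro v w h
    have h' : v - w ∈ Ideal.span {(2 : R)} • (⊤ : Submodule R W) :=
      (Submodule.quotientRel_def _).1 h
    obtain ⟨y, hy⟩ := mem_two_smul_top h'
    have hv : v = w + (2 : R) • y := by rw [← hy]; abel
    have h1 := D.alphaTilde_add g w ((2 : R) • y)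
    rw [D.alphaTilde_two_smul g y] at h1
    simp only [map_smul, smul_eq_mul] at h1
    rw [hv]
    linear_combination h1 +
      (D.betaTilde (g.1 w) (g.1 y) - D.betaTilde w y) * four_eq_zero R)

@[simp] theorem alphaRed_red (g : D.SpW) (v : W) : D.alphaRed g (red v) = D.alphaTilde g v := rfl

/-- The natural homomorphism `Sp(W) → ASp(V)`, `g̃ ↦ (g, α_g̃)`. -/
def toASp : D.SpW →* D.ASp where
  toFun g := ⟨D.redSp g, D.alphaRed g, by
    intro v w
    obtain ⟨v, rfl⟩ := Submodule.mkQ_surjective _ v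
    obtain ⟨w, rfl⟩ := Submodule.mkQ_surjective _ w
    exact D.alphaTilde_add g v w⟩
  map_one' := by
    refine ASp.ext (Subtype.ext (LinearEquiv.ext fun v => ?_)) (funext fun v => ?_)
    · obtain ⟨v, rfl⟩ := Submodule.mkQ_surjective _ v
      rfl
    · obtain ⟨v, rfl⟩ := Submodule.mkQ_surjective _ v
      exact sub_self _
  map_mul' a b := by
    refine ASp.ext (Subtype.ext (LinearEquiv.ext fun v => ?_)) (funext fun v => ?_)
    · obtain ⟨v, rfl⟩ := Submodule.mkQ_surjective _ v
      rfl
    · obtain ⟨v, rfl⟩ := Submodule.mkQ_surjective _ v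
      exact (sub_add_sub_cancel _ _ _).symm

/-! ## Enhanced Lagrangians -/

/-- An enhanced Lagrangian: a Lagrangian subspace `L ⊆ V` with a homomorphic section
`τ : L → H(V)` of the projection `H(V) → V`. -/
structure ELag (D : SplitSymplectic R W) : Type u where
  /-- the Lagrangian subspace -/
  L : Submodule R (Red R W)
  isLagrangian : IsLagrangian D.omega L
  /-- the section -/
  τ : L → D.Heis
  τ_add : ∀ l m, τ (l + m) = τ l * τ m
  τ_v : ∀ l, (τ l).v = l

namespace ELag

variable {D}

theorem ext' {A B : D.ELag} (h : A.L = B.L)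
    (h' : ∀ v (hA : v ∈ A.L) (hB : v ∈ B.L), A.τ ⟨v, hA⟩ = B.τ ⟨v, hB⟩) : A = B := by
  obtain ⟨L, _, τ, _, _⟩ := A
  obtain ⟨L', _, τ', _, _⟩ := B
  obtain rfl : L = L' := h
  obtain rfl : τ = τ' := funext fun l => h' l.1 l.2 l.2
  rfl

theorem τ_zero (A : D.ELag) : A.τ 0 = 1 := by
  have h := A.τ_add 0 0
  rw [add_zero] at h
  exact left_eq_mul.1 h

theorem inv_mem (a : D.ASp) (A : D.ELag) (l : A.L.map (a.g.1 : Red R W →ₗ[R] Red R W)) :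
    (a.g⁻¹).1 l ∈ A.L := by
  obtain ⟨_, v, hv, rfl⟩ := l
  show (a.g⁻¹).1 (a.g.1 v) ∈ A.L
  rwa [ASp.inv_apply_apply]

/-- The action of `ASp(V)` on enhanced Lagrangians: `(g τ)(l) = g (τ (g⁻¹ l))` on `g L`. -/
instance : SMul D.ASp D.ELag := ⟨fun a A =>
  { L := A.L.map (a.g.1 : Red R W →ₗ[R] Red R W)
    isLagrangian := by
      intro v
      have h : v ∈ A.L.map (a.g.1 : Red R W →ₗ[R] Red R W) ↔ (a.g⁻¹).1 v ∈ A.L := by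
        constructor
        · exact fun hv => inv_mem a A ⟨v, hv⟩
        · exact fun hv => ⟨_, hv, ASp.apply_inv_apply _ _⟩
      rw [h, A.isLagrangian]
      constructor
      · rintro h1 _ ⟨l, hl, rfl⟩
        have h2 := a.g.2 ((a.g⁻¹).1 v) l
        rw [ASp.apply_inv_apply, h1 l hl] at h2
        exact h2
      · intro h1 l hl
        rw [← h1 (a.g.1 l) ⟨l, hl, rfl⟩, ← a.g.2, ASp.apply_inv_apply]
    τ := fun l => ASp.toMulAut a (A.τ ⟨(a.g⁻¹).1 l, inv_mem a A l⟩)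
    τ_add := fun l m => by
      rw [← map_mul, ← A.τ_add]
      congr 2
      exact Subtype.ext (map_add (a.g⁻¹).1 _ _)
    τ_v := fun l => by
      rw [ASp.toMulAut_v, A.τ_v, ASp.apply_inv_apply] }⟩

theorem smul_L (a : D.ASp) (A : D.ELag) :
    (a • A).L = A.L.map (a.g.1 : Red R W →ₗ[R] Red R W) := rfl

theorem smul_τ (a : D.ASp) (A : D.ELag) (l : (a • A).L) :
    (a • A).τ l = ASp.toMulAut a (A.τ ⟨(a.g⁻¹).1 l, inv_mem a A l⟩) := rfl

instance : MulAction D.ASp D.ELag where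
  one_smul A := by
    refine ext' (Submodule.map_id _) fun v h1 h2 => ?_
    rw [smul_τ, map_one]
    rfl
  mul_smul a b A := by
    refine ext' (Submodule.map_comp _ _ _) fun v h1 h2 => ?_
    rw [smul_τ, smul_τ, smul_τ, map_mul]
    show ASp.toMulAut a (ASp.toMulAut b _) = _
    congr 4

theorem apply_mem (a : D.ASp) (A : D.ELag) (l : A.L) : a.g.1 l ∈ (a • A).L := ⟨l, l.2, rfl⟩

theorem toMulAut_τ (a : D.ASp) (A : D.ELag) (l : A.L) :
    ASp.toMulAut a (A.τ l) = (a • A).τ ⟨a.g.1 l, apply_mem a A l⟩ := by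
  rw [smul_τ]
  congr 2
  exact Subtype.ext (ASp.inv_apply_apply _ _).symm

end ELag

/-! ## The models of the Heisenberg representation -/

variable (R) in
/-- The character `ψ(z) = exp((2πi/4) tr z)` of `R`. -/
def psi : AddChar R ℂ :=
  (ZMod.stdAddChar (N := 4)).compAddMonoidHom (Algebra.trace (ZMod 4) R).toAddMonoidHom

/-- The space `𝓗_L` of functions on `H(V)` with `f(z · τ(l) · h) = ψ(z) f(h)`. -/
def model (A : D.ELag) : Submodule ℂ (D.Heis → ℂ) where
  carrier := {f | ∀ z l h, f (Heis.central z * A.τ l * h) = psi R z * f h}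
  add_mem' {f g} hf hg z l h := by
    simp only [Pi.add_apply, hf z l h, hg z l h, mul_add]
  zero_mem' z l h := by simp
  smul_mem' c f hf z l h := by
    simp only [Pi.smul_apply, hf z l h, smul_eq_mul]; ring

/-- The action of `H(V)` on `𝓗_L` by right translations. The spaces `𝓗_L` with these actions form
the `H(V)`-vector bundle `𝔥` on the set of enhanced Lagrangians. -/
def modelRep (A : D.ELag) : Representation ℂ D.Heis (D.model A) where
  toFun k :=
    { toFun := fun f => ⟨fun h => f.1 (h * k), fun z l h => by
        beta_reduce
        rw [mul_assoc _ h k]; exact f.2 z l (h * k)⟩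
      map_add' := fun _ _ => rfl
      map_smul' := fun _ _ => rfl }
  map_one' := by
    ext f h
    exact congrArg f.1 (mul_one h)
  map_mul' k k' := by
    ext f h
    exact congrArg f.1 (mul_assoc h k k').symm

/-- The equivariant structure `θ_g : 𝓗_{gL} → 𝓗_L`, `f ↦ f ∘ g`. -/
def theta (g : D.ASp) (A : D.ELag) :
    D.model (g • A) ≃ₗ[ℂ] D.model A where
  toFun f := ⟨fun h => f.1 (ASp.toMulAut g h), fun z l h => by
    beta_reduce
    rw [map_mul, map_mul, ASp.toMulAut_central, ELag.toMulAut_τ]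
    exact f.2 z _ _⟩
  invFun f := ⟨fun h => f.1 ((ASp.toMulAut g).symm h), fun z l h => by
    obtain ⟨l, rfl⟩ : ∃ l' : A.L, (⟨g.g.1 l', ELag.apply_mem g A l'⟩ : (g • A).L) = l :=
      ⟨⟨_, ELag.inv_mem g A l⟩, Subtype.ext (ASp.apply_inv_apply _ _)⟩
    beta_reduce
    rw [← ELag.toMulAut_τ, map_mul, map_mul, MulEquiv.symm_apply_apply,
      (MulEquiv.symm_apply_eq _).2 (ASp.toMulAut_central g z).symm]
    exact f.2 z l _⟩
  left_inv f := Subtype.ext (funext fun h => congrArg f.1 (MulEquiv.apply_symm_apply _ h))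
  right_inv f := Subtype.ext (funext fun h => congrArg f.1 (MulEquiv.symm_apply_apply _ h))
  map_add' _ _ := rfl
  map_smul' _ _ := rfl

theorem theta_intertwines (g : D.ASp) (A : D.ELag) (h : D.Heis)
    (f : D.model (g • A)) :
    D.theta g A (D.modelRep (g • A) (ASp.toMulAut g h) f) =
      D.modelRep A h (D.theta g A f) :=
  Subtype.ext (funext fun k => congrArg f.1 (map_mul (ASp.toMulAut g) k h).symm)

theorem fiberCast_model {A B : D.ELag} (h : A = B) (f : D.model A) :
    (fiberCast (fun A => D.model A) h f).1 = f.1 := by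
  subst h; rfl

theorem theta_one (A : D.ELag) {g : D.ASp} (hg : g = 1) (h : g • A = A) (f : D.model (g • A)) :
    D.theta g A f = fiberCast (fun A => D.model A) h f := by
  refine Subtype.ext ?_
  rw [fiberCast_model]
  refine funext fun k => congrArg f.1 ?_
  rw [hg, map_one]
  rfl

theorem theta_mul (g k : D.ASp) (A : D.ELag) (f : D.model ((g * k) • A)) :
    D.theta (g * k) A f =
      D.theta k A (D.theta g (k • A) (fiberCast (fun A => D.model A) (mul_smul g k A) f)) := by
  refine Subtype.ext (funext fun h => ?_)
  show f.1 (ASp.toMulAut (g * k) h) =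
    (fiberCast (fun A => D.model A) (mul_smul g k A) f).1 (ASp.toMulAut g (ASp.toMulAut k h))
  rw [fiberCast_model, map_mul]
  rfl

/-! ## The canonical trivialization of `𝔥^{⊗4}` -/

section Canonical

variable [Finite R] [Module.Finite R W]

instance finite_lagrangian (A : D.ELag) : Finite A.L :=
  haveI : Finite (Red R W) := Module.finite_of_finite R
  inferInstance

/-- The canonical intertwining morphism `F_{M,L} : 𝓗_L → 𝓗_M`,
`F_{M,L}[f](h) = ∑_{m ∈ M} f(τ(m) h)`. -/
def intertwiner (M L : D.ELag) : D.model L →ₗ[ℂ] D.model M where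
  toFun f := ⟨fun h => ∑ᶠ m : M.L, f.1 (M.τ m * h), fun z l h => by
    have h1 : ∀ m : M.L, f.1 (M.τ m * (Heis.central z * M.τ l * h)) =
        psi R z * f.1 (M.τ (m + l) * h) := fun m => by
      have h2 := f.2 z 0 (M.τ (m + l) * h)
      rw [ELag.τ_zero, mul_one] at h2
      rw [← h2, M.τ_add, ← mul_assoc, ← mul_assoc, ← mul_assoc, ← mul_assoc,
        Heis.central_comm z (M.τ m)]
    simp only [h1]
    refine (smul_finsum (psi R z) fun m : M.L => f.1 (M.τ (m + l) * h)).symm.trans ?_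
    rw [smul_eq_mul]
    congr 1
    exact finsum_comp_equiv (Equiv.addRight l) (f := fun m : M.L => f.1 (M.τ m * h))⟩
  map_add' f g := Subtype.ext (funext fun h =>
    finsum_add_distrib (Set.toFinite _) (Set.toFinite _))
  map_smul' c f := Subtype.ext (funext fun h =>
    (smul_finsum c fun m : M.L => f.1 (M.τ m * h)).symm)

/-- Two enhanced Lagrangians are in general position if `M + L = V`. -/
def Transversal (M L : D.ELag) : Prop := M.L ⊔ L.L = ⊤

/-- The normalization coefficient `A_{M,L} = (-1)^{d n} / |M|²`, where `d` is the rank of `R`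
over `ℤ/4` (the degree `[K : ℚ₂]`) and `2 n` is the rank of `W` over `R`. -/
def normCoeff (M : D.ELag) : ℂ :=
  (-1) ^ (Module.finrank (ZMod 4) R * (Module.finrank R W / 2)) / (Nat.card M.L : ℂ) ^ 2

/-- A trivialization of `𝔥^{⊗4}` is canonical if it extends the partial trivialization
`T_{M,L} = A_{M,L} F_{M,L}^{⊗4}`, given on pairs in general position. -/
def IsCanonical (T : Trivialization (tensorRep 4 D.modelRep)) : Prop :=
  ∀ M L : D.ELag, D.Transversal M L →
    (T.map M L).toLinearMap = D.normCoeff M • tpow 4 (D.intertwiner M L)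

open Classical in
/-- The canonical system `T_{M,L} : 𝓗_L^{⊗4} → 𝓗_M^{⊗4}`: the unique trivialization of `𝔥^{⊗4}`
which extends the partial one (with value `0` in case there were no such unique extension). -/
def canonicalT (M L : D.ELag) :
    (⨂[ℂ] _ : Fin 4, D.model L) →ₗ[ℂ] (⨂[ℂ] _ : Fin 4, D.model M) :=
  if h : ∃! T : Trivialization (tensorRep 4 D.modelRep), D.IsCanonical T then
    (h.choose.map M L).toLinearMap
  else 0

theorem transversal_smul (g : D.ASp) {M L : D.ELag} (h : D.Transversal M L) :
    D.Transversal (g • M) (g • L) := by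
  unfold Transversal at *
  rw [ELag.smul_L, ELag.smul_L, ← Submodule.map_sup, h, Submodule.map_top, LinearEquiv.range]

/-- `m ↦ g m`, as a bijection `M ≃ g M`. -/
def smulEquiv (g : D.ASp) (M : D.ELag) : M.L ≃ (g • M).L where
  toFun m := ⟨g.g.1 m, ELag.apply_mem g M m⟩
  invFun m := ⟨_, ELag.inv_mem g M m⟩
  left_inv _ := Subtype.ext (ASp.inv_apply_apply _ _)
  right_inv _ := Subtype.ext (ASp.apply_inv_apply _ _)

theorem normCoeff_smul (g : D.ASp) (M : D.ELag) : D.normCoeff (g • M) = D.normCoeff M := by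
  unfold normCoeff
  rw [Nat.card_congr (D.smulEquiv g M)]

theorem theta_intertwiner (g : D.ASp) (M L : D.ELag) (f : D.model (g • L)) :
    D.theta g M (D.intertwiner (g • M) (g • L) f) = D.intertwiner M L (D.theta g L f) := by
  refine Subtype.ext (funext fun h => ?_)
  show ∑ᶠ m : (g • M).L, f.1 ((g • M).τ m * ASp.toMulAut g h) =
    ∑ᶠ m : M.L, f.1 (ASp.toMulAut g (M.τ m * h))
  rw [← finsum_comp_equiv (D.smulEquiv g M)]
  refine finsum_congr fun m => ?_
  rw [map_mul, ELag.toMulAut_τ]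
  rfl

/-- `θ_g^{⊗4}` as an isomorphism. -/
def theta4 (g : D.ASp) (A : D.ELag) :
    (⨂[ℂ] _ : Fin 4, D.model (g • A)) ≃ₗ[ℂ] (⨂[ℂ] _ : Fin 4, D.model A) :=
  LinearEquiv.ofLinearMap (tpow 4 (D.theta g A).toLinearMap) (tpow 4 (D.theta g A).symm.toLinearMap)
    (by rw [← tpow_comp]; simp)
    (by rw [← tpow_comp]; simp)

theorem theta4_toLinearMap (g : D.ASp) (A : D.ELag) :
    (D.theta4 g A).toLinearMap = tpow 4 (D.theta g A).toLinearMap := rfl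

theorem theta4_intertwines (g : D.ASp) (A : D.ELag) (h : Fin 4 → D.Heis) :
    (D.theta4 g A).toLinearMap ∘ₗ
        tensorRep 4 D.modelRep (g • A) (fun i => ASp.toMulAut g (h i)) =
      tensorRep 4 D.modelRep A h ∘ₗ (D.theta4 g A).toLinearMap := by
  refine (PiTensorProduct.map_comp _ _).symm.trans (Eq.trans ?_ (PiTensorProduct.map_comp _ _))
  congr 1
  funext i
  exact LinearMap.ext fun f => D.theta_intertwines g A (h i) f

/-- The conjugate of a trivialization of `𝔥^{⊗4}` by `θ_g^{⊗4}`. -/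
def conjT (g : D.ASp) (T : Trivialization (tensorRep 4 D.modelRep)) :
    Trivialization (tensorRep 4 D.modelRep) where
  map M L := (D.theta4 g L).symm ≪≫ₗ T.map (g • M) (g • L) ≪≫ₗ D.theta4 g M
  intertwines M L h x := by
    obtain ⟨y, rfl⟩ := (D.theta4 g L).surjective x
    have h1 := LinearMap.congr_fun (D.theta4_intertwines g L h) y
    have h2 := LinearMap.congr_fun (D.theta4_intertwines g M h) (T.map (g • M) (g • L) y)
    simp only [LinearMap.comp_apply, LinearEquiv.coe_coe] at h1 h2
    rw [← h1]
    simp only [LinearEquiv.trans_apply, LinearEquiv.symm_apply_apply]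
    rw [T.intertwines, h2]
  mul N M L x := by
    simp only [LinearEquiv.trans_apply, LinearEquiv.symm_apply_apply, T.mul]

theorem isCanonical_conjT (g : D.ASp) {T : Trivialization (tensorRep 4 D.modelRep)}
    (hT : D.IsCanonical T) : D.IsCanonical (D.conjT g T) := by
  intro M L h
  have h1 := hT _ _ (D.transversal_smul g h)
  have h2 : (D.theta g M).toLinearMap ∘ₗ D.intertwiner (g • M) (g • L) =
      D.intertwiner M L ∘ₗ (D.theta g L).toLinearMap :=
    LinearMap.ext fun f => D.theta_intertwiner g M L f
  have h3 : (D.theta4 g M).toLinearMap ∘ₗ (T.map (g • M) (g • L)).toLinearMap =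
      (D.normCoeff M • tpow 4 (D.intertwiner M L)) ∘ₗ (D.theta4 g L).toLinearMap := by
    rw [h1, normCoeff_smul, theta4_toLinearMap, theta4_toLinearMap, LinearMap.comp_smul,
      LinearMap.smul_comp]
    congr 1
    exact (tpow_comp 4 _ _).symm.trans ((congrArg _ h2).trans (tpow_comp 4 _ _))
  refine LinearMap.ext fun x => ?_
  obtain ⟨y, rfl⟩ := (D.theta4 g L).surjective x
  have h4 := LinearMap.congr_fun h3 y
  simpa [conjT] using h4

/-- The canonical system is `ASp(V)`-equivariant. -/
theorem theta_canonicalT (g : D.ASp) (M L : D.ELag) :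
    tpow 4 (D.theta g M).toLinearMap ∘ₗ D.canonicalT (g • M) (g • L) =
      D.canonicalT M L ∘ₗ tpow 4 (D.theta g L).toLinearMap := by
  by_cases h : ∃! T : Trivialization (tensorRep 4 D.modelRep), D.IsCanonical T
  · have h1 : D.conjT g h.choose = h.choose :=
      h.choose_spec.2 _ (D.isCanonical_conjT g h.choose_spec.1)
    simp only [canonicalT, dif_pos h]
    refine LinearMap.ext fun x => ?_
    have h2 : (D.conjT g h.choose).map M L (D.theta4 g L x) = h.choose.map M L (D.theta4 g L x) := by
      rw [h1]
    simp only [conjT, LinearEquiv.trans_apply, LinearEquiv.symm_apply_apply] at h2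
    exact h2
  · simp only [canonicalT, dif_neg h]
    rw [LinearMap.zero_comp, LinearMap.comp_zero]

/-! ## The Weil gerbe -/

/-- An object `(𝔈, {E_{M,L}}, φ)` of the Weil gerbe: an `H(V)`-vector bundle `𝔈` on the set of
enhanced Lagrangians, a trivialization of `𝔈`, and an isomorphism `φ : 𝔈 → 𝔥` of `H(V)`-vector
bundles such that `φ^{⊗4} : 𝔈^{⊗4} → 𝔥^{⊗4}` is an isomorphism of trivialized bundles. -/
structure WeilGerbe : Type (u + 1) where
  /-- the fibres of `𝔈` -/
  fiber : D.ELag → Type u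
  [addCommGroup : ∀ L, AddCommGroup (fiber L)]
  [module : ∀ L, Module ℂ (fiber L)]
  /-- the Heisenberg action on the fibres -/
  π : ∀ L, Representation ℂ D.Heis (fiber L)
  /-- the trivialization -/
  triv : Trivialization π
  /-- the isomorphism with `𝔥` -/
  φ : ∀ L, fiber L ≃ₗ[ℂ] D.model L
  φ_intertwines : ∀ L h x, φ L (π L h x) = D.modelRep L h (φ L x)
  φ_tpow : ∀ M L, tpow 4 (φ M).toLinearMap ∘ₗ tpow 4 (triv.map M L).toLinearMap =
    D.canonicalT M L ∘ₗ tpow 4 (φ L).toLinearMap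

attribute [instance] WeilGerbe.addCommGroup WeilGerbe.module

namespace WeilGerbe

variable {D}

/-- A morphism of the Weil gerbe: an isomorphism `f` of trivialized `H(V)`-vector bundles with
`φ₂^{⊗4} ∘ f^{⊗4} = φ₁^{⊗4}`. -/
structure Hom (E F : D.WeilGerbe) : Type u where
  /-- the map on the fibres -/
  map : ∀ L, E.fiber L ≃ₗ[ℂ] F.fiber L
  intertwines : ∀ L h x, map L (E.π L h x) = F.π L h (map L x)
  map_triv : ∀ M L x, map M (E.triv.map M L x) = F.triv.map M L (map L x)
  map_tpow : ∀ L, tpow 4 (F.φ L).toLinearMap ∘ₗ tpow 4 (map L).toLinearMap =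
    tpow 4 (E.φ L).toLinearMap

theorem Hom.ext {E F : D.WeilGerbe} {f g : Hom E F} (h : ∀ L x, f.map L x = g.map L x) :
    f = g := by
  obtain ⟨f, _, _, _⟩ := f
  obtain ⟨g, _, _, _⟩ := g
  obtain rfl : f = g := funext fun L => LinearEquiv.ext (h L)
  rfl

/-- The identity morphism. -/
def Hom.id (E : D.WeilGerbe) : Hom E E where
  map L := LinearEquiv.refl ℂ _
  intertwines _ _ _ := rfl
  map_triv _ _ _ := rfl
  map_tpow L := by
    rw [LinearEquiv.refl_toLinearMap, tpow_id, LinearMap.comp_id]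

/-- Composition of morphisms. -/
def Hom.comp {E F H : D.WeilGerbe} (f : Hom E F) (g : Hom F H) : Hom E H where
  map L := f.map L ≪≫ₗ g.map L
  intertwines L h x := by
    simp only [LinearEquiv.trans_apply, f.intertwines, g.intertwines]
  map_triv M L x := by
    simp only [LinearEquiv.trans_apply, f.map_triv, g.map_triv]
  map_tpow L := by
    rw [LinearEquiv.coe_trans, tpow_comp, ← LinearMap.comp_assoc, g.map_tpow, f.map_tpow]

/-- The inverse of a morphism. -/
def Hom.inv {E F : D.WeilGerbe} (f : Hom E F) : Hom F E where
  map L := (f.map L).symm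
  intertwines L h x := by
    rw [LinearEquiv.symm_apply_eq, f.intertwines, LinearEquiv.apply_symm_apply]
  map_triv M L x := by
    rw [LinearEquiv.symm_apply_eq, f.map_triv, LinearEquiv.apply_symm_apply]
  map_tpow L := by
    rw [← f.map_tpow, LinearMap.comp_assoc, ← tpow_comp, LinearEquiv.comp_symm, tpow_id,
      LinearMap.comp_id]

instance : Category D.WeilGerbe where
  Hom E F := Hom E F
  id E := Hom.id E
  comp f g := Hom.comp f g

@[simp] theorem id_map (E : D.WeilGerbe) (L) (x : E.fiber L) : Hom.map (𝟙 E) L x = x := rfl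

@[simp] theorem comp_map {E F H : D.WeilGerbe} (f : E ⟶ F) (g : F ⟶ H) (L) (x : E.fiber L) :
    Hom.map (f ≫ g) L x = Hom.map g L (Hom.map f L x) := rfl

theorem hom_ext {E F : D.WeilGerbe} {f g : E ⟶ F} (h : ∀ L x, Hom.map f L x = Hom.map g L x) :
    f = g := Hom.ext h

/-- Every morphism is an isomorphism. -/
def Hom.toIso {E F : D.WeilGerbe} (f : Hom E F) : E ≅ F where
  hom := f
  inv := f.inv
  hom_inv_id := hom_ext fun L x => (f.map L).symm_apply_apply x
  inv_hom_id := hom_ext fun L x => (f.map L).apply_symm_apply x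

@[simp] theorem toIso_hom {E F : D.WeilGerbe} (f : Hom E F) : f.toIso.hom = f := rfl

/-- The pull-back `g^* 𝔈`, with fibres `𝔈_{gL}`, the `g`-twisted Heisenberg action, trivialization
`E_{gM,gL}` and the isomorphism `θ_g ∘ g^*φ` with `𝔥`. -/
def pullObj (g : D.ASp) (E : D.WeilGerbe) : D.WeilGerbe where
  fiber L := E.fiber (g • L)
  π L := (E.π (g • L)).comp (ASp.toMulAut g).toMonoidHom
  triv :=
    { map := fun M L => E.triv.map (g • M) (g • L)
      intertwines := fun M L h x => E.triv.intertwines _ _ _ _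
      mul := fun N M L x => E.triv.mul _ _ _ _ }
  φ L := E.φ (g • L) ≪≫ₗ D.theta g L
  φ_intertwines L h x := by
    rw [LinearEquiv.trans_apply, LinearEquiv.trans_apply, ← theta_intertwines,
      ← E.φ_intertwines]
    rfl
  φ_tpow M L := by
    rw [LinearEquiv.coe_trans, LinearEquiv.coe_trans, tpow_comp, tpow_comp, LinearMap.comp_assoc,
      E.φ_tpow, ← LinearMap.comp_assoc, theta_canonicalT, LinearMap.comp_assoc]

/-- The pull-back functor `g^*` on the Weil gerbe. -/
def pull (g : D.ASp) : D.WeilGerbe ⥤ D.WeilGerbe where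
  obj E := pullObj g E
  map {E F} f :=
    { map := fun L => Hom.map f (g • L)
      intertwines := fun L h x => Hom.intertwines f _ _ _
      map_triv := fun M L x => Hom.map_triv f _ _ _
      map_tpow := fun L => by
        show tpow 4 (F.φ (g • L) ≪≫ₗ D.theta g L).toLinearMap ∘ₗ
          tpow 4 (Hom.map f (g • L) : E.fiber (g • L) ≃ₗ[ℂ] F.fiber (g • L)).toLinearMap =
          tpow 4 (E.φ (g • L) ≪≫ₗ D.theta g L).toLinearMap
        rw [LinearEquiv.coe_trans, LinearEquiv.coe_trans, tpow_comp, tpow_comp,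
          LinearMap.comp_assoc, Hom.map_tpow f] }
  map_id _ := rfl
  map_comp _ _ := rfl

/-- The tautological isomorphism `1^* ≅ Id`. -/
def pullOne (g : D.ASp) (hg : g = 1) : pull g ≅ 𝟭 D.WeilGerbe :=
  NatIso.ofComponents (fun E => Hom.toIso
    { map := fun L => fiberCast E.fiber (show g • L = L by rw [hg, one_smul])
      intertwines := fun L h x => by
        have h1 : ASp.toMulAut g h = h := by rw [hg, map_one]; rfl
        show fiberCast E.fiber _ (E.π (g • L) (ASp.toMulAut g h) x) = _
        rw [h1]
        exact fiberCast_rep E.π _ h x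
      map_triv := fun M L x => fiberCast_triv E.triv _ _ x
      map_tpow := fun L => by
        show _ = tpow 4 (E.φ (g • L) ≪≫ₗ D.theta g L).toLinearMap
        refine (tpow_comp 4 _ _).symm.trans (congrArg _ (LinearMap.ext fun x => ?_))
        have h2 : g • L = L := by rw [hg, one_smul]
        exact (fiberCast_map E.φ h2 x).symm.trans (D.theta_one L hg h2 _).symm })
    (fun {E F} f => hom_ext fun L x =>
      (fiberCast_map (E := E.fiber) (F := F.fiber) (Hom.map f)
        (show g • L = L by rw [hg, one_smul]) x))

/-- The tautological isomorphism `(gh)^* ≅ h^* ∘ g^*`. -/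
def pullMul (g k : D.ASp) : pull (g * k) ≅ pull g ⋙ pull k :=
  NatIso.ofComponents (fun E => Hom.toIso
    { map := fun L => fiberCast E.fiber (mul_smul g k L)
      intertwines := fun L h x => by
        have h1 : ASp.toMulAut (g * k) h = ASp.toMulAut g (ASp.toMulAut k h) := by
          rw [map_mul]; rfl
        show fiberCast E.fiber _ (E.π ((g * k) • L) (ASp.toMulAut (g * k) h) x) = _
        rw [h1]
        exact fiberCast_rep E.π _ _ x
      map_triv := fun M L x => fiberCast_triv E.triv _ _ x
      map_tpow := fun L => by
        show _ = tpow 4 (E.φ ((g * k) • L) ≪≫ₗ D.theta (g * k) L).toLinearMap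
        refine (tpow_comp 4 _ _).symm.trans (congrArg _ (LinearMap.ext fun x => ?_))
        show D.theta k L (D.theta g (k • L) (E.φ _ (fiberCast E.fiber (mul_smul g k L) x))) =
          D.theta (g * k) L (E.φ _ x)
        exact ((D.theta_mul g k L (E.φ _ x)).trans
          (congrArg (fun y => D.theta k L (D.theta g (k • L) y))
            (fiberCast_map E.φ (mul_smul g k L) x))).symm })
    (fun {E F} f => hom_ext fun L x =>
      (fiberCast_map (E := E.fiber) (F := F.fiber) (Hom.map f) (mul_smul g k L) x))

/-- Multiplication by a 4th root of unity, as an automorphism of the identity functor. -/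
def scalar (ζ : rootsOfUnity 4 ℂ) : 𝟭 D.WeilGerbe ≅ 𝟭 D.WeilGerbe :=
  NatIso.ofComponents (fun E => Hom.toIso
    { map := fun L => LinearEquiv.smulOfUnit (ζ : ℂˣ)
      intertwines := fun L h x => ((E.π L h).map_smul ((ζ : ℂˣ) : ℂ) x).symm
      map_triv := fun M L x => ((E.triv.map M L).map_smul ((ζ : ℂˣ) : ℂ) x).symm
      map_tpow := fun L => by
        have h1 : (((ζ : ℂˣ) : ℂ)) ^ 4 = 1 := by
          have := ζ.2
          rw [mem_rootsOfUnity] at this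
          rw [← Units.val_pow_eq_pow_val, this, Units.val_one]
        have h2 : (LinearEquiv.smulOfUnit (ζ : ℂˣ) : E.fiber L ≃ₗ[ℂ] E.fiber L).toLinearMap =
            ((ζ : ℂˣ) : ℂ) • LinearMap.id := LinearMap.ext fun x => rfl
        show tpow 4 (E.φ L).toLinearMap ∘ₗ tpow 4
          (LinearEquiv.smulOfUnit (ζ : ℂˣ) : E.fiber L ≃ₗ[ℂ] E.fiber L).toLinearMap = _
        rw [h2, tpow_smul, h1, one_smul, LinearMap.comp_id]
        rfl })
    (fun {E F} f => hom_ext fun L x =>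
      ((Hom.map f L).map_smul ((ζ : ℂˣ) : ℂ) x).symm)

end WeilGerbe

/-! ## The affine metaplectic group -/

/-- The affine metaplectic group `AMp(V)`: pairs `(g, ι)` with `g ∈ ASp(V)` and `ι : g^* ≅ Id` an
isomorphism of functors on the Weil gerbe. -/
structure AMp : Type (u + 1) where
  /-- the element of `ASp(V)` -/
  g : D.ASp
  /-- the isomorphism of functors `g^* ≅ Id` -/
  ι : WeilGerbe.pull g ≅ 𝟭 D.WeilGerbe

namespace AMp

variable {D}

open WeilGerbe

/-- The component `𝔈_{gL} → 𝔈_L` of `ι` at an object `𝔈`. -/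
def app (a : D.AMp) (E : D.WeilGerbe) (L : D.ELag) : E.fiber (a.g • L) ≃ₗ[ℂ] E.fiber L :=
  Hom.map (a.ι.hom.app E) L

theorem ext {a b : D.AMp} (h : a.g = b.g) (h' : ∀ E L (x : E.fiber (a.g • L)),
    a.app E L x = b.app E L (fiberCast E.fiber (by rw [h]) x)) : a = b := by
  obtain ⟨g, ι⟩ := a
  obtain ⟨k, κ⟩ := b
  obtain rfl : g = k := h
  obtain rfl : ι = κ := by
    ext E : 3
    exact hom_ext fun L x => h' E L x
  rfl

/-- `(g, ι_g) · (h, ι_h) = (g h, ι_h ∘ h^*(ι_g))`. -/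
instance : Mul D.AMp := ⟨fun a b =>
  ⟨a.g * b.g, pullMul a.g b.g ≪≫ Functor.isoWhiskerRight a.ι (pull b.g) ≪≫
    (pull b.g).leftUnitor ≪≫ b.ι⟩⟩

instance : One D.AMp := ⟨⟨1, pullOne 1 rfl⟩⟩

/-- `(g, ι_g)⁻¹ = (g⁻¹, (g⁻¹)^*(ι_g⁻¹))`. -/
instance : Inv D.AMp := ⟨fun a =>
  ⟨a.g⁻¹, (pull a.g⁻¹).leftUnitor.symm ≪≫ Functor.isoWhiskerRight a.ι.symm (pull a.g⁻¹) ≪≫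
    (pullMul a.g a.g⁻¹).symm ≪≫ pullOne (a.g * a.g⁻¹) (mul_inv_cancel _)⟩⟩

@[simp] theorem mul_g (a b : D.AMp) : (a * b).g = a.g * b.g := rfl
@[simp] theorem one_g : (1 : D.AMp).g = 1 := rfl
@[simp] theorem inv_g (a : D.AMp) : (a⁻¹).g = a.g⁻¹ := rfl

theorem app_mul (a b : D.AMp) (E : D.WeilGerbe) (L) (x : E.fiber ((a.g * b.g) • L)) :
    (a * b).app E L x =
      b.app E L (a.app E (b.g • L) (fiberCast E.fiber (mul_smul a.g b.g L) x)) := rfl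

theorem app_one (E : D.WeilGerbe) (L) (x : E.fiber ((1 : D.ASp) • L)) :
    (1 : D.AMp).app E L x = fiberCast E.fiber (one_smul _ L) x := rfl

theorem app_cast (a : D.AMp) (E : D.WeilGerbe) {L L' : D.ELag} (h : L = L')
    (x : E.fiber (a.g • L)) : a.app E L' (fiberCast E.fiber (congrArg (a.g • ·) h) x) =
      fiberCast E.fiber h (a.app E L x) := by
  subst h; rfl

theorem inv_app (a : D.AMp) (E : D.WeilGerbe) (L) (x : E.fiber L) :
    Hom.map (a.ι.inv.app E) L x = (a.app E L).symm x := by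
  have h : a.ι.inv.app E ≫ a.ι.hom.app E = 𝟙 _ := a.ι.inv_hom_id_app E
  have h' := congrArg (fun f : Hom E E => f.map L x) h
  exact (LinearEquiv.eq_symm_apply (a.app E L)).2 h'

theorem app_inv (a : D.AMp) (E : D.WeilGerbe) (L) (x : E.fiber (a.g⁻¹ • L)) :
    (a⁻¹).app E L x =
      fiberCast E.fiber (smul_inv_smul a.g L) ((a.app E (a.g⁻¹ • L)).symm x) := by
  have h : ∀ y : E.fiber (a.g • a.g⁻¹ • L),
      (fiberCast E.fiber (mul_smul a.g a.g⁻¹ L)).symm y =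
        fiberCast E.fiber (mul_smul a.g a.g⁻¹ L).symm y := fun y => by
    rw [LinearEquiv.symm_apply_eq, fiberCast_trans, fiberCast_rfl]
  have h1 : (a.g * a.g⁻¹) • L = L := by rw [mul_inv_cancel, one_smul]
  exact (congrArg (fiberCast E.fiber h1) ((h _).trans (congrArg _ (inv_app a E _ x)))).trans
    (fiberCast_trans _ h1 _)

instance : Group D.AMp :=
  Group.ofLeftAxioms
    (fun a b c => by
      refine ext (mul_assoc _ _ _) fun E L x => ?_
      rw [app_mul (a * b) c, app_mul a b, app_mul a (b * c), app_mul b c]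
      refine congrArg (fun y => c.app E L (b.app E (c.g • L) y))
        (Eq.trans ?_ (app_cast a E (mul_smul b.g c.g L) _))
      simp only [fiberCast_trans])
    (fun a => by
      refine ext (one_mul _) fun E L x => ?_
      rw [app_mul 1 a, app_one, fiberCast_trans])
    (fun a => by
      refine ext (inv_mul_cancel _) fun E L x => ?_
      rw [app_mul a⁻¹ a, app_inv, app_one,
        app_cast a E (inv_smul_smul a.g L), LinearEquiv.apply_symm_apply,
        fiberCast_trans, fiberCast_trans])

/-- The projection `AMp(V) → ASp(V)`. -/
def proj : D.AMp →* D.ASp where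
  toFun := AMp.g
  map_one' := rfl
  map_mul' _ _ := rfl

/-- The inclusion `μ₄ → AMp(V)`, `ζ ↦ (1, ζ)`. -/
def incl : rootsOfUnity 4 ℂ →* D.AMp where
  toFun ζ := ⟨1, pullOne 1 rfl ≪≫ scalar ζ⟩
  map_one' := ext rfl fun E L x => one_smul ℂ (fiberCast E.fiber (one_smul _ L) x)
  map_mul' ζ ξ := by
    refine ext (mul_one 1).symm fun E L x => ?_
    let z : ℂ := ((ζ : ℂˣ) : ℂ)
    let w : ℂ := ((ξ : ℂˣ) : ℂ)
    have h1 : (1 : D.ASp) • L = L := one_smul _ L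
    have h2 : (1 : D.ASp) • (1 : D.ASp) • L = (1 : D.ASp) • L := one_smul _ _
    have h3 : ((1 : D.ASp) * 1) • L = (1 : D.ASp) • (1 : D.ASp) • L := mul_smul _ _ _
    have h4 : (1 : D.ASp) • L = ((1 : D.ASp) * 1) • L := by rw [mul_one]
    show (z * w) • fiberCast E.fiber h1 x =
      w • fiberCast E.fiber h1 (z • fiberCast E.fiber h2 (fiberCast E.fiber h3
        (fiberCast E.fiber h4 x)))
    rw [map_smul, smul_smul, mul_comm, fiberCast_trans, fiberCast_trans, fiberCast_trans]

end AMp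

/-! ## The canonical model of the Weil representation -/

namespace WeilGerbe

variable {D}

/-- The canonical vector space `Γ(𝔈)` of horizontal sections of `𝔈`. -/
def Gam (E : D.WeilGerbe) : Submodule ℂ (∀ L, E.fiber L) where
  carrier := {f | ∀ M L, E.triv.map M L (f L) = f M}
  add_mem' hf hg M L := by simp [hf M L, hg M L]
  zero_mem' M L := by simp
  smul_mem' c f hf M L := by simp [hf M L]

/-- The Heisenberg representation on `Γ(𝔈)`. -/
def heisRep (E : D.WeilGerbe) : Representation ℂ D.Heis E.Gam where
  toFun h :=
    { toFun := fun f => ⟨fun L => E.π L h (f.1 L), fun M L => by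
        rw [E.triv.intertwines, f.2]⟩
      map_add' := fun f g => Subtype.ext (funext fun L => map_add _ _ _)
      map_smul' := fun c f => Subtype.ext (funext fun L => map_smul _ _ _) }
  map_one' := LinearMap.ext fun f => Subtype.ext (funext fun L => by simp)
  map_mul' h k := LinearMap.ext fun f => Subtype.ext (funext fun L => by simp)

/-- The composition `Γ(𝔈) → Γ(g^*𝔈) → Γ(𝔈)` of the tautological isomorphism with `Γ(ι)`. -/
def transport (E : D.WeilGerbe) (a : D.AMp) : E.Gam →ₗ[ℂ] E.Gam where
  toFun f := ⟨fun L => a.app E L (f.1 (a.g • L)), fun M L => by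
    beta_reduce
    rw [← f.2 (a.g • M) (a.g • L)]
    exact (Hom.map_triv (a.ι.hom.app E) M L _).symm⟩
  map_add' f g := Subtype.ext (funext fun L => map_add _ _ _)
  map_smul' c f := Subtype.ext (funext fun L => map_smul _ _ _)

theorem transport_one (E : D.WeilGerbe) : E.transport 1 = 1 :=
  LinearMap.ext fun f => Subtype.ext (funext fun L => by
    show fiberCast E.fiber (one_smul _ L) (f.1 ((1 : D.ASp) • L)) = f.1 L
    exact fiberCast_section f.1 _)

theorem transport_mul (E : D.WeilGerbe) (a b : D.AMp) :
    E.transport (a * b) = E.transport b * E.transport a :=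
  LinearMap.ext fun f => Subtype.ext (funext fun L => by
    show b.app E L (a.app E (b.g • L) (fiberCast E.fiber (mul_smul a.g b.g L)
      (f.1 ((a.g * b.g) • L)))) = b.app E L (a.app E (b.g • L) (f.1 (a.g • b.g • L)))
    rw [fiberCast_section f.1])

/-- The Weil representation `ρ_𝔈 : AMp(V) → GL(Γ(𝔈))`: the element `(g, ι)` acts by the inverse of
the composition `Γ(𝔈) → Γ(g^*𝔈) → Γ(𝔈)`. (That composition itself reverses products.) -/
def weilRep (E : D.WeilGerbe) : Representation ℂ D.AMp E.Gam where
  toFun a := E.transport a⁻¹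
  map_one' := by rw [inv_one, transport_one]
  map_mul' a b := by rw [mul_inv_rev, transport_mul]

end WeilGerbe

end Canonical

end SplitSymplectic

end

end WeilTwo

namespace WeilTwo

/-- The properties of `𝓞_K / (4)` used below, for `K` unramified over `ℚ₂`. -/
structure IsDyadic (R : Type u) [CommRing R] [Algebra (ZMod 4) R] : Prop where
  free : Module.Free (ZMod 4) R
  exists_eq_two_mul : ∀ r : R, 2 * r = 0 → ∃ s, r = 2 * s
  isUnit_or : ∀ r : R, IsUnit r ∨ ∃ s, r = 2 * s
  psi_two_mul_sq : ∀ x : R, SplitSymplectic.psi R (2 * x ^ 2) = SplitSymplectic.psi R (2 * x)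
  exists_psi_ne_one : ∃ x : R, SplitSymplectic.psi R (2 * x) ≠ 1

theorem isLocalRing_zmod_four : IsLocalRing (ZMod 4) :=
  have : Nontrivial (ZMod 4) := ⟨0, 1, by decide⟩
  IsLocalRing.of_nonunits_add (by
    intro a b ha hb
    simp only [mem_nonunits_iff] at *
    revert a b
    decide)

section Trace

variable (R : Type u) [CommRing R] [Algebra (ZMod 4) R]

theorem psi_two_mul_eq (x : R) : SplitSymplectic.psi R (2 * x) =
    ZMod.stdAddChar (N := 4) (2 * Algebra.trace (ZMod 4) R x) := by
  have : (2 : R) * x = (2 : ZMod 4) • x := by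
    rw [Algebra.smul_def, map_ofNat]
  rw [this]
  show ZMod.stdAddChar (N := 4) (Algebra.trace (ZMod 4) R ((2 : ZMod 4) • x)) = _
  rw [map_smul, smul_eq_mul]

variable [Finite R] [Module.Free (ZMod 4) R]

attribute [local instance] Ideal.Quotient.field in
theorem psi_two_mul_properties [Nontrivial R] (hu : ∀ r : R, IsUnit r ∨ ∃ s, r = 2 * s) :
    (∀ x : R, SplitSymplectic.psi R (2 * x ^ 2) = SplitSymplectic.psi R (2 * x)) ∧
    ∃ x : R, SplitSymplectic.psi R (2 * x) ≠ 1 := by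
  have := isLocalRing_zmod_four
  let p := IsLocalRing.maximalIdeal (ZMod 4)
  let P : Ideal R := p.map (algebraMap (ZMod 4) R)
  have h2p : (2 : ZMod 4) ∈ p := by
    rw [IsLocalRing.mem_maximalIdeal, mem_nonunits_iff]
    decide
  have hp2 : ∀ a : ZMod 4, a ∈ p ↔ 2 * a = 0 := by
    intro a
    rw [IsLocalRing.mem_maximalIdeal, mem_nonunits_iff]
    revert a
    decide
  have h2P : (2 : R) ∈ P := by
    have := Ideal.mem_map_of_mem (algebraMap (ZMod 4) R) h2p
    rwa [map_ofNat] at this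
  have hP2 : P ≤ Ideal.span {(2 : R)} := by
    rw [Ideal.map_le_iff_le_comap]
    intro a ha
    rw [hp2] at ha
    have : a = 0 ∨ a = 2 := by revert a; decide
    rw [Ideal.mem_comap]
    rcases this with rfl | rfl
    · simp
    · rw [map_ofNat]; exact Ideal.mem_span_singleton_self _
  have hP : P.IsMaximal := by
    rw [Ideal.isMaximal_iff]
    refine ⟨fun h => ?_, fun J x _ hx hxJ => ?_⟩
    · obtain ⟨c, hc⟩ := Ideal.mem_span_singleton.1 (hP2 h)
      have h4 := four_eq_zero R
      have : (1 : R) = 0 := by linear_combination (1 + 2 * c) * hc + c ^ 2 * h4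
      exact one_ne_zero this
    · rcases hu x with h | ⟨s, rfl⟩
      · rw [Ideal.eq_top_of_isUnit_mem J hxJ h]; trivial
      · exact (hx (Ideal.mul_mem_right _ _ h2P)).elim
  let k := ZMod 4 ⧸ p
  let l := R ⧸ P
  have ht : ∀ x, Algebra.trace k l (Ideal.Quotient.mk P x) =
    Ideal.Quotient.mk p (Algebra.trace (ZMod 4) R x) := fun x => Algebra.trace_quotient_mk x
  have : Finite k := Finite.of_surjective _ (Ideal.Quotient.mk_surjective (I := p))
  have : Finite l := Finite.of_surjective _ (Ideal.Quotient.mk_surjective (I := P))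
  have : FiniteDimensional k l := Module.Finite.of_finite
  have hpsi : ∀ x y : R, Algebra.trace k l (Ideal.Quotient.mk P x) =
      Algebra.trace k l (Ideal.Quotient.mk P y) ↔
      SplitSymplectic.psi R (2 * x) = SplitSymplectic.psi R (2 * y) := by
    intro x y
    rw [psi_two_mul_eq, psi_two_mul_eq, ZMod.injective_stdAddChar.eq_iff, ht, ht,
      Ideal.Quotient.eq, hp2, mul_sub, sub_eq_zero]
  constructor
  · intro x
    rw [← hpsi, map_pow]
    have : CharP k 2 := by
      refine CharTwo.of_one_ne_zero_of_two_eq_zero one_ne_zero ?_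
      have : Ideal.Quotient.mk p 2 = 0 := Ideal.Quotient.eq_zero_iff_mem.2 h2p
      rwa [map_ofNat] at this
    have : CharP l 2 := by
      refine CharTwo.of_one_ne_zero_of_two_eq_zero one_ne_zero ?_
      have : Ideal.Quotient.mk P 2 = 0 := Ideal.Quotient.eq_zero_iff_mem.2 h2P
      rwa [map_ofNat] at this
    have hk : ∀ c : k, c ^ 2 = c := by
      intro c
      obtain ⟨a, rfl⟩ := Ideal.Quotient.mk_surjective c
      rw [← map_pow, Ideal.Quotient.eq, hp2]
      revert a
      decide
    let F : l →ₐ[k] l :=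
      { frobenius l 2 with
        commutes' := fun c => by
          show (algebraMap k l c) ^ 2 = _
          rw [← map_pow, hk] }
    have hF : Function.Bijective F :=
      Finite.injective_iff_bijective.1 (RingHom.injective F.toRingHom)
    exact Algebra.trace_eq_of_algEquiv (AlgEquiv.ofBijective F hF) (Ideal.Quotient.mk P x)
  · have : Algebra.IsAlgebraic k l := Algebra.IsAlgebraic.of_finite k l
    obtain ⟨y, hy⟩ := Algebra.trace_surjective k l 1
    obtain ⟨x, rfl⟩ := Ideal.Quotient.mk_surjective y
    refine ⟨x, fun h => ?_⟩
    have := (hpsi x 0).2 (by rw [h, mul_zero, AddChar.map_zero_eq_one])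
    rw [hy, map_zero, map_zero] at this
    exact one_ne_zero this

end Trace

theorem isDyadic_truncRing (K : Type u) [Field K] [Algebra ℚ_[2] K] [FiniteDimensional ℚ_[2] K]
    [Algebra ℤ_[2] K] [IsScalarTower ℤ_[2] ℚ_[2] K]
    (hK : (Ideal.span {(2 : RingOfInt K)}).IsMaximal) : IsDyadic (TruncRing K) := by
  have : CharZero K := charZero_of_injective_algebraMap (algebraMap ℚ_[2] K).injective
  have h20 : (2 : RingOfInt K) ≠ 0 := by
    intro h
    have := congrArg (Subtype.val) h
    exact two_ne_zero (α := K) this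
  have hmk : ∀ x : RingOfInt K, (Ideal.Quotient.mk (Ideal.span {(2 : RingOfInt K)} ^ 2) x = 0) ↔
      ∃ y, x = 4 * y := by
    intro x
    rw [Ideal.Quotient.eq_zero_iff_mem, Ideal.span_singleton_pow, Ideal.mem_span_singleton]
    norm_num [dvd_iff_exists_eq_mul_right, -Subtype.exists]
  have htwo : ∀ r : TruncRing K, 2 * r = 0 → ∃ s, r = 2 * s := by
    intro r hr
    obtain ⟨x, rfl⟩ := Ideal.Quotient.mk_surjective r
    rw [← map_ofNat (Ideal.Quotient.mk _), ← map_mul, hmk] at hr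
    obtain ⟨y, hy⟩ := hr
    refine ⟨Ideal.Quotient.mk _ y, ?_⟩
    rw [← map_ofNat (Ideal.Quotient.mk _), ← map_mul]
    congr 1
    apply mul_left_cancel₀ h20
    linear_combination hy
  have hunit : ∀ r : TruncRing K, IsUnit r ∨ ∃ s, r = 2 * s := by
    intro r
    obtain ⟨x, rfl⟩ := Ideal.Quotient.mk_surjective r
    by_cases hx : x ∈ Ideal.span {(2 : RingOfInt K)}
    · right
      obtain ⟨y, rfl⟩ := Ideal.mem_span_singleton.1 hx
      exact ⟨Ideal.Quotient.mk _ y, by rw [map_mul, map_ofNat]⟩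
    · left
      obtain ⟨y, z, hz, h⟩ := hK.exists_inv hx
      obtain ⟨w, rfl⟩ := Ideal.mem_span_singleton.1 hz
      refine IsUnit.of_mul_eq_one (Ideal.Quotient.mk _ (y * (1 + 2 * w))) ?_
      rw [← map_mul, ← sub_eq_zero, ← map_one (Ideal.Quotient.mk _), ← map_sub, hmk]
      exact ⟨-w ^ 2, by linear_combination (1 + 2 * w) * h⟩
  have : Nontrivial (TruncRing K) := by
    refine Ideal.Quotient.nontrivial_iff.2 fun h => hK.ne_top ?_
    exact top_unique (h ▸ Ideal.pow_le_self two_ne_zero)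
  have hfree : Module.Free (ZMod 4) (TruncRing K) := by
    have : Module.Finite ℤ_[2] (RingOfInt K) :=
      IsIntegralClosure.finite ℤ_[2] ℚ_[2] K (RingOfInt K)
    have : Module.IsTorsionFree ℤ_[2] K := by
      rw [Module.isTorsionFree_iff_algebraMap_injective,
        IsScalarTower.algebraMap_eq ℤ_[2] ℚ_[2] K]
      exact (algebraMap ℚ_[2] K).injective.comp (IsFractionRing.injective ℤ_[2] ℚ_[2])
    have : Module.Free ℤ_[2] (RingOfInt K) :=
      IsIntegralClosure.module_free ℤ_[2] ℚ_[2] K (RingOfInt K)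
    let _ : Module (ZMod 4) (TruncRing K) := Algebra.toModule
    let b := Module.Free.chooseBasis ℤ_[2] (RingOfInt K)
    let ι := Module.Free.ChooseBasisIndex ℤ_[2] (RingOfInt K)
    let q : RingOfInt K →+* TruncRing K := Ideal.Quotient.mk _
    let t : ℤ_[2] →+* ZMod 4 := PadicInt.toZModPow 2
    have htq : ∀ (c : ℤ_[2]) x, q (c • x) = t c • q x := by
      intro c x
      have : ((q.comp (algebraMap ℤ_[2] (RingOfInt K)))) =
        (algebraMap (ZMod 4) (TruncRing K)).comp t := by
        have hker : RingHom.ker t ≤ RingHom.ker (q.comp (algebraMap ℤ_[2] (RingOfInt K))) := by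
          intro e he
          rw [show RingHom.ker t = _ from PadicInt.ker_toZModPow 2, Ideal.mem_span_singleton] at he
          obtain ⟨f, rfl⟩ := he
          rw [RingHom.mem_ker, RingHom.comp_apply, map_mul, map_mul]
          have : q (algebraMap ℤ_[2] (RingOfInt K) ((2 : ℕ) ^ 2 : ℤ_[2])) = 0 := by
            rw [← Nat.cast_pow, map_natCast, map_natCast]
            exact four_eq_zero_truncRing K
          rw [this, zero_mul]
        have hs : Function.Surjective t := ZMod.ringHom_surjective t
        refine (RingHom.liftOfSurjective_comp t hs ⟨_, hker⟩).symm.trans ?_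
        congr 1
        exact RingHom.ext_zmod _ _
      rw [Algebra.smul_def, Algebra.smul_def, map_mul]
      congr 1
      exact RingHom.congr_fun this c
    have hs : Function.Surjective t := ZMod.ringHom_surjective t
    refine Module.Free.of_basis (ι := ι) (Module.Basis.mk (v := fun i => q (b i)) ?_ ?_)
    · rw [Fintype.linearIndependent_iff]
      intro g hg i
      choose g' hg' using fun i => hs (g i)
      have h1 : q (∑ i, g' i • b i) = 0 := by
        rw [map_sum, ← hg]
        exact Finset.sum_congr rfl fun i _ => by rw [htq, hg']
      obtain ⟨y, hy⟩ := (hmk _).1 h1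
      have h2 : g' i = 4 * b.repr y i := by
        have := congrArg (fun z => b.repr z i) hy
        rw [b.repr_sum_self] at this
        rw [this]
        have h4 : (4 : RingOfInt K) * y = (4 : ℤ_[2]) • y := by
          rw [Algebra.smul_def, map_ofNat]
        rw [h4, map_smul]
        rfl
      rw [← hg', h2, map_mul, map_ofNat]
      exact (congrArg (· * _) (by decide : (4 : ZMod 4) = 0)).trans (zero_mul _)
    · rintro y -
      obtain ⟨x, rfl⟩ := Ideal.Quotient.mk_surjective y
      rw [← b.sum_repr x]
      show q _ ∈ _
      rw [map_sum]
      refine Submodule.sum_mem _ fun i _ => ?_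
      rw [htq]
      exact Submodule.smul_mem _ _ (Submodule.subset_span ⟨i, rfl⟩)
  obtain ⟨h1, h2⟩ := psi_two_mul_properties (TruncRing K) hunit
  exact ⟨hfree, htwo, hunit, h1, h2⟩

end WeilTwo

namespace WeilTwo

theorem IsDyadic.psi_primitive {R : Type u} [CommRing R] [Algebra (ZMod 4) R] (hR : IsDyadic R)
    (r : R) (h : ∀ s, SplitSymplectic.psi R (s * r) = 1) : r = 0 := by
  obtain ⟨x, hx⟩ := hR.exists_psi_ne_one
  rcases hR.isUnit_or r with ⟨u, rfl⟩ | ⟨s, rfl⟩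
  · refine (hx ?_).elim
    rw [← h (2 * x * (↑u⁻¹ : R)), Units.inv_mul_cancel_right]
  · rcases hR.isUnit_or s with ⟨u, rfl⟩ | ⟨t, rfl⟩
    · refine (hx ?_).elim
      rw [← h (x * (↑u⁻¹ : R))]
      congr 1
      linear_combination -2 * x * u.inv_mul
    · linear_combination t * four_eq_zero R

section Pairing

variable {R X : Type u} [CommRing R] [AddCommGroup X] [Module R X]
  {ψ : AddChar R ℂ} (hψ : ∀ r, (∀ s, ψ (s * r) = 1) → r = 0)

open Classical in
theorem sum_addChar_addMonoidHom {A : Type*} [AddCommGroup A] [Fintype A] (ψ : AddChar R ℂ)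
    (φ : A →+ R) :
    ∑ x, ψ (φ x) = if ∀ x, ψ (φ x) = 1 then (Nat.card A : ℂ) else 0 := by
  have h := AddChar.sum_eq_ite (ψ.compAddMonoidHom φ)
  simp only [AddChar.compAddMonoidHom_apply] at h
  rw [h, Nat.card_eq_fintype_card]
  refine if_congr ?_ rfl rfl
  rw [AddChar.ext_iff]
  rfl

include hψ in
theorem sum_addChar_linearMap [Fintype X] (φ : X →ₗ[R] R) [Decidable (φ = 0)] :
    ∑ x, ψ (φ x) = if φ = 0 then (Nat.card X : ℂ) else 0 := by
  classical
  refine (sum_addChar_addMonoidHom ψ φ.toAddMonoidHom).trans (if_congr ?_ rfl rfl)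
  constructor
  · intro h
    ext x
    refine hψ _ fun s => ?_
    have := h (s • x)
    simpa using this
  · rintro rfl x
    exact AddChar.map_zero_eq_one ψ

variable [Finite X] {B : LinearMap.BilinForm R X} (hB : B.IsAlt) (hnd : ∀ x, B x = 0 → x = 0)

include hψ hnd in
theorem card_mul_card_orthogonal (P : Submodule R X) :
    Nat.card P * Nat.card (B.orthogonal P) = Nat.card X := by
  classical
  have := Fintype.ofFinite X
  have h1 : ∀ x : X, ∑ p : P, ψ (B p x) =
      if x ∈ B.orthogonal P then (Nat.card P : ℂ) else 0 := by
    intro x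
    refine (sum_addChar_linearMap hψ ((B.flip x).comp P.subtype)).trans (if_congr ?_ rfl rfl)
    rw [LinearMap.BilinForm.mem_orthogonal_iff]
    constructor
    · exact fun h p hp => LinearMap.congr_fun h ⟨p, hp⟩
    · exact fun h => LinearMap.ext fun p => h p.1 p.2
  have h2 : ∀ p : P, ∑ x : X, ψ (B p x) = if p = 0 then (Nat.card X : ℂ) else 0 := by
    intro p
    refine (sum_addChar_linearMap hψ (B p)).trans (if_congr ?_ rfl rfl)
    exact ⟨fun h => Subtype.ext (hnd _ h), fun h => by rw [h]; exact map_zero B⟩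
  have h3 := Finset.sum_comm (s := Finset.univ) (t := Finset.univ) (f := fun (x : X) (p : P) =>
    ψ (B p x))
  simp only [h1, h2] at h3
  rw [← Finset.sum_filter, Finset.sum_const, Finset.sum_ite_eq' Finset.univ (0 : P)] at h3
  rw [if_pos (Finset.mem_univ _), nsmul_eq_mul] at h3
  have h4 : (Finset.univ.filter (· ∈ B.orthogonal P)).card = Nat.card (B.orthogonal P) := by
    rw [Nat.card_eq_fintype_card, Fintype.card_subtype]
  rw [h4] at h3
  rw [mul_comm]
  exact_mod_cast h3

include hψ hB hnd in
theorem orthogonal_orthogonal_eq (P : Submodule R X) : B.orthogonal (B.orthogonal P) = P := by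
  have hle : P ≤ B.orthogonal (B.orthogonal P) :=
    LinearMap.BilinForm.le_orthogonal_orthogonal hB.isRefl
  have h1 := card_mul_card_orthogonal hψ hnd P
  have h2 := card_mul_card_orthogonal hψ hnd (B.orthogonal P)
  have h3 : 0 < Nat.card (B.orthogonal P) := Nat.card_pos
  have h4 : Nat.card (B.orthogonal (B.orthogonal P)) = Nat.card P :=
    Nat.eq_of_mul_eq_mul_left h3 (by rw [h2, ← h1, mul_comm])
  exact (SetLike.coe_injective
    (Set.eq_of_subset_of_ncard_le hle h4.le (Set.toFinite _))).symm

include hB in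
theorem isLagrangian_iff {L : Submodule R X} : IsLagrangian B L ↔ B.orthogonal L = L := by
  have h : ∀ v l, B v l = 0 ↔ B l v = 0 := fun v l => ⟨hB.isRefl _ _, hB.isRefl _ _⟩
  rw [SetLike.ext_iff]
  refine forall_congr' fun v => ?_
  rw [LinearMap.BilinForm.mem_orthogonal_iff]
  simp only [h v, iff_comm (a := v ∈ L)]

include hψ hB hnd in
theorem sup_eq_top_of_isLagrangian {N L : Submodule R X} (hN : B.orthogonal N = N)
    (hL : B.orthogonal L = L) (h : N ⊓ L = ⊥) : N ⊔ L = ⊤ := by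
  rw [← orthogonal_orthogonal_eq hψ hB hnd (N ⊔ L), eq_top_iff]
  have : B.orthogonal (N ⊔ L) ≤ ⊥ := by
    rw [← h]
    exact le_inf ((LinearMap.BilinForm.orthogonal_le le_sup_left).trans hN.le)
      ((LinearMap.BilinForm.orthogonal_le le_sup_right).trans hL.le)
  rw [le_bot_iff.1 this]
  intro x _ y hy
  rw [(Submodule.mem_bot R).1 hy]
  show B 0 x = 0
  rw [map_zero, LinearMap.zero_apply]

include hψ hB hnd in
theorem exists_common_transversal (hu : ∀ r : R, IsUnit r ∨ ∃ s, r = 2 * s)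
    (h2 : ∀ x : X, (2 : R) • x = 0) {L M : Submodule R X} (hL : IsLagrangian B L)
    (hM : IsLagrangian B M) : ∃ N, IsLagrangian B N ∧ N ⊔ L = ⊤ ∧ N ⊔ M = ⊤ := by
  rw [isLagrangian_iff hB] at hL hM
  let S : Set (Submodule R X) := {N | N ≤ B.orthogonal N ∧ N ⊓ L = ⊥ ∧ N ⊓ M = ⊥}
  obtain ⟨N, ⟨hN, hNL, hNM⟩, hmax⟩ := (Set.toFinite S).exists_maximal
    ⟨⊥, bot_le, bot_inf_eq _, bot_inf_eq _⟩
  have key : ∀ P : Submodule R X, B.orthogonal P = P → N ⊓ P = ⊥ → ¬ B.orthogonal N ≤ N →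
      ∃ v ∈ B.orthogonal N, v ∉ N ⊔ P := by
    intro P hP hNP hN'
    by_contra! hle
    have h1 : B.orthogonal (N ⊔ P) ≤ P :=
      (LinearMap.BilinForm.orthogonal_le le_sup_right).trans hP.le
    have h2 : B.orthogonal (N ⊔ P) ≤ N := by
      conv_rhs => rw [← orthogonal_orthogonal_eq hψ hB hnd N]
      exact LinearMap.BilinForm.orthogonal_le hle
    refine hN' fun v hv => ?_
    obtain ⟨n, hn, p, hp, rfl⟩ := Submodule.mem_sup.1 (hle v hv)
    have hp' : p ∈ B.orthogonal N := by
      have := Submodule.sub_mem _ hv (hN hn)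
      rwa [add_sub_cancel_left] at this
    have : p ∈ B.orthogonal (N ⊔ P) := by
      intro x hx
      obtain ⟨y, hy, z, hz, rfl⟩ := Submodule.mem_sup.1 hx
      have h3 : B y p = 0 := hp' y hy
      have h4 : B z p = 0 := (hP.ge hp) z hz
      show B (y + z) p = 0
      rw [map_add, LinearMap.add_apply, h3, h4, add_zero]
    exact N.add_mem hn (h2 this)
  have hext : ∀ (P : Submodule R X) (v : X), N ⊓ P = ⊥ → v ∉ N ⊔ P → (N ⊔ R ∙ v) ⊓ P = ⊥ := by
    intro P v hNP hv
    rw [eq_bot_iff]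
    rintro x ⟨hx, hxP⟩
    obtain ⟨n, hn, y, hy, rfl⟩ := Submodule.mem_sup.1 hx
    obtain ⟨r, rfl⟩ := Submodule.mem_span_singleton.1 hy
    rcases hu r with ⟨u, rfl⟩ | ⟨s, rfl⟩
    · refine (hv ?_).elim
      have h3 : v = (↑u⁻¹ : R) • ((n + (u : R) • v) - n) := by
        rw [add_sub_cancel_left, smul_smul, Units.inv_mul, one_smul]
      rw [h3]
      exact Submodule.smul_mem _ _ (Submodule.sub_mem _ (Submodule.mem_sup_right hxP)
        (Submodule.mem_sup_left hn))
    · rw [mul_comm, mul_smul, h2, smul_zero, add_zero] at hxP ⊢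
      exact hNP.le ⟨hn, hxP⟩
  have hlag : B.orthogonal N ≤ N := by
    by_contra h
    obtain ⟨x, hx, hxL⟩ := key L hL hNL h
    obtain ⟨y, hy, hyM⟩ := key M hM hNM h
    obtain ⟨v, hv, hvL, hvM⟩ : ∃ v ∈ B.orthogonal N, v ∉ N ⊔ L ∧ v ∉ N ⊔ M := by
      by_cases hxM : x ∈ N ⊔ M
      · by_cases hyL : y ∈ N ⊔ L
        · exact ⟨x + y, Submodule.add_mem _ hx hy,
            fun h' => hxL ((Submodule.add_mem_iff_left _ hyL).1 h'),
            fun h' => hyM ((Submodule.add_mem_iff_right _ hxM).1 h')⟩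
        · exact ⟨y, hy, hyL, hyM⟩
      · exact ⟨x, hx, hxL, hxM⟩
    have hmem : N ⊔ R ∙ v ∈ S := by
      refine ⟨?_, hext L v hNL hvL, hext M v hNM hvM⟩
      have h5 : ∀ n ∈ N, B n v = 0 := fun n hn => hv n hn
      have h6 : ∀ n ∈ N, B v n = 0 := fun n hn => hB.isRefl _ _ (h5 n hn)
      have h7 : ∀ n ∈ N, ∀ m ∈ N, B n m = 0 := fun n hn m hm => hN hm n hn
      intro a ha b hb
      obtain ⟨n, hn, y, hy, rfl⟩ := Submodule.mem_sup.1 ha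
      obtain ⟨r, rfl⟩ := Submodule.mem_span_singleton.1 hy
      obtain ⟨m, hm, z, hz, rfl⟩ := Submodule.mem_sup.1 hb
      obtain ⟨s, rfl⟩ := Submodule.mem_span_singleton.1 hz
      show B _ _ = 0
      simp [h5 _ hm, h6 _ hn, h7 _ hm _ hn, hB.self_eq_zero]
    have := hmax hmem le_sup_left
    exact hvL (Submodule.mem_sup_left (this (Submodule.mem_sup_right
      (Submodule.mem_span_singleton_self v))))
  have hN' : B.orthogonal N = N := le_antisymm hlag hN
  exact ⟨N, (isLagrangian_iff hB).2 hN', sup_eq_top_of_isLagrangian hψ hB hnd hN' hL hNL,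
    sup_eq_top_of_isLagrangian hψ hB hnd hN' hM hNM⟩

end Pairing

end WeilTwo

namespace WeilTwo

theorem IsDyadic.not_isUnit_two_mul {R : Type u} [CommRing R] [Algebra (ZMod 4) R]
    (hR : IsDyadic R) (s : R) : ¬ IsUnit (2 * s) := by
  rintro ⟨u, hu⟩
  obtain ⟨x, hx⟩ := hR.exists_psi_ne_one
  refine hx ?_
  have h : (2 : R) = 0 := by
    have h1 : (2 : R) * u = 0 := by rw [hu]; linear_combination s * four_eq_zero R
    rw [← Units.mul_inv_cancel_right 2 u, h1, zero_mul]
  rw [h, zero_mul, AddChar.map_zero_eq_one]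

theorem IsDyadic.nontrivial {R : Type u} [CommRing R] [Algebra (ZMod 4) R]
    (hR : IsDyadic R) : Nontrivial R := by
  by_contra h
  rw [not_nontrivial_iff_subsingleton] at h
  exact hR.not_isUnit_two_mul 0 (isUnit_of_subsingleton _)

theorem IsDyadic.isLocalRing {R : Type u} [CommRing R] [Algebra (ZMod 4) R]
    (hR : IsDyadic R) : IsLocalRing R := by
  have := hR.nontrivial
  refine IsLocalRing.of_nonunits_add fun a b ha hb => ?_
  obtain ⟨s, rfl⟩ := (hR.isUnit_or a).resolve_left ha
  obtain ⟨t, rfl⟩ := (hR.isUnit_or b).resolve_left hb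
  rw [← mul_add]
  exact hR.not_isUnit_two_mul _

theorem natCard_eq_pow_finrank (A M : Type*) [CommRing A] [Nontrivial A] [AddCommGroup M]
    [Module A M] [Module.Free A M] [Module.Finite A M] :
    Nat.card M = Nat.card A ^ Module.finrank A M := by
  rw [Nat.card_congr (Module.finBasis A M).equivFun.toEquiv, Nat.card_fun, Nat.card_fin]

section RedFacts

variable {R W : Type u} [CommRing R] [Algebra (ZMod 4) R] [AddCommGroup W] [Module R W]

theorem red_eq_zero_iff {w : W} : (red w : Red R W) = 0 ↔ ∃ y : W, w = (2 : R) • y := by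
  rw [Submodule.mkQ_apply, Submodule.Quotient.mk_eq_zero]
  refine ⟨mem_two_smul_top, ?_⟩
  rintro ⟨y, rfl⟩
  exact Submodule.smul_mem_smul (Ideal.mem_span_singleton_self _) trivial

theorem two_smul_red (x : Red R W) : (2 : R) • x = 0 := by
  obtain ⟨w, rfl⟩ := Submodule.mkQ_surjective _ x
  rw [← map_smul, red_eq_zero_iff]
  exact ⟨w, rfl⟩

theorem add_self_red (x : Red R W) : x + x = 0 := by
  rw [← two_smul R, two_smul_red]

theorem IsDyadic.exists_eq_two_smul (hR : IsDyadic R) [Module.Free R W] {w : W}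
    (h : (2 : R) • w = 0) : ∃ y : W, w = (2 : R) • y := by
  let b := Module.Free.chooseBasis R W
  have h1 : ∀ i, ∃ s, b.repr w i = 2 * s := fun i => by
    refine hR.exists_eq_two_mul _ ?_
    have := congrArg (fun z => b.repr z i) h
    simpa using this
  choose s hs using h1
  refine ⟨∑ i ∈ (b.repr w).support, s i • b i, ?_⟩
  conv_lhs => rw [← b.linearCombination_repr w, Finsupp.linearCombination_apply, Finsupp.sum]
  rw [Finset.smul_sum]
  exact Finset.sum_congr rfl fun i _ => by rw [hs, mul_smul]

theorem IsDyadic.card_red_sq (hR : IsDyadic R) [Module.Free R W] [Finite W] :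
    Nat.card (Red R W) ^ 2 = Nat.card W := by
  let t : W →ₗ[R] W := LinearMap.lsmul R W 2
  have h1 : LinearMap.ker t = Ideal.span {(2 : R)} • (⊤ : Submodule R W) := by
    ext w
    refine Iff.trans ?_ (red_eq_zero_iff.symm.trans (Submodule.Quotient.mk_eq_zero _))
    refine ⟨fun h => hR.exists_eq_two_smul h, ?_⟩
    rintro ⟨y, rfl⟩
    show (2 : R) • (2 : R) • y = 0
    rw [smul_smul, show (2 : R) * 2 = 0 by linear_combination four_eq_zero R, zero_smul]
  have h2 : LinearMap.range t = LinearMap.ker t := by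
    rw [h1]
    ext w
    refine Iff.trans ?_ (red_eq_zero_iff.symm.trans (Submodule.Quotient.mk_eq_zero _))
    exact ⟨fun ⟨y, hy⟩ => ⟨y, hy.symm⟩, fun ⟨y, hy⟩ => ⟨y, hy.symm⟩⟩
  have h3 : Nat.card (Red R W) = Nat.card (LinearMap.range t) := by
    show Nat.card (W ⧸ (Ideal.span {(2 : R)} • (⊤ : Submodule R W))) = _
    rw [← h1]
    exact Nat.card_congr t.quotKerEquivRange.toEquiv
  have h4 := Submodule.card_eq_card_quotient_mul_card (LinearMap.ker t)
  rw [h4, sq, h1, ← h1, ← h2, ← h3, h2, h1]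

end RedFacts

namespace SplitSymplectic

variable {R W : Type u} [CommRing R] [Algebra (ZMod 4) R] [AddCommGroup W] [Module R W]
variable (D : SplitSymplectic R W)

theorem omega_isAlt : D.omega.IsAlt := by
  intro v
  obtain ⟨w, rfl⟩ := Submodule.mkQ_surjective _ v
  show 2 * D.ω w w = 0
  rw [D.isAlt.self_eq_zero, mul_zero]

theorem omega_nondegenerate (hR : IsDyadic R) [Module.Free R W] (x : Red R W)
    (hx : D.omega x = 0) : x = 0 := by
  obtain ⟨w, rfl⟩ := Submodule.mkQ_surjective _ x
  rw [red_eq_zero_iff]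
  refine hR.exists_eq_two_smul ?_
  refine D.isPerfPair.bijective_left.1 ?_
  rw [map_zero]
  ext y
  rw [map_smul]
  exact LinearMap.congr_fun hx (red y)

/-- A symplectic basis adapted to the Lagrangian splitting. -/
structure AdaptedBasis (n : ℕ) where
  /-- basis of the first Lagrangian -/
  e : Fin n → W
  /-- dual basis of the second Lagrangian -/
  f : Fin n → W
  e_mem : ∀ i, e i ∈ D.L₀
  f_mem : ∀ i, f i ∈ D.M₀
  dual : ∀ i j, D.ω (e i) (f j) = if i = j then 1 else 0
  eq_sum_e : ∀ w ∈ D.L₀, w = ∑ i, D.ω w (f i) • e i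
  eq_sum_f : ∀ w ∈ D.M₀, w = ∑ i, D.ω (e i) w • f i

variable [Module.Free R W] [Module.Finite R W]

theorem free_L₀ (hR : IsDyadic R) : Module.Free R D.L₀ := by
  have := hR.isLocalRing
  have : Module.Projective R D.L₀ := Module.Projective.of_split D.L₀.subtype
    (D.L₀.projectionOnto D.M₀ D.isCompl) (by
      ext x
      simp)
  have : Module.Finite R D.L₀ :=
    Module.Finite.of_surjective (D.L₀.projectionOnto D.M₀ D.isCompl)
      (Submodule.projectionOnto_surjective D.isCompl)
  exact Module.free_of_flat_of_isLocalRing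

theorem finite_L₀ : Module.Finite R D.L₀ :=
  Module.Finite.of_surjective (D.L₀.projectionOnto D.M₀ D.isCompl)
    (Submodule.projectionOnto_surjective D.isCompl)

theorem ω_swap (v w : W) : D.ω v w = - D.ω w v := (D.isAlt.neg_eq w v).symm

theorem ω_L₀ {v w : W} (hv : v ∈ D.L₀) (hw : w ∈ D.L₀) : D.ω v w = 0 :=
  (D.isLagrangian_L₀ v).1 hv w hw

theorem exists_adaptedBasis (hR : IsDyadic R) :
    Nonempty (D.AdaptedBasis (Module.finrank R D.L₀)) := by
  have := D.free_L₀ hR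
  have := D.finite_L₀
  have := hR.nontrivial
  let b : Module.Basis (Fin (Module.finrank R D.L₀)) R D.L₀ := Module.finBasis R D.L₀
  have h1 : ∀ i, ∃ m ∈ D.M₀, ∀ l (hl : l ∈ D.L₀), D.ω l m = b.repr ⟨l, hl⟩ i := by
    intro i
    let φ : W →ₗ[R] R := (b.coord i).comp (D.L₀.projectionOnto D.M₀ D.isCompl)
    obtain ⟨w, hw⟩ := D.isPerfPair.bijective_right.2 φ
    refine ⟨D.M₀.projection D.L₀ D.isCompl.symm w, Submodule.projection_apply_mem _ _,
      fun l hl => ?_⟩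
    have h2 := LinearMap.congr_fun hw l
    have h3 := Submodule.projection_add_projection_eq_self D.isCompl w
    rw [LinearMap.flip_apply, ← h3, map_add,
      D.ω_L₀ hl (Submodule.projection_apply_mem _ _), zero_add] at h2
    rw [h2]
    show b.repr (D.L₀.projectionOnto D.M₀ D.isCompl l) i = _
    rw [show D.L₀.projectionOnto D.M₀ D.isCompl l = ⟨l, hl⟩ from
      Submodule.projectionOnto_apply_left D.isCompl ⟨l, hl⟩]
  choose f hf hfl using h1
  have hd : ∀ i j, D.ω (b i) (f j) = if i = j then 1 else 0 := by
    intro i j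
    rw [hfl j _ (b i).2, Subtype.coe_eta, b.repr_self, Finsupp.single_apply]
  have hs : ∀ w ∈ D.L₀, w = ∑ i, D.ω w (f i) • (b i : W) := by
    intro w hw
    have h2 := congrArg Subtype.val (b.sum_repr ⟨w, hw⟩)
    rw [Submodule.coe_sum] at h2
    refine h2.symm.trans (Finset.sum_congr rfl fun i _ => ?_)
    rw [Submodule.coe_smul, ← hfl i w hw]
  refine ⟨⟨fun i => b i, f, fun i => (b i).2, hf, hd, hs, fun w hw => ?_⟩⟩
  rw [← sub_eq_zero]
  have hM : w - ∑ i, D.ω (b i) w • f i ∈ D.M₀ :=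
    Submodule.sub_mem _ hw (Submodule.sum_mem _ fun i _ => Submodule.smul_mem _ _ (hf i))
  have hL : w - ∑ i, D.ω (b i) w • f i ∈ D.L₀ := by
    rw [D.isLagrangian_L₀]
    intro l hl
    rw [D.ω_swap, neg_eq_zero, hs l hl, map_sum, LinearMap.sum_apply]
    refine Finset.sum_eq_zero fun j _ => ?_
    rw [map_smul, LinearMap.smul_apply, map_sub, map_sum]
    simp [hd]
  exact Submodule.disjoint_def.1 D.isCompl.disjoint _ hL hM

variable [Finite R]

theorem card_eq_two_pow (hR : IsDyadic R) {L : Submodule R (Red R W)}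
    (hL : IsLagrangian D.omega L) :
    Nat.card L = 2 ^ (Module.finrank (ZMod 4) R * (Module.finrank R W / 2)) := by
  have : Finite W := Module.finite_of_finite R
  have : Finite (Red R W) := Module.finite_of_finite R
  have := hR.free
  have := hR.nontrivial
  have : Nontrivial (ZMod 4) := ⟨0, 1, by decide⟩
  have := D.free_L₀ hR
  have := D.finite_L₀
  have h1 := card_mul_card_orthogonal hR.psi_primitive (D.omega_nondegenerate hR) L
  rw [(isLagrangian_iff D.omega_isAlt).1 hL] at h1
  have h2 := card_mul_card_orthogonal hR.psi_primitive
    (fun x hx => D.isPerfPair.bijective_left.1 (hx.trans (map_zero D.ω).symm)) D.L₀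
  rw [(isLagrangian_iff D.isAlt).1 D.isLagrangian_L₀] at h2
  have h3 := hR.card_red_sq (W := W)
  have hR4 : Nat.card R = 4 ^ Module.finrank (ZMod 4) R := by
    rw [natCard_eq_pow_finrank (ZMod 4) R, Nat.card_zmod]
  have hLc : Nat.card D.L₀ = Nat.card R ^ Module.finrank R D.L₀ :=
    natCard_eq_pow_finrank R _
  have hWc : Nat.card W = Nat.card R ^ Module.finrank R W := natCard_eq_pow_finrank R _
  have h4 : Module.finrank R W = 2 * Module.finrank R D.L₀ := by
    refine Nat.pow_right_injective (Finite.one_lt_card (α := R)) ?_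
    show Nat.card R ^ _ = Nat.card R ^ _
    rw [← hWc, ← h2, hLc, ← pow_add, two_mul]
  have h5 : Module.finrank R W / 2 = Module.finrank R D.L₀ := by omega
  rw [h5]
  refine Nat.pow_left_injective (n := 4) (by norm_num) ?_
  show Nat.card L ^ 4 = _ ^ 4
  rw [show Nat.card L ^ 4 = (Nat.card L * Nat.card L) ^ 2 by ring, h1, h3, ← h2, hLc, hR4]
  generalize Module.finrank (ZMod 4) R = d
  rw [show (4 : ℕ) ^ d = 2 ^ (2 * d) by rw [pow_mul]; norm_num]
  simp only [← pow_mul, ← pow_add]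
  congr 1
  ring

end SplitSymplectic

end WeilTwo

namespace WeilTwo

section Quadratic

variable {R : Type u} [CommRing R] [Algebra (ZMod 4) R] {A : Type u} [AddCommGroup A]

theorem zmod_two_val_add (x y : ZMod 2) :
    ∃ k : ℤ, ((x + y).val : ℤ) = x.val + y.val + 2 * k := by
  have : (((x + y).val : ℤ) : ZMod 2) = ((x.val + y.val : ℤ) : ZMod 2) := by simp
  rw [ZMod.intCast_eq_intCast_iff_dvd_sub] at this
  obtain ⟨k, hk⟩ := this
  exact ⟨-k, by push_cast at hk; linarith⟩

/-- The diagonal of a symmetric bilinear form, evaluated at lifts of the coordinates modulo `2`. -/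
theorem exists_quadratic_of_coordinates {ι : Type u} (n : A → ι → R)
    (B : LinearMap.BilinForm R (ι → R)) (hB : ∀ x y, B x y = B y x)
    (hn : ∀ l m, ∃ t, n (l + m) = n l + n m + (2 : R) • t) :
    ∃ q : A → R, ∀ l m, q (l + m) = q l + q m + 2 * B (n l) (n m) := by
  refine ⟨fun l => B (n l) (n l), fun l m => ?_⟩
  obtain ⟨t, ht⟩ := hn l m
  beta_reduce
  rw [ht]
  simp only [map_add, map_smul, LinearMap.add_apply, LinearMap.smul_apply, smul_eq_mul]
  rw [hB (n m) (n l), hB t (n l), hB t (n m)]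
  linear_combination (B (n l) t + B (n m) t + B t t) * four_eq_zero R

/-- A symmetric biadditive form with values in `2 R` on an elementary abelian `2`-group is the
polarization of a function with values in `R`. -/
theorem exists_quadratic [Finite A] (hA : ∀ x : A, x + x = 0) (β : A →+ A →+ R)
    (hsym : ∀ x y, β x y = β y x) (h2 : ∀ x y, ∃ s, β x y = 2 * s) :
    ∃ q : A → R, ∀ l m, q (l + m) = q l + q m + β l m := by
  classical
  let _ : Module (ZMod 2) A := AddCommGroup.zmodModule fun x => by rw [two_nsmul, hA]
  let b := Module.Free.chooseBasis (ZMod 2) A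
  choose! h hh using fun (r : R) (hr : ∃ s, r = 2 * s) => hr
  let c : Matrix _ _ R := Matrix.of fun i j => h (β (b i) (b j))
  have hc : ∀ i j, 2 * c i j = β (b i) (b j) := fun i j => (hh _ (h2 _ _)).symm
  let n : A → Module.Free.ChooseBasisIndex (ZMod 2) A → R := fun l i => ((b.repr l i).val : R)
  have hn : ∀ l m, ∃ t, n (l + m) = n l + n m + (2 : R) • t := by
    intro l m
    have : ∀ i, ∃ s : R, n (l + m) i = n l i + n m i + 2 * s := by
      intro i
      obtain ⟨k, hk⟩ := zmod_two_val_add (b.repr l i) (b.repr m i)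
      refine ⟨k, ?_⟩
      have := congrArg (Int.cast : ℤ → R) hk
      push_cast at this
      simp only [n, map_add, Finsupp.add_apply]
      exact this
    choose t ht using this
    exact ⟨t, funext ht⟩
  have hrep : ∀ l : A, l = ∑ i, (b.repr l i).val • b i := by
    intro l
    refine (b.sum_repr l).symm.trans (Finset.sum_congr rfl fun i _ => ?_)
    conv_lhs => rw [← ZMod.natCast_zmod_val (b.repr l i), Nat.cast_smul_eq_nsmul]
  have hB : ∀ x y, Matrix.toBilin' c x y = Matrix.toBilin' c y x := by
    intro x y
    rw [Matrix.toBilin'_apply, Matrix.toBilin'_apply, Finset.sum_comm]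
    refine Finset.sum_congr rfl fun i _ => Finset.sum_congr rfl fun j _ => ?_
    have : c j i = c i j := congrArg h (hsym _ _)
    rw [this]
    ring
  obtain ⟨q, hq⟩ := exists_quadratic_of_coordinates n (Matrix.toBilin' c) hB hn
  refine ⟨q, fun l m => ?_⟩
  rw [hq, Matrix.toBilin'_apply, Finset.mul_sum]
  congr 1
  conv_rhs => rw [hrep l, hrep m]
  simp only [map_sum, AddMonoidHom.finsetSum_apply, map_nsmul, AddMonoidHom.nsmul_apply,
    Finset.mul_sum, ← hc, nsmul_eq_mul]
  rw [Finset.sum_comm]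
  refine Finset.sum_congr rfl fun i _ => Finset.sum_congr rfl fun j _ => ?_
  simp only [n]
  ring

end Quadratic

namespace SplitSymplectic

variable {R W : Type u} [CommRing R] [Algebra (ZMod 4) R] [AddCommGroup W] [Module R W]
variable (D : SplitSymplectic R W)

theorem beta_eq_two_mul (v w : Red R W) : ∃ s, D.beta v w = 2 * s := by
  obtain ⟨v, rfl⟩ := Submodule.mkQ_surjective _ v
  obtain ⟨w, rfl⟩ := Submodule.mkQ_surjective _ w
  exact ⟨_, rfl⟩

theorem two_mul_beta (v w : Red R W) : 2 * D.beta v w = 0 := by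
  obtain ⟨s, hs⟩ := D.beta_eq_two_mul v w
  rw [hs]
  linear_combination s * four_eq_zero R

theorem beta_sub (v w : Red R W) : D.beta v w - D.beta w v = D.omega v w := by
  obtain ⟨v, rfl⟩ := Submodule.mkQ_surjective _ v
  obtain ⟨w, rfl⟩ := Submodule.mkQ_surjective _ w
  have := D.betaTilde_sub v w
  show 2 * D.betaTilde v w - 2 * D.betaTilde w v = 2 * D.ω v w
  linear_combination 2 * this

theorem exists_elag [Finite (Red R W)] {L : Submodule R (Red R W)}
    (hL : IsLagrangian D.omega L) : ∃ A : D.ELag, A.L = L := by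
  let β : L →+ L →+ R := AddMonoidHom.mk' (fun l => (D.beta l).toAddMonoidHom.comp
    L.subtype.toAddMonoidHom) (fun l m => by ext; simp)
  obtain ⟨q, hq⟩ := exists_quadratic (fun x : L => Subtype.ext (add_self_red (x : Red R W))) β
    (fun l m => by
      show D.beta l m = D.beta m l
      rw [← sub_eq_zero, D.beta_sub]
      exact (hL _).1 l.2 _ m.2)
    (fun l m => D.beta_eq_two_mul _ _)
  refine ⟨⟨L, hL, fun l => ⟨l, q l⟩, fun l m => ?_, fun l => rfl⟩, rfl⟩
  ext
  · rfl
  · exact hq l m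

theorem betaTilde_of_mem_L₀_right (v : W) {l : W} (hl : l ∈ D.L₀) : D.betaTilde v l = 0 := by
  show D.ω _ (D.M₀.projection D.L₀ D.isCompl.symm l) = 0
  rw [(Submodule.projection_apply_eq_zero_iff D.isCompl.symm).2 hl, map_zero]

theorem betaTilde_of_mem_M₀_left {m : W} (hm : m ∈ D.M₀) (w : W) : D.betaTilde m w = 0 := by
  show D.ω (D.L₀.projection D.M₀ D.isCompl m) _ = 0
  rw [(Submodule.projection_apply_eq_zero_iff D.isCompl).2 hm, map_zero, LinearMap.zero_apply]

theorem betaTilde_of_mem_M₀_right (l : W) {m : W} (hm : m ∈ D.M₀) :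
    D.betaTilde l m = D.ω l m := by
  rw [← D.betaTilde_sub l m, D.betaTilde_of_mem_M₀_left hm, sub_zero]

theorem isLagrangian_red_L₀ (hR : IsDyadic R) [Module.Free R W] :
    IsLagrangian D.omega (D.L₀.map red) := by
  intro v
  constructor
  · rintro ⟨l, hl, rfl⟩ _ ⟨l', hl', rfl⟩
    show 2 * D.ω l l' = 0
    rw [(D.isLagrangian_L₀ l).1 hl _ hl', mul_zero]
  · intro h
    obtain ⟨w, rfl⟩ := Submodule.mkQ_surjective _ v
    obtain ⟨l, hl, m, hm, rfl⟩ := Submodule.mem_sup.1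
      (D.isCompl.sup_eq_top.ge (Submodule.mem_top (x := w)))
    have h1 : (2 : R) • m ∈ D.L₀ := by
      rw [D.isLagrangian_L₀]
      intro l' hl'
      have h2 : 2 * D.ω (l + m) l' = 0 := h _ ⟨l', hl', rfl⟩
      rw [map_add, LinearMap.add_apply, (D.isLagrangian_L₀ l).1 hl _ hl', zero_add] at h2
      rwa [map_smul]
    have h2 := Submodule.disjoint_def.1 D.isCompl.disjoint _ h1 (D.M₀.smul_mem 2 hm)
    have h3 : (red m : Red R W) = 0 := red_eq_zero_iff.2 (hR.exists_eq_two_smul h2)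
    show red (l + m) ∈ _
    rw [map_add, h3, add_zero]
    exact ⟨l, hl, rfl⟩

theorem beta_red_L₀_right (v : Red R W) {l : Red R W} (hl : l ∈ D.L₀.map red) :
    D.beta v l = 0 := by
  obtain ⟨v, rfl⟩ := Submodule.mkQ_surjective _ v
  obtain ⟨l, hl, rfl⟩ := hl
  show 2 * D.betaTilde v l = 0
  rw [D.betaTilde_of_mem_L₀_right v hl, mul_zero]

theorem beta_red_M₀_left {m : Red R W} (hm : m ∈ D.M₀.map red) (v : Red R W) :
    D.beta m v = 0 := by
  obtain ⟨v, rfl⟩ := Submodule.mkQ_surjective _ v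
  obtain ⟨m, hm, rfl⟩ := hm
  show 2 * D.betaTilde m v = 0
  rw [D.betaTilde_of_mem_M₀_left hm v, mul_zero]

/-- The enhanced Lagrangian `l ↦ (l, 0)` over the reduction of `L₀`. -/
def baseELag (hR : IsDyadic R) [Module.Free R W] : D.ELag where
  L := D.L₀.map red
  isLagrangian := D.isLagrangian_red_L₀ hR
  τ l := ⟨l, 0⟩
  τ_add l m := by
    ext
    · rfl
    · show 0 = 0 + 0 + D.beta l m
      rw [D.beta_red_L₀_right _ m.2, add_zero, add_zero]
  τ_v _ := rfl

theorem exists_common_transversal_elag (hR : IsDyadic R) [Module.Free R W] [Finite (Red R W)]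
    (M L : D.ELag) : ∃ N : D.ELag, D.Transversal N M ∧ D.Transversal N L := by
  obtain ⟨N, hN, h1, h2⟩ := exists_common_transversal hR.psi_primitive D.omega_isAlt
    (D.omega_nondegenerate hR) hR.isUnit_or two_smul_red M.isLagrangian L.isLagrangian
  obtain ⟨A, rfl⟩ := D.exists_elag hN
  exact ⟨A, h1, h2⟩

end SplitSymplectic

end WeilTwo

namespace WeilTwo

noncomputable section

namespace SplitSymplectic

variable {R W : Type u} [CommRing R] [Algebra (ZMod 4) R] [AddCommGroup W] [Module R W]
variable {D : SplitSymplectic R W}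

theorem psi_zero : psi R 0 = 1 := AddChar.map_zero_eq_one _

theorem psi_add (a b : R) : psi R (a + b) = psi R a * psi R b := AddChar.map_add_eq_mul _ _ _

theorem psi_pow_four (a : R) : psi R a ^ 4 = 1 := by
  rw [← AddChar.map_nsmul_eq_pow, nsmul_eq_mul]
  push_cast
  rw [four_eq_zero R, zero_mul, psi_zero]

theorem psi_sq (a : R) : psi R a ^ 2 = psi R (2 * a) := by
  rw [← AddChar.map_nsmul_eq_pow, nsmul_eq_mul]
  push_cast
  rfl

theorem Heis.mul_comm_central (a b : D.Heis) :
    a * b = Heis.central (D.omega a.v b.v) * b * a := by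
  ext
  · simp [add_comm]
  · simp only [mul_z, mul_v, central_z, central_v, ← D.beta_sub, map_zero, map_add,
      LinearMap.zero_apply, LinearMap.add_apply]
    ring

theorem model_central {A : D.ELag} (f : D.model A) (z : R) (h : D.Heis) :
    f.1 (Heis.central z * h) = psi R z * f.1 h := by
  have := f.2 z 0 h
  rwa [ELag.τ_zero, mul_one] at this

theorem central_zero : (Heis.central 0 : D.Heis) = 1 := rfl

theorem model_τ {A : D.ELag} (f : D.model A) (l : A.L) (h : D.Heis) :
    f.1 (A.τ l * h) = f.1 h := by
  have := f.2 0 l h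
  rwa [central_zero, one_mul, psi_zero, one_mul] at this

theorem model_mul_τ {A : D.ELag} (f : D.model A) (l : A.L) (h : D.Heis) :
    f.1 (h * A.τ l) = psi R (D.omega h.v l) * f.1 h := by
  rw [Heis.mul_comm_central, f.2, A.τ_v]

theorem modelRep_apply {A : D.ELag} (k : D.Heis) (f : D.model A) (h : D.Heis) :
    (D.modelRep A k f).1 h = f.1 (h * k) := rfl

open Classical in
/-- The vector of `𝓗_L` supported on the preimage of `L`, with value `1` at `1`. -/
def delta (A : D.ELag) : D.model A :=
  ⟨fun h => if hv : h.v ∈ A.L then psi R (h.z - (A.τ ⟨h.v, hv⟩).z) else 0, fun z l h => by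
    have hvl : (Heis.central z * A.τ l * h).v = l + h.v := by simp [A.τ_v]
    beta_reduce
    by_cases hv : h.v ∈ A.L
    · have hv' : (Heis.central z * A.τ l * h).v ∈ A.L := by
        rw [hvl]
        exact A.L.add_mem l.2 hv
      rw [dif_pos hv, dif_pos hv', ← psi_add]
      congr 1
      have h1 : (⟨_, hv'⟩ : A.L) = l + ⟨h.v, hv⟩ := Subtype.ext hvl
      rw [h1, A.τ_add]
      simp only [Heis.mul_z, Heis.mul_v, Heis.central_z, Heis.central_v, A.τ_v, map_zero,
        LinearMap.zero_apply, map_add, LinearMap.add_apply]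
      ring
    · have hv' : (Heis.central z * A.τ l * h).v ∉ A.L := by
        rw [hvl, A.L.add_mem_iff_right l.2]
        exact hv
      rw [dif_neg hv, dif_neg hv', mul_zero]⟩

theorem delta_of_mem (A : D.ELag) {h : D.Heis} (hv : h.v ∈ A.L) :
    (delta A).1 h = psi R (h.z - (A.τ ⟨h.v, hv⟩).z) := by
  classical
  exact dif_pos hv

theorem delta_of_notMem (A : D.ELag) {h : D.Heis} (hv : h.v ∉ A.L) : (delta A).1 h = 0 := by
  classical
  exact dif_neg hv

theorem delta_one (A : D.ELag) : (delta A).1 1 = 1 := by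
  have h : (1 : D.Heis).v ∈ A.L := A.L.zero_mem
  rw [delta_of_mem A h]
  have h1 : (⟨(1 : D.Heis).v, h⟩ : A.L) = 0 := rfl
  rw [h1, A.τ_zero, sub_self, psi_zero]

theorem delta_pow (A : D.ELag) (h : D.Heis) : (delta A).1 h = 0 ∨ (delta A).1 h ^ 4 = 1 := by
  by_cases hv : h.v ∈ A.L
  · rw [delta_of_mem A hv]
    exact Or.inr (psi_pow_four _)
  · exact Or.inl (delta_of_notMem A hv)

variable [Finite R] [Module.Finite R W] [Module.Free R W] (hR : IsDyadic R)

theorem finite_red : Finite (Red R W) := Module.finite_of_finite R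

instance finite_heis : Finite D.Heis :=
  have := finite_red (R := R) (W := W)
  Finite.of_injective (β := Red R W × R) (fun h => (h.v, h.z)) (fun a b h => by
    ext
    · exact congrArg Prod.fst h
    · exact congrArg Prod.snd h)

include hR in
open Classical in
theorem sum_psi_omega (A : D.ELag) [Fintype A.L] (v : Red R W) :
    ∑ l : A.L, psi R (D.omega v l) = if v ∈ A.L then (Nat.card A.L : ℂ) else 0 := by
  refine (sum_addChar_linearMap hR.psi_primitive ((D.omega v).comp A.L.subtype)).trans
    (if_congr ?_ rfl rfl)
  rw [A.isLagrangian]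
  constructor
  · exact fun h l hl => LinearMap.congr_fun h ⟨l, hl⟩
  · exact fun h => LinearMap.ext fun l => h l.1 l.2

include hR in
theorem sum_modelRep_τ (A : D.ELag) [Fintype A.L] (f : D.model A) :
    ∑ l : A.L, D.modelRep A (A.τ l) f = ((Nat.card A.L : ℂ) * f.1 1) • delta A := by
  classical
  refine Subtype.ext (funext fun h => ?_)
  rw [Submodule.coe_sum, Finset.sum_apply]
  simp only [modelRep_apply, model_mul_τ]
  rw [← Finset.sum_mul, sum_psi_omega hR]
  show _ = (Nat.card A.L * f.1 1) * (delta A).1 h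
  split_ifs with hv
  · have h1 : h = Heis.central (h.z - (A.τ ⟨h.v, hv⟩).z) * A.τ ⟨h.v, hv⟩ * 1 := by
      ext
      · simp [A.τ_v]
      · simp
    conv_lhs => rw [h1, f.2]
    rw [delta_of_mem A hv]
    ring
  · rw [zero_mul, delta_of_notMem A hv, mul_zero]

include hR in
/-- Schur's lemma for `𝓗_L`. -/
theorem exists_eq_smul (A : D.ELag) (T : D.model A →ₗ[ℂ] D.model A)
    (hT : ∀ h f, T (D.modelRep A h f) = D.modelRep A h (T f)) : ∃ c : ℂ, ∀ f, T f = c • f := by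
  have := Fintype.ofFinite A.L
  refine ⟨(T (delta A)).1 1, fun f => ?_⟩
  have key : ∀ f, (T f).1 1 = (T (delta A)).1 1 * f.1 1 := by
    intro f
    have h1 := congrArg (fun g => (T g).1 1) (sum_modelRep_τ hR A f)
    simp only [map_sum, hT, Submodule.coe_sum, Finset.sum_apply, modelRep_apply, map_smul] at h1
    have h2 : ∀ l : A.L, (T f).1 (1 * A.τ l) = (T f).1 1 := fun l => by
      rw [one_mul, ← mul_one (A.τ l), model_τ]
    simp only [h2, Finset.sum_const, Finset.card_univ, ← Nat.card_eq_fintype_card,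
      nsmul_eq_mul] at h1
    have h3 : (Nat.card A.L : ℂ) ≠ 0 := Nat.cast_ne_zero.2 Nat.card_pos.ne'
    apply mul_left_cancel₀ h3
    rw [h1]
    show (Nat.card A.L * f.1 1) * (T (delta A)).1 1 = _
    ring
  refine Subtype.ext (funext fun h => ?_)
  have h4 := key (D.modelRep A h f)
  rw [hT, modelRep_apply, modelRep_apply, one_mul] at h4
  exact h4

theorem intertwiner_apply (M L : D.ELag) [Fintype M.L] (f : D.model L) (h : D.Heis) :
    (D.intertwiner M L f).1 h = ∑ m : M.L, f.1 (M.τ m * h) :=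
  finsum_eq_sum_of_fintype _

theorem intertwiner_intertwines (M L : D.ELag) (h : D.Heis) (f : D.model L) :
    D.intertwiner M L (D.modelRep L h f) = D.modelRep M h (D.intertwiner M L f) := by
  have := Fintype.ofFinite M.L
  refine Subtype.ext (funext fun k => ?_)
  rw [modelRep_apply, intertwiner_apply, intertwiner_apply]
  exact Finset.sum_congr rfl fun m _ => by rw [modelRep_apply, mul_assoc]

include hR in
theorem eq_zero_of_transversal {M L : D.ELag} (hML : D.Transversal M L) {x : Red R W}
    (hM : x ∈ M.L) (hL : x ∈ L.L) : x = 0 := by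
  refine D.omega_nondegenerate hR x (LinearMap.ext fun y => ?_)
  obtain ⟨m, hm, l, hl, rfl⟩ := Submodule.mem_sup.1 (hML.ge (Submodule.mem_top (x := y)))
  rw [map_add, (M.isLagrangian x).1 hM m hm, (L.isLagrangian x).1 hL l hl, add_zero]
  rfl

include hR in
theorem intertwiner_intertwiner {M L : D.ELag} (hML : D.Transversal M L) (f : D.model L) :
    D.intertwiner L M (D.intertwiner M L f) = (Nat.card L.L : ℂ) • f := by
  classical
  have := Fintype.ofFinite M.L
  have := Fintype.ofFinite L.L
  refine Subtype.ext (funext fun h => ?_)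
  rw [intertwiner_apply]
  simp only [intertwiner_apply]
  have h1 : ∀ (l : L.L) (m : M.L), f.1 (M.τ m * (L.τ l * h)) =
      psi R (D.omega m l) * f.1 (M.τ m * h) := by
    intro l m
    rw [← mul_assoc, Heis.mul_comm_central (M.τ m) (L.τ l), M.τ_v, L.τ_v, mul_assoc, f.2]
  simp only [h1]
  rw [Finset.sum_comm]
  simp only [← Finset.sum_mul, sum_psi_omega hR]
  rw [Finset.sum_eq_single 0]
  · rw [if_pos (show ((0 : M.L) : Red R W) ∈ L.L from L.L.zero_mem), M.τ_zero, one_mul]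
    rfl
  · intro m _ hm
    rw [if_neg, zero_mul]
    exact fun h => hm (Subtype.ext (eq_zero_of_transversal hR hML m.2 h))
  · exact fun h => (h (Finset.mem_univ _)).elim

/-- The hermitian form `∑ f(h) \bar g(h)` on functions on `H(V)`. -/
def herm (f g : D.Heis → ℂ) : ℂ := ∑ᶠ h, f h * (starRingEnd ℂ) (g h)

theorem herm_smul_left (c : ℂ) (f g : D.Heis → ℂ) : herm (c • f) g = c * herm f g := by
  have := Fintype.ofFinite D.Heis
  simp only [herm, finsum_eq_sum_of_fintype, Finset.mul_sum, Pi.smul_apply, smul_eq_mul, mul_assoc]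

theorem herm_conj (f g : D.Heis → ℂ) : (starRingEnd ℂ) (herm f g) = herm g f := by
  have := Fintype.ofFinite D.Heis
  simp only [herm, finsum_eq_sum_of_fintype, map_sum, map_mul, Complex.conj_conj]
  exact Finset.sum_congr rfl fun h _ => mul_comm _ _

theorem herm_smul_smul (c : ℂ) (f : D.Heis → ℂ) :
    herm (c • f) (c • f) = (Complex.normSq c : ℂ) * herm f f := by
  have h : herm f (c • f) = (starRingEnd ℂ) c * herm f f := by
    rw [← herm_conj, herm_smul_left, map_mul, herm_conj]
  rw [herm_smul_left, h, ← mul_assoc, Complex.mul_conj]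

theorem herm_self_ne_zero {f : D.Heis → ℂ} (h : f 1 ≠ 0) : herm f f ≠ 0 := by
  have := Fintype.ofFinite D.Heis
  simp only [herm, finsum_eq_sum_of_fintype, Complex.mul_conj]
  rw [← Complex.ofReal_sum, Complex.ofReal_ne_zero]
  refine (lt_of_lt_of_le (Complex.normSq_pos.2 h) ?_).ne'
  exact Finset.single_le_sum (f := fun h => Complex.normSq (f h))
    (fun i _ => Complex.normSq_nonneg _) (Finset.mem_univ _)

theorem herm_comp_mul_left (k : D.Heis) (f g : D.Heis → ℂ) :
    herm (fun h => f (k * h)) (fun h => g (k * h)) = herm f g :=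
  finsum_comp_equiv (Equiv.mulLeft k) (f := fun h => f h * (starRingEnd ℂ) (g h))

theorem herm_intertwiner (M L : D.ELag) (f : D.model L) (g : D.model M) :
    herm (D.intertwiner M L f).1 g.1 = Nat.card M.L * herm f.1 g.1 := by
  have := Fintype.ofFinite M.L
  have := Fintype.ofFinite D.Heis
  have h1 : ∀ m : M.L, ∑ h, f.1 (M.τ m * h) * (starRingEnd ℂ) (g.1 h) = herm f.1 g.1 := by
    intro m
    rw [← herm_comp_mul_left (M.τ m)]
    simp only [herm, finsum_eq_sum_of_fintype, model_τ]
  rw [herm, finsum_eq_sum_of_fintype]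
  simp only [intertwiner_apply, Finset.sum_mul]
  rw [Finset.sum_comm]
  simp only [h1, Finset.sum_const, Finset.card_univ, nsmul_eq_mul, Nat.card_eq_fintype_card]

include hR in
theorem herm_intertwiner_self {M L : D.ELag} (hML : D.Transversal M L) (f : D.model L) :
    herm (D.intertwiner M L f).1 (D.intertwiner M L f).1 = Nat.card M.L * herm f.1 f.1 := by
  have h3 : (Nat.card L.L : ℂ) ≠ 0 := Nat.cast_ne_zero.2 Nat.card_pos.ne'
  have h4 : herm (D.intertwiner M L f).1 f.1 = herm f.1 f.1 := by
    apply mul_left_cancel₀ h3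
    rw [← herm_intertwiner, intertwiner_intertwiner hR hML]
    exact herm_smul_left _ _ _
  rw [herm_intertwiner, ← herm_conj, h4, herm_conj]

end SplitSymplectic

end

end WeilTwo

namespace WeilTwo

noncomputable section

section Gaussian

/-- A Gaussian integer of norm `2 ^ j` is `(1 + i) ^ j` up to a unit. -/
theorem gaussianInt_pow_four {j : ℕ} {z : GaussianInt} (hz : z.norm = 2 ^ j) :
    z ^ 4 = (-4) ^ j := by
  induction j generalizing z with
  | zero =>
    rw [pow_zero] at hz
    obtain ⟨a, b⟩ := z
    rw [Zsqrtd.norm_def] at hz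
    simp only at hz
    have ha : a ^ 2 ≤ 1 := by nlinarith [sq_nonneg b]
    have hb : b ^ 2 ≤ 1 := by nlinarith [sq_nonneg a]
    have ha1 : -1 ≤ a := by nlinarith
    have ha2 : a ≤ 1 := by nlinarith
    have hb1 : -1 ≤ b := by nlinarith
    have hb2 : b ≤ 1 := by nlinarith
    clear ha hb
    interval_cases a <;> interval_cases b <;> first | (exfalso; revert hz; decide) | rfl
  | succ j ih =>
    obtain ⟨a, b⟩ := z
    rw [Zsqrtd.norm_def] at hz
    simp only at hz
    have h1 : Even (a + b) := by
      have h2 : Even (a * a + b * b) := ⟨2 ^ j, by rw [pow_succ] at hz; linarith⟩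
      rw [Int.even_add, Int.even_mul, Int.even_mul] at h2
      rw [Int.even_add]
      simpa using h2
    obtain ⟨c, hc⟩ := h1
    obtain rfl : b = c + c - a := by linarith
    have h3 : (⟨a, c + c - a⟩ : GaussianInt) = ⟨1, 1⟩ * ⟨c, c - a⟩ := by
      rw [Zsqrtd.ext_iff, Zsqrtd.re_mul, Zsqrtd.im_mul]
      constructor <;> simp only <;> ring
    have h4 : (⟨c, c - a⟩ : GaussianInt).norm = 2 ^ j := by
      rw [Zsqrtd.norm_def]
      simp only
      rw [pow_succ] at hz
      linarith
    rw [h3, mul_pow, ih h4, show (⟨1, 1⟩ : GaussianInt) ^ 4 = -4 from rfl, pow_succ']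

/-- The Gaussian integers as a subring of `ℂ`. -/
abbrev gaussian : Subring ℂ := GaussianInt.toComplex.range

theorem I_mem_gaussian : Complex.I ∈ gaussian := ⟨⟨0, 1⟩, by simp [GaussianInt.toComplex_def]⟩

theorem pow_four_eq_of_mem_gaussian {c : ℂ} {j : ℕ} (hc : c ∈ gaussian)
    (h : Complex.normSq c = 2 ^ j) : c ^ 4 = (-4) ^ j := by
  obtain ⟨z, rfl⟩ := hc
  have : z.norm = 2 ^ j := by
    rw [← GaussianInt.intCast_real_norm] at h
    exact_mod_cast h
  rw [← map_pow, gaussianInt_pow_four this, map_pow, map_neg, map_ofNat]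

theorem mem_gaussian_of_pow_four {c : ℂ} (h : c ^ 4 = 1) : c ∈ gaussian := by
  have h1 : (c - 1) * (c + 1) * ((c - Complex.I) * (c + Complex.I)) = 0 := by
    linear_combination h + (1 - c ^ 2) * Complex.I_sq
  rcases mul_eq_zero.1 h1 with h2 | h2 <;> rcases mul_eq_zero.1 h2 with h3 | h3
  · rw [sub_eq_zero.1 h3]; exact gaussian.one_mem
  · rw [eq_neg_of_add_eq_zero_left h3]; exact gaussian.neg_mem gaussian.one_mem
  · rw [sub_eq_zero.1 h3]; exact I_mem_gaussian
  · rw [eq_neg_of_add_eq_zero_left h3]; exact gaussian.neg_mem I_mem_gaussian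

end Gaussian

namespace SplitSymplectic

variable {R W : Type u} [CommRing R] [Algebra (ZMod 4) R] [AddCommGroup W] [Module R W]
variable {D : SplitSymplectic R W}
variable [Finite R] [Module.Finite R W] [Module.Free R W] (hR : IsDyadic R)

/-- The unitary intertwiners `𝓗_L → 𝓗_M` that are defined over `ℤ[i, 1/2]`. -/
structure IsUnitaryIntegral {L M : D.ELag} (T : D.model L →ₗ[ℂ] D.model M) : Prop where
  intertwines : ∀ h f, T (D.modelRep L h f) = D.modelRep M h (T f)
  herm_eq : ∀ f, herm (T f).1 (T f).1 = herm f.1 f.1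
  integral : ∃ k : ℕ, ∀ f : D.model L, (∀ h, f.1 h ∈ gaussian) →
    ∀ h, 2 ^ k * (T f).1 h ∈ gaussian

/-- Isomorphisms which, with their inverses, are unitary intertwiners over `ℤ[i, 1/2]`. -/
structure IsUnitaryIntegralEquiv {L M : D.ELag} (T : D.model L ≃ₗ[ℂ] D.model M) : Prop where
  to_fun : IsUnitaryIntegral T.toLinearMap
  inv_fun : IsUnitaryIntegral T.symm.toLinearMap

theorem IsUnitaryIntegral.comp {L M N : D.ELag} {S : D.model M →ₗ[ℂ] D.model N}
    {T : D.model L →ₗ[ℂ] D.model M} (hS : IsUnitaryIntegral S) (hT : IsUnitaryIntegral T) :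
    IsUnitaryIntegral (S ∘ₗ T) where
  intertwines h f := by
    simp only [LinearMap.comp_apply, hT.intertwines, hS.intertwines]
  herm_eq f := by
    simp only [LinearMap.comp_apply, hT.herm_eq, hS.herm_eq]
  integral := by
    obtain ⟨k, hk⟩ := hS.integral
    obtain ⟨k', hk'⟩ := hT.integral
    refine ⟨k + k', fun f hf h => ?_⟩
    have := hk ((2 : ℂ) ^ k' • T f) (fun h => hk' f hf h) h
    rw [map_smul] at this
    rw [pow_add, mul_assoc]
    exact this

theorem IsUnitaryIntegralEquiv.symm {L M : D.ELag} {T : D.model L ≃ₗ[ℂ] D.model M}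
    (hT : IsUnitaryIntegralEquiv T) : IsUnitaryIntegralEquiv T.symm := ⟨hT.2, hT.1⟩

theorem IsUnitaryIntegralEquiv.trans {L M N : D.ELag} {T : D.model L ≃ₗ[ℂ] D.model M}
    {S : D.model M ≃ₗ[ℂ] D.model N} (hT : IsUnitaryIntegralEquiv T)
    (hS : IsUnitaryIntegralEquiv S) : IsUnitaryIntegralEquiv (T ≪≫ₗ S) :=
  ⟨hS.1.comp hT.1, hT.2.comp hS.2⟩

theorem delta_mem_gaussian (A : D.ELag) (h : D.Heis) : (delta A).1 h ∈ gaussian := by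
  rcases delta_pow A h with h1 | h1
  · rw [h1]; exact gaussian.zero_mem
  · exact mem_gaussian_of_pow_four h1

include hR in
/-- Unitary intertwiners over `ℤ[i, 1/2]` are unique up to fourth roots of unity. -/
theorem IsUnitaryIntegral.exists_eq_smul {L M : D.ELag} {S : D.model L →ₗ[ℂ] D.model M}
    (hS : IsUnitaryIntegral S) {T : D.model L ≃ₗ[ℂ] D.model M} (hT : IsUnitaryIntegralEquiv T) :
    ∃ ζ : ℂ, ζ ^ 4 = 1 ∧ ∀ f, S f = ζ • T f := by
  have h := hS.comp hT.2
  obtain ⟨c, hc⟩ := SplitSymplectic.exists_eq_smul hR M _ h.intertwines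
  refine ⟨c, ?_, fun f => ?_⟩
  · have h1 : Complex.normSq c = 1 := by
      have h2 := h.herm_eq (delta M)
      rw [hc] at h2
      have h3 : herm (c • delta M).1 (c • delta M).1 =
        (Complex.normSq c : ℂ) * herm (delta M).1 (delta M).1 := herm_smul_smul c (delta M).1
      rw [h3] at h2
      have h4 : herm (delta M).1 (delta M).1 ≠ 0 :=
        herm_self_ne_zero (by rw [delta_one]; exact one_ne_zero)
      exact_mod_cast mul_right_cancel₀ h4 (h2.trans (one_mul _).symm)
    obtain ⟨k, hk⟩ := h.integral
    have h2 := hk (delta M) (delta_mem_gaussian M) 1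
    rw [hc] at h2
    have h3 : (c • delta M).1 1 = c := by
      show c * (delta M).1 1 = c
      rw [delta_one, mul_one]
    rw [h3] at h2
    have h4 := pow_four_eq_of_mem_gaussian (j := 2 * k) h2 (by
      rw [map_mul, map_pow, h1, mul_one, pow_mul, show (2 : ℂ) = ((2 : ℝ) : ℂ) by simp,
        Complex.normSq_ofReal]
      norm_num)
    rw [mul_pow, ← pow_mul, pow_mul (-4 : ℂ), mul_comm k, pow_mul] at h4
    norm_num at h4
    exact h4
  · have := hc (T f)
    rw [LinearMap.comp_apply, LinearEquiv.coe_coe, LinearEquiv.symm_apply_apply] at this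
    exact this

theorem intertwiner_integral (M L : D.ELag) (f : D.model L) (hf : ∀ h, f.1 h ∈ gaussian)
    (h : D.Heis) : (D.intertwiner M L f).1 h ∈ gaussian := by
  have := Fintype.ofFinite M.L
  rw [intertwiner_apply]
  exact gaussian.sum_mem fun m _ => hf _

theorem normSq_one_add_I_pow (m : ℕ) : Complex.normSq ((1 + Complex.I) ^ m) = 2 ^ m := by
  rw [map_pow]
  congr 1
  rw [Complex.normSq_apply]
  norm_num

theorem one_add_I_pow_mem (m : ℕ) : (1 + Complex.I) ^ m ∈ gaussian :=
  gaussian.pow_mem (gaussian.add_mem gaussian.one_mem I_mem_gaussian) _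

theorem two_pow_mul_inv_mem (m : ℕ) : 2 ^ m * ((1 + Complex.I) ^ m)⁻¹ ∈ gaussian := by
  have h : (2 : ℂ) ^ m * ((1 + Complex.I) ^ m)⁻¹ = (1 - Complex.I) ^ m := by
    have h1 : (1 + Complex.I) ≠ 0 := by
      intro h
      have := congrArg Complex.re h
      norm_num at this
    rw [mul_inv_eq_iff_eq_mul₀ (pow_ne_zero _ h1), ← mul_pow]
    congr 1
    linear_combination Complex.I_sq
  rw [h]
  exact gaussian.pow_mem (gaussian.sub_mem gaussian.one_mem I_mem_gaussian) _

theorem transversal_symm {M L : D.ELag} (h : D.Transversal M L) : D.Transversal L M := by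
  unfold Transversal at *
  rwa [sup_comm]

include hR in
theorem isUnitaryIntegral_intertwiner {M L : D.ELag} (hML : D.Transversal M L) {m : ℕ}
    (hm : Nat.card M.L = 2 ^ m) {c : ℂ} (hc : Complex.normSq c * 2 ^ m = 1) {k : ℕ}
    (hk : 2 ^ k * c ∈ gaussian) : IsUnitaryIntegral (c • D.intertwiner M L) where
  intertwines h f := by
    rw [LinearMap.smul_apply, LinearMap.smul_apply, intertwiner_intertwines, map_smul]
  herm_eq f := by
    rw [LinearMap.smul_apply]
    refine (herm_smul_smul c (D.intertwiner M L f).1).trans ?_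
    rw [herm_intertwiner_self hR hML, hm, ← mul_assoc]
    have : (Complex.normSq c : ℂ) * ((2 ^ m : ℕ) : ℂ) = 1 := by exact_mod_cast hc
    rw [this, one_mul]
  integral := ⟨k, fun f hf h => by
    rw [LinearMap.smul_apply]
    show 2 ^ k * (c * (D.intertwiner M L f).1 h) ∈ gaussian
    rw [← mul_assoc]
    exact gaussian.mul_mem hk (intertwiner_integral M L f hf h)⟩

include hR in
/-- The normalized intertwiner of a pair in general position. -/
theorem exists_normalized_intertwiner {M L : D.ELag} (hML : D.Transversal M L) {m : ℕ}
    (hM : Nat.card M.L = 2 ^ m) (hL : Nat.card L.L = 2 ^ m) :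
    ∃ T : D.model L ≃ₗ[ℂ] D.model M, IsUnitaryIntegralEquiv T ∧
      D.intertwiner M L = (1 + Complex.I) ^ m • T.toLinearMap := by
  let a : ℂ := (1 + Complex.I) ^ m
  have ha : Complex.normSq a = 2 ^ m := normSq_one_add_I_pow m
  have h2m : (2 : ℝ) ^ m ≠ 0 := pow_ne_zero _ two_ne_zero
  have h2m' : (2 : ℂ) ^ m ≠ 0 := pow_ne_zero _ two_ne_zero
  have ha0 : a ≠ 0 := fun h => by
    rw [h, map_zero] at ha
    exact h2m ha.symm
  have hLM := transversal_symm hML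
  let T : D.model L ≃ₗ[ℂ] D.model M := LinearEquiv.ofLinearMap (a⁻¹ • D.intertwiner M L)
    ((a / 2 ^ m) • D.intertwiner L M)
    (by
      ext1 f
      simp only [LinearMap.comp_apply, LinearMap.smul_apply, map_smul, LinearMap.id_apply]
      rw [intertwiner_intertwiner hR hLM, smul_smul, smul_smul, hM]
      push_cast
      rw [show a / 2 ^ m * a⁻¹ * 2 ^ m = 1 by field_simp, one_smul])
    (by
      ext1 f
      simp only [LinearMap.comp_apply, LinearMap.smul_apply, map_smul, LinearMap.id_apply]
      rw [intertwiner_intertwiner hR hML, smul_smul, smul_smul, hL]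
      push_cast
      rw [show a⁻¹ * (a / 2 ^ m) * 2 ^ m = 1 by field_simp, one_smul])
  refine ⟨T, ⟨?_, ?_⟩, ?_⟩
  · exact isUnitaryIntegral_intertwiner hR hML hM (c := a⁻¹) (k := m)
      (by rw [map_inv₀, ha, inv_mul_cancel₀ h2m]) (two_pow_mul_inv_mem m)
  · refine isUnitaryIntegral_intertwiner hR hLM hL (c := a / 2 ^ m) (k := m) ?_ ?_
    · rw [map_div₀, ha, map_pow, show (2 : ℂ) = ((2 : ℝ) : ℂ) by simp, Complex.normSq_ofReal,
        mul_pow]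
      field_simp
    · rw [mul_div_cancel₀ _ h2m']
      exact one_add_I_pow_mem m
  · ext1 f
    show _ = a • (a⁻¹ • D.intertwiner M L f)
    rw [smul_smul, mul_inv_cancel₀ ha0, one_smul]

include hR in
theorem exists_isUnitaryIntegralEquiv (L M : D.ELag) :
    ∃ T : D.model L ≃ₗ[ℂ] D.model M, IsUnitaryIntegralEquiv T := by
  have := finite_red (R := R) (W := W)
  obtain ⟨N, h1, h2⟩ := D.exists_common_transversal_elag hR L M
  have hc : ∀ A : D.ELag, _ := fun A => D.card_eq_two_pow hR A.isLagrangian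
  obtain ⟨S, hS, -⟩ := exists_normalized_intertwiner hR h1 (hc _) (hc _)
  obtain ⟨T, hT, -⟩ := exists_normalized_intertwiner hR h2 (hc _) (hc _)
  exact ⟨S ≪≫ₗ T.symm, hS.trans hT.symm⟩

variable (D) in
/-- A unitary isomorphism over `ℤ[i, 1/2]` of `𝓗_L` with the fibre at the base point. -/
def frame (L : D.ELag) : D.model L ≃ₗ[ℂ] D.model (D.baseELag hR) :=
  (exists_isUnitaryIntegralEquiv hR L (D.baseELag hR)).choose

theorem isUnitaryIntegralEquiv_frame (L : D.ELag) :
    IsUnitaryIntegralEquiv (D.frame hR L) :=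
  (exists_isUnitaryIntegralEquiv hR L (D.baseELag hR)).choose_spec

variable (D) in
/-- A trivialization of `𝔥` by unitary isomorphisms over `ℤ[i, 1/2]`. -/
def unitaryTriv : Trivialization D.modelRep where
  map M L := D.frame hR L ≪≫ₗ (D.frame hR M).symm
  intertwines M L h x :=
    ((isUnitaryIntegralEquiv_frame hR L).trans
      (isUnitaryIntegralEquiv_frame hR M).symm).1.intertwines h x
  mul N M L x := by
    simp only [LinearEquiv.trans_apply, LinearEquiv.apply_symm_apply]

theorem isUnitaryIntegralEquiv_unitaryTriv (M L : D.ELag) :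
    IsUnitaryIntegralEquiv ((D.unitaryTriv hR).map M L) :=
  (isUnitaryIntegralEquiv_frame hR L).trans (isUnitaryIntegralEquiv_frame hR M).symm

end SplitSymplectic

end

end WeilTwo

namespace WeilTwo

noncomputable section

/-- The functional `x₁ ⊗ … ⊗ x_m ↦ e(x₁) ⋯ e(x_m)`. -/
def tpowFunctional (m : ℕ) {E : Type*} [AddCommGroup E] [Module ℂ E] (e : E →ₗ[ℂ] ℂ) :
    (⨂[ℂ] _ : Fin m, E) →ₗ[ℂ] ℂ :=
  PiTensorProduct.lift ((MultilinearMap.mkPiAlgebra ℂ (Fin m) ℂ).compLinearMap fun _ => e)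

theorem tpowFunctional_tprod (m : ℕ) {E : Type*} [AddCommGroup E] [Module ℂ E] (e : E →ₗ[ℂ] ℂ)
    (x : E) : tpowFunctional m e (PiTensorProduct.tprod ℂ fun _ => x) = e x ^ m := by
  simp [tpowFunctional]

theorem tpow_tprod (m : ℕ) {E F : Type*} [AddCommGroup E] [Module ℂ E] [AddCommGroup F]
    [Module ℂ F] (f : E →ₗ[ℂ] F) (x : E) :
    tpow m f (PiTensorProduct.tprod ℂ fun _ => x) = PiTensorProduct.tprod ℂ fun _ => f x :=
  PiTensorProduct.map_tprod _ _

theorem tpow_smul_map (m : ℕ) {E F : Type*} [AddCommGroup E] [Module ℂ E] [AddCommGroup F]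
    [Module ℂ F] (c : ℂ) (f : E →ₗ[ℂ] F) : tpow m (c • f) = c ^ m • tpow m f := by
  have : c • f = f ∘ₗ (c • LinearMap.id) := by ext; simp
  rw [this, tpow_comp, tpow_smul, LinearMap.comp_smul, LinearMap.comp_id]

namespace SplitSymplectic

variable {R W : Type u} [CommRing R] [Algebra (ZMod 4) R] [AddCommGroup W] [Module R W]
variable {D : SplitSymplectic R W}

/-- Evaluation at `1 ∈ H(V)`. -/
def evalOne (A : D.ELag) : D.model A →ₗ[ℂ] ℂ := LinearMap.proj 1 ∘ₗ (D.model A).subtype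

theorem evalOne_apply (A : D.ELag) (f : D.model A) : evalOne A f = f.1 1 := rfl

theorem pow_four_eq_one_of_tpow {E : Type*} [AddCommGroup E] [Module ℂ E] {A : D.ELag}
    {f g : E →ₗ[ℂ] D.model A} (hf : Function.Surjective f) {c : ℂ} (h : ∀ x, g x = c • f x)
    (hfg : tpow 4 g = tpow 4 f) : c ^ 4 = 1 := by
  obtain ⟨x, hx⟩ := hf (delta A)
  have h1 := congrArg (tpowFunctional 4 (evalOne A))
    (LinearMap.congr_fun hfg (PiTensorProduct.tprod ℂ fun _ => x))
  rw [tpow_tprod, tpow_tprod, tpowFunctional_tprod, tpowFunctional_tprod, h, hx, map_smul,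
    evalOne_apply, delta_one] at h1
  simpa using h1

variable [Finite R] [Module.Finite R W] [Module.Free R W] (hR : IsDyadic R)

/-- The fourth tensor power of a trivialization. -/
def tpowTriv (T : Trivialization D.modelRep) : Trivialization (tensorRep 4 D.modelRep) where
  map M L := PiTensorProduct.congr fun _ => T.map M L
  intertwines M L h x := by
    have h1 : tpow 4 (T.map M L).toLinearMap ∘ₗ tensorRep 4 D.modelRep L h =
        tensorRep 4 D.modelRep M h ∘ₗ tpow 4 (T.map M L).toLinearMap := by
      refine (PiTensorProduct.map_comp _ _).symm.trans
        (Eq.trans ?_ (PiTensorProduct.map_comp _ _))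
      congr 1
      funext i
      exact LinearMap.ext fun f => T.intertwines M L (h i) f
    exact LinearMap.congr_fun h1 x
  mul N M L x := by
    have h1 : tpow 4 (T.map N M).toLinearMap ∘ₗ tpow 4 (T.map M L).toLinearMap =
        tpow 4 (T.map N L).toLinearMap := by
      rw [← tpow_comp]
      congr 1
      exact LinearMap.ext fun f => T.mul N M L f
    exact LinearMap.congr_fun h1 x

theorem tpowTriv_toLinearMap (T : Trivialization D.modelRep) (M L : D.ELag) :
    ((tpowTriv T).map M L).toLinearMap = tpow 4 (T.map M L).toLinearMap := rfl

include hR in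
theorem normCoeff_smul_tpow_intertwiner {M L : D.ELag} (hML : D.Transversal M L)
    {T : D.model L ≃ₗ[ℂ] D.model M} (hT : IsUnitaryIntegralEquiv T) :
    D.normCoeff M • tpow 4 (D.intertwiner M L) = tpow 4 T.toLinearMap := by
  have hc : ∀ A : D.ELag, _ := fun A => D.card_eq_two_pow hR A.isLagrangian
  obtain ⟨S, hS, hF⟩ := exists_normalized_intertwiner hR hML (hc M) (hc L)
  obtain ⟨ζ, hζ, h⟩ := hS.1.exists_eq_smul hR hT
  have h' : S.toLinearMap = ζ • T.toLinearMap := LinearMap.ext h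
  rw [hF, h', tpow_smul_map, tpow_smul_map, hζ, one_smul, smul_smul, normCoeff, hc M]
  generalize Module.finrank (ZMod 4) R * (Module.finrank R W / 2) = m
  have h4 : (1 + Complex.I) ^ 4 = -4 := by
    linear_combination (Complex.I ^ 2 + 4 * Complex.I + 5) * Complex.I_sq
  have h5 : (-1) ^ m / ((2 ^ m : ℕ) : ℂ) ^ 2 * ((1 + Complex.I) ^ m) ^ 4 = 1 := by
    rw [← pow_mul, mul_comm m, pow_mul, h4]
    push_cast
    rw [← pow_mul, mul_comm m, pow_mul, div_mul_eq_mul_div, ← mul_pow, ← div_pow]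
    norm_num
  rw [h5, one_smul]

theorem isCanonical_tpowTriv : D.IsCanonical (tpowTriv (D.unitaryTriv hR)) := fun M L hML => by
  rw [tpowTriv_toLinearMap, normCoeff_smul_tpow_intertwiner hR hML
    (isUnitaryIntegralEquiv_unitaryTriv hR M L)]

include hR in
theorem existsUnique_isCanonical :
    ∃! T : Trivialization (tensorRep 4 D.modelRep), D.IsCanonical T := by
  have := finite_red (R := R) (W := W)
  refine ⟨tpowTriv (D.unitaryTriv hR), isCanonical_tpowTriv hR, fun T hT => ?_⟩
  refine Trivialization.ext fun M L => LinearEquiv.ext fun x => ?_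
  obtain ⟨N, h1, h2⟩ := D.exists_common_transversal_elag hR M L
  have h : ∀ A B, D.Transversal A B → ∀ y, T.map A B y =
      (tpowTriv (D.unitaryTriv hR)).map A B y := fun A B hAB =>
    LinearMap.congr_fun ((hT A B hAB).trans (isCanonical_tpowTriv hR A B hAB).symm)
  rw [← T.mul M N L, ← (tpowTriv _).mul M N L, h _ _ h2, h _ _ (transversal_symm h1)]

theorem canonicalT_eq (M L : D.ELag) :
    D.canonicalT M L = tpow 4 ((D.unitaryTriv hR).map M L).toLinearMap := by
  have h := existsUnique_isCanonical (D := D) hR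
  have h1 : D.canonicalT M L = (h.choose.map M L).toLinearMap := dif_pos h
  rw [h1, ← h.choose_spec.2 _ (isCanonical_tpowTriv hR), tpowTriv_toLinearMap]

include hR in
theorem canonicalT_comp (L M : D.ELag) :
    D.canonicalT L M ∘ₗ D.canonicalT M L = LinearMap.id := by
  rw [canonicalT_eq hR, canonicalT_eq hR, ← tpow_comp, ← tpow_id]
  congr 1
  ext1 x
  exact ((D.unitaryTriv hR).mul L M L x).trans ((D.unitaryTriv hR).map_self L x)

namespace WeilGerbe

variable (D) in
/-- The object of the Weil gerbe given by `𝔥` itself. -/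
def base : D.WeilGerbe where
  fiber L := D.model L
  π := D.modelRep
  triv := D.unitaryTriv hR
  φ L := LinearEquiv.refl ℂ _
  φ_intertwines _ _ _ := rfl
  φ_tpow M L := by
    rw [canonicalT_eq hR, LinearEquiv.refl_toLinearMap, LinearEquiv.refl_toLinearMap, tpow_id,
      tpow_id, LinearMap.comp_id, LinearMap.id_comp]

theorem φ_symm_intertwines (E : D.WeilGerbe) (L : D.ELag) (h : D.Heis) (x : D.model L) :
    (E.φ L).symm (D.modelRep L h x) = E.π L h ((E.φ L).symm x) := by
  rw [LinearEquiv.symm_apply_eq, E.φ_intertwines, LinearEquiv.apply_symm_apply]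

include hR in
/-- Two objects of the Weil gerbe are isomorphic. -/
theorem nonempty_hom (E F : D.WeilGerbe) : Nonempty (Hom E F) := by
  let Λ := D.baseELag hR
  refine ⟨⟨fun L => E.triv.map Λ L ≪≫ₗ E.φ Λ ≪≫ₗ (F.φ Λ).symm ≪≫ₗ F.triv.map L Λ, ?_, ?_, ?_⟩⟩
  · intro L h x
    simp only [LinearEquiv.trans_apply, E.triv.intertwines, E.φ_intertwines, φ_symm_intertwines,
      F.triv.intertwines]
  · intro M L x
    simp only [LinearEquiv.trans_apply, E.triv.mul, F.triv.mul]
  · intro L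
    have hE := E.φ_tpow Λ L
    have hF := F.φ_tpow L Λ
    simp only [LinearEquiv.coe_trans, tpow_comp]
    rw [← LinearMap.comp_assoc, ← LinearMap.comp_assoc, ← LinearMap.comp_assoc, hF,
      LinearMap.comp_assoc (tpow 4 (F.φ Λ).symm.toLinearMap), ← tpow_comp, LinearEquiv.comp_symm, tpow_id,
      LinearMap.comp_id, LinearMap.comp_assoc, hE, ← LinearMap.comp_assoc, canonicalT_comp hR,
      LinearMap.id_comp]

include hR in
theorem Hom.exists_eq_smul_at {E F : D.WeilGerbe} (f g : Hom E F) (L : D.ELag) :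
    ∃ ζ : ℂ, ζ ^ 4 = 1 ∧ ∀ x, g.map L x = ζ • f.map L x := by
  obtain ⟨c, hc⟩ := exists_eq_smul hR L
    ((F.φ L).toLinearMap ∘ₗ (g.map L).toLinearMap ∘ₗ (f.map L).symm.toLinearMap ∘ₗ
      (F.φ L).symm.toLinearMap) (fun h x => by
        have h1 : ∀ (y : F.fiber L), (f.map L).symm (F.π L h y) =
            E.π L h ((f.map L).symm y) := fun y => f.inv.intertwines L h y
        simp only [LinearMap.comp_apply, LinearEquiv.coe_coe, φ_symm_intertwines, h1,
          g.intertwines, F.φ_intertwines])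
  have hc' : ∀ x, F.φ L (g.map L x) = c • F.φ L (f.map L x) := by
    intro x
    have := hc (F.φ L (f.map L x))
    simpa only [LinearMap.comp_apply, LinearEquiv.coe_coe, LinearEquiv.symm_apply_apply] using this
  refine ⟨c, ?_, fun x => (F.φ L).injective (by rw [hc', map_smul])⟩
  refine pow_four_eq_one_of_tpow (f := (F.φ L).toLinearMap ∘ₗ (f.map L).toLinearMap)
    (g := (F.φ L).toLinearMap ∘ₗ (g.map L).toLinearMap)
    ((F.φ L).surjective.comp (f.map L).surjective) hc' ?_
  rw [tpow_comp, tpow_comp, f.map_tpow, g.map_tpow]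

include hR in
/-- Two morphisms of the Weil gerbe differ by a fourth root of unity. -/
theorem Hom.exists_eq_smul {E F : D.WeilGerbe} (f g : Hom E F) :
    ∃ ζ : ℂ, ζ ^ 4 = 1 ∧ ∀ L x, g.map L x = ζ • f.map L x := by
  let Λ := D.baseELag hR
  obtain ⟨ζ, hζ, h⟩ := f.exists_eq_smul_at hR g Λ
  refine ⟨ζ, hζ, fun L x => (F.triv.map Λ L).injective ?_⟩
  rw [← g.map_triv, h, f.map_triv, map_smul]

theorem nontrivial_fiber (E : D.WeilGerbe) (L : D.ELag) : Nontrivial (E.fiber L) := by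
  have : Nontrivial (D.model L) := ⟨delta L, 0, fun h => by
    have h1 := congrArg (evalOne L) h
    rw [evalOne_apply, delta_one, map_zero] at h1
    exact one_ne_zero h1⟩
  exact (E.φ L).toEquiv.nontrivial

theorem nontrivial_gam (E : D.WeilGerbe) (Λ : D.ELag) : Nontrivial E.Gam := by
  have := E.nontrivial_fiber Λ
  obtain ⟨x, hx⟩ := exists_ne (0 : E.fiber Λ)
  refine ⟨⟨fun L => E.triv.map L Λ x, fun M L => E.triv.mul M L Λ x⟩, 0, fun h => hx ?_⟩
  have h1 := congrFun (congrArg Subtype.val h) Λ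
  exact (E.triv.map_self Λ x).symm.trans h1

theorem transport_incl (E : D.WeilGerbe) (ζ : rootsOfUnity 4 ℂ) (f : E.Gam) :
    E.transport (AMp.incl ζ) f = ((ζ : ℂˣ) : ℂ) • f :=
  Subtype.ext (funext fun L => by
    show ((ζ : ℂˣ) : ℂ) • fiberCast E.fiber (one_smul _ L) (f.1 ((1 : D.ASp) • L)) =
      ((ζ : ℂˣ) : ℂ) • f.1 L
    rw [fiberCast_section f.1])

theorem transport_heisRep (E : D.WeilGerbe) (a : D.AMp) (h : D.Heis) (f : E.Gam) :
    E.transport a (E.heisRep (ASp.toMulAut a.g h) f) = E.heisRep h (E.transport a f) :=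
  Subtype.ext (funext fun L => Hom.intertwines (a.ι.hom.app E) L h (f.1 (a.g • L)))

theorem weilRep_heisRep (E : D.WeilGerbe) (a : D.AMp) (h : D.Heis) (f : E.Gam) :
    E.weilRep a (E.heisRep h f) = E.heisRep (ASp.toMulAut a.g h) (E.weilRep a f) := by
  have h1 := E.transport_heisRep a⁻¹ (ASp.toMulAut a.g h) f
  rw [AMp.inv_g, map_inv] at h1
  have h2 : (ASp.toMulAut a.g)⁻¹ (ASp.toMulAut a.g h) = h :=
    MulEquiv.symm_apply_apply (ASp.toMulAut a.g) h
  rw [h2] at h1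
  exact h1

theorem weilRep_incl (E : D.WeilGerbe) (ζ : rootsOfUnity 4 ℂ) (f : E.Gam) :
    E.weilRep (AMp.incl ζ) f = (((ζ⁻¹ : rootsOfUnity 4 ℂ) : ℂˣ) : ℂ) • f := by
  show E.transport (AMp.incl ζ)⁻¹ f = _
  rw [← map_inv, transport_incl]

end WeilGerbe

namespace AMp

open WeilGerbe

theorem app_incl (ζ : rootsOfUnity 4 ℂ) (E : D.WeilGerbe) (L)
    (x : E.fiber ((1 : D.ASp) • L)) :
    (incl ζ).app E L x = ((ζ : ℂˣ) : ℂ) • fiberCast E.fiber (one_smul _ L) x := rfl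

theorem incl_mul_comm (ζ : rootsOfUnity 4 ℂ) (a : D.AMp) : incl ζ * a = a * incl ζ := by
  refine ext ((one_mul a.g).trans (mul_one a.g).symm) fun E L x => ?_
  rw [app_mul (incl ζ) a, app_mul a (incl ζ)]
  refine (congrArg (a.app E L) (app_incl ζ E (a.g • L) _)).trans ?_
  refine Eq.trans ?_ (app_incl ζ E L _).symm
  rw [map_smul]
  congr 1
  refine Eq.trans ?_ (app_cast a E (one_smul _ L) _)
  rw [fiberCast_trans]
  exact congrArg (a.app E L) ((fiberCast_trans (E := E.fiber) _ _ _).trans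
    (fiberCast_trans (E := E.fiber) _ _ _).symm)

include hR in
theorem incl_injective : Function.Injective (incl (D := D)) := by
  intro ζ ξ h
  let E := base D hR
  have := E.nontrivial_gam (D.baseELag hR)
  obtain ⟨f, hf⟩ := exists_ne (0 : E.Gam)
  have h1 := E.transport_incl ζ f
  rw [h, E.transport_incl ξ f] at h1
  exact Subtype.ext (Units.ext (smul_left_injective ℂ hf h1.symm))

include hR in
theorem proj_surjective : Function.Surjective (proj (D := D)) := by
  intro g
  let B := base D hR
  let a : ∀ E : D.WeilGerbe, E ≅ B := fun E => (nonempty_hom hR E B).some.toIso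
  let b : (pull g).obj B ≅ B := (nonempty_hom hR ((pull g).obj B) B).some.toIso
  refine ⟨⟨g, NatIso.ofComponents (fun E => (pull g).mapIso (a E) ≪≫ b ≪≫ (a E).symm) ?_⟩, rfl⟩
  intro E F f
  obtain ⟨ζ, -, h⟩ := Hom.exists_eq_smul hR (a E).hom (f ≫ (a F).hom)
  have hF : ∀ L (y : B.fiber L), Hom.map (a F).hom L (Hom.map (a F).inv L y) = y := fun L y =>
    congrArg (fun k : Hom B B => k.map L y) (a F).inv_hom_id
  have hE : ∀ L (y : B.fiber L), Hom.map (a E).hom L (Hom.map (a E).inv L y) = y := fun L y =>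
    congrArg (fun k : Hom B B => k.map L y) (a E).inv_hom_id
  refine hom_ext fun L x => ?_
  show Hom.map (a F).inv L (Hom.map b.hom L (Hom.map (a F).hom (g • L) (Hom.map f (g • L) x))) =
    Hom.map f L (Hom.map (a E).inv L (Hom.map b.hom L (Hom.map (a E).hom (g • L) x)))
  apply (Hom.map (a F).hom L).injective
  rw [hF]
  have h1 : Hom.map (a F).hom (g • L) (Hom.map f (g • L) x) =
    ζ • Hom.map (a E).hom (g • L) x := h (g • L) x
  have h2 : ∀ y, Hom.map (a F).hom L (Hom.map f L y) = ζ • Hom.map (a E).hom L y := h L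
  rw [h1, h2, hE]
  exact map_smul (Hom.map b.hom L) ζ _

include hR in
theorem exists_incl_eq (a : D.AMp) (ha : a.g = 1) : ∃ ζ, incl ζ = a := by
  let B := base D hR
  let t := pullOne (D := D) a.g ha
  obtain ⟨ζ, hζ, h⟩ := Hom.exists_eq_smul hR (t.hom.app B) (a.ι.hom.app B)
  have hζ0 : ζ ≠ 0 := fun h0 => by rw [h0] at hζ; norm_num at hζ
  let ξ : rootsOfUnity 4 ℂ := ⟨Units.mk0 ζ hζ0, by
    rw [mem_rootsOfUnity]
    exact Units.ext hζ⟩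
  refine ⟨ξ, ext ha.symm fun E L x => ?_⟩
  have h1 : a.g • L = L := by rw [ha, one_smul]
  let f := (nonempty_hom hR E B).some
  have h0 : (1 : D.ASp) • L = a.g • L := by rw [ha]
  have key : ∀ y, a.app E L y = ζ • fiberCast E.fiber h1 y := by
    intro y
    apply (Hom.map f L).injective
    have h2 : Hom.map f L (a.app E L y) = a.app B L (Hom.map f (a.g • L) y) :=
      (congrArg (fun k : Hom (pullObj a.g E) B => k.map L y) (a.ι.hom.naturality f)).symm
    have h3 := h L (Hom.map f (a.g • L) y)
    refine h2.trans (h3.trans ?_)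
    rw [map_smul]
    congr 1
    exact fiberCast_map (E := E.fiber) (F := B.fiber) (Hom.map f) h1 y
  refine Eq.trans ?_ (key (fiberCast E.fiber h0 x)).symm
  exact congrArg (ζ • ·) (fiberCast_trans (E := E.fiber) h0 h1 x).symm

include hR in
theorem isCentralExtension : IsCentralExtension (incl (D := D)) (proj (D := D)) where
  injective := incl_injective hR
  surjective := proj_surjective hR
  exact := by
    ext a
    constructor
    · rintro ⟨ζ, rfl⟩
      rfl
    · exact fun h => exists_incl_eq hR a h
  central := by
    rintro _ ⟨ζ, rfl⟩
    rw [Subgroup.mem_center_iff]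
    exact fun a => (incl_mul_comm ζ a).symm

end AMp

end SplitSymplectic

end

end WeilTwo

namespace WeilTwo

noncomputable section

namespace SplitSymplectic

variable {R W : Type u} [CommRing R] [Algebra (ZMod 4) R] [AddCommGroup W] [Module R W]
variable (D : SplitSymplectic R W)

theorem redSp_mul (a b : D.SpW) : D.redSp (a * b) = D.redSp a * D.redSp b :=
  congrArg ASp.g (map_mul D.toASp a b)

theorem redSp_one : D.redSp 1 = 1 := congrArg ASp.g (map_one D.toASp)

theorem redSp_mul_apply (a b : D.SpW) (v : Red R W) :
    (D.redSp (a * b)).1 v = (D.redSp a).1 ((D.redSp b).1 v) := by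
  rw [redSp_mul]; rfl

theorem redSp_one_apply (v : Red R W) : (D.redSp 1).1 v = v := by
  rw [redSp_one]; rfl

theorem redSp_inv_apply (a : D.SpW) (v : Red R W) :
    (D.redSp a).1 ((D.redSp a⁻¹).1 v) = v := by
  rw [← redSp_mul_apply, mul_inv_cancel, redSp_one_apply]

/-- The stabilizer in `Sp(W)` of the reduction of `L₀`. -/
def stabL₀ : Subgroup D.SpW where
  carrier := {g | ∀ v, (D.redSp g).1 v ∈ D.L₀.map red ↔ v ∈ D.L₀.map red}
  mul_mem' {a b} ha hb v := by
    rw [redSp_mul_apply]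
    exact (ha _).trans (hb v)
  one_mem' v := by rw [redSp_one_apply]
  inv_mem' {a} ha v := by
    rw [← ha, redSp_inv_apply]

/-- The automorphisms that are trivial on `L₀` and on `W / L₀`. -/
def unipotentL₀ : Subgroup D.SpW where
  carrier := {g | (∀ l ∈ D.L₀, g.1 l = l) ∧ ∀ w, g.1 w - w ∈ D.L₀}
  mul_mem' {a b} ha hb := by
    have h : ∀ w, (a * b).1 w = a.1 (b.1 w) := fun w => rfl
    refine ⟨fun l hl => by rw [h, hb.1 l hl, ha.1 l hl], fun w => ?_⟩
    rw [h, ← sub_add_sub_cancel _ (b.1 w)]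
    exact D.L₀.add_mem (ha.2 _) (hb.2 _)
  one_mem' := ⟨fun _ _ => rfl, fun w => by
    show w - w ∈ _
    rw [sub_self]
    exact D.L₀.zero_mem⟩
  inv_mem' {a} ha := by
    have h : ∀ w, a.1 (a⁻¹.1 w) = w := fun w =>
      congrArg (fun g : D.SpW => g.1 w) (mul_inv_cancel a)
    have h1 : ∀ l ∈ D.L₀, a⁻¹.1 l = l := fun l hl => by
      apply a.1.injective
      rw [h, ha.1 l hl]
    refine ⟨h1, fun w => ?_⟩
    have h2 := ha.2 (a⁻¹.1 w)
    rw [h] at h2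
    rw [← neg_sub]
    exact D.L₀.neg_mem h2

theorem isPGroup_unipotentL₀ : IsPGroup 2 D.unipotentL₀ := by
  rintro ⟨g, hg⟩
  have h : ∀ (k : ℕ) (w : W), (g ^ k).1 w = w + (k : R) • (g.1 w - w) := by
    intro k w
    induction k with
    | zero =>
      rw [pow_zero, Nat.cast_zero, zero_smul, add_zero]
      rfl
    | succ k ih =>
      have h1 : (g ^ (k + 1)).1 w = g.1 ((g ^ k).1 w) := by rw [pow_succ']; rfl
      rw [h1, ih, map_add, map_smul, hg.1 _ (hg.2 w), Nat.cast_succ, add_smul, one_smul]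
      abel
  refine ⟨2, Subtype.ext (Subtype.ext (LinearEquiv.ext fun w => ?_))⟩
  refine (h 4 w).trans ?_
  push_cast
  rw [four_eq_zero R, zero_smul, add_zero]
  rfl

/-- The symplectic transvection `w ↦ w + ω(u, w) u`. -/
def transvection (u : W) : D.SpW :=
  ⟨LinearEquiv.ofLinearMap (LinearMap.id + (D.ω u).smulRight u)
      (LinearMap.id - (D.ω u).smulRight u)
      (by ext w; simp [D.isAlt.self_eq_zero])
      (by ext w; simp [D.isAlt.self_eq_zero]), fun v w => by
    show D.ω (v + D.ω u v • u) (w + D.ω u w • u) = D.ω v w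
    have := D.isAlt.neg_eq u v
    simp only [map_add, LinearMap.add_apply, map_smul, LinearMap.smul_apply, smul_eq_mul,
      D.isAlt.self_eq_zero u]
    rw [← this]
    ring⟩

theorem transvection_apply (u w : W) : (D.transvection u).1 w = w + D.ω u w • u := rfl

theorem transvection_mem {u : W} (hu : u ∈ D.L₀) : D.transvection u ∈ D.unipotentL₀ := by
  refine ⟨fun l hl => ?_, fun w => ?_⟩
  · rw [transvection_apply, (D.isLagrangian_L₀ u).1 hu l hl, zero_smul, add_zero]
  · rw [transvection_apply, add_sub_cancel_left]
    exact D.L₀.smul_mem _ hu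

variable [Finite R] [Module.Finite R W]

theorem finite_spW : Finite D.SpW :=
  have : Finite W := Module.finite_of_finite R
  Finite.of_injective (fun g : D.SpW => (g.1 : W → W)) fun _ _ h =>
    Subtype.ext (LinearEquiv.ext (congrFun h))

/-- A `2`-group of symplectic automorphisms fixes a vector modulo a proper invariant subspace. -/
theorem exists_fixed_mod {S : Subgroup D.SpW} (hS : IsPGroup 2 S) {I J : Submodule R (Red R W)}
    (hI : ∀ s ∈ S, ∀ v ∈ I, (D.redSp s).1 v ∈ I) (hJ : ∀ s ∈ S, ∀ v ∈ J, (D.redSp s).1 v ∈ J)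
    (hJI : ¬ J ≤ I) :
    ∃ v ∈ J, v ∉ I ∧ ∀ s ∈ S, (D.redSp s).1 v - v ∈ I := by
  have : Finite (Red R W) := Module.finite_of_finite R
  have : Finite (Red R W ⧸ I) := Finite.of_surjective _ (Submodule.mkQ_surjective I)
  let Q := J.map I.mkQ
  have : Finite Q := Subtype.finite
  let m : S → (Red R W ⧸ I) →ₗ[R] (Red R W ⧸ I) := fun s =>
    I.mapQ I ((D.redSp s.1).1 : Red R W →ₗ[R] Red R W) fun v hv => hI _ s.2 v hv
  have hm : ∀ s (v : Red R W), m s (I.mkQ v) = I.mkQ ((D.redSp s.1).1 v) := fun s v => rfl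
  have hmQ : ∀ s, ∀ q ∈ Q, m s q ∈ Q := by
    rintro s _ ⟨v, hv, rfl⟩
    exact ⟨_, hJ _ s.2 v hv, rfl⟩
  let _ : MulAction S Q :=
    { smul := fun s q => ⟨m s q.1, hmQ s q.1 q.2⟩
      one_smul := fun ⟨_, v, hv, rfl⟩ => Subtype.ext (congrArg I.mkQ (D.redSp_one_apply v))
      mul_smul := fun s t ⟨_, v, hv, rfl⟩ =>
        Subtype.ext (congrArg I.mkQ (D.redSp_mul_apply s.1 t.1 v)) }
  obtain ⟨x, hx, hxI⟩ := SetLike.not_le_iff_exists.1 hJI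
  have h2 : 2 ∣ Nat.card Q := by
    let q : Q := ⟨I.mkQ x, x, hx, rfl⟩
    have hq : addOrderOf q = 2 := by
      refine addOrderOf_eq_prime ?_ fun h => hxI ?_
      · refine Subtype.ext ?_
        show 2 • I.mkQ x = 0
        rw [two_nsmul, ← map_add, add_self_red, map_zero]
      · exact (Submodule.Quotient.mk_eq_zero I).1 (congrArg Subtype.val h)
    rw [← hq]
    exact addOrderOf_dvd_natCard q
  obtain ⟨⟨_, v, hv, rfl⟩, hb, hne⟩ := hS.exists_fixed_point_of_prime_dvd_card_of_fixed_point Q h2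
    (a := 0) (fun s => Subtype.ext (map_zero (m s)))
  refine ⟨v, hv, fun h => hne (Subtype.ext ?_), fun s hs => ?_⟩
  · exact ((Submodule.Quotient.mk_eq_zero I).2 h).symm
  · exact (Submodule.Quotient.eq I).1 (congrArg Subtype.val (hb ⟨s, hs⟩))

theorem redSp_orthogonal {S : Subgroup D.SpW} {I : Submodule R (Red R W)}
    (hI : ∀ s ∈ S, ∀ v ∈ I, (D.redSp s).1 v ∈ I) :
    ∀ s ∈ S, ∀ v ∈ D.omega.orthogonal I, (D.redSp s).1 v ∈ D.omega.orthogonal I := by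
  intro s hs v hv x hx
  have h := (D.redSp s).2 ((D.redSp s⁻¹).1 x) v
  rw [redSp_inv_apply] at h
  exact h.trans (hv _ (hI _ (S.inv_mem hs) x hx))

/-- A `2`-group of symplectic automorphisms fixes a Lagrangian of `V`. -/
theorem exists_invariant_isLagrangian {S : Subgroup D.SpW} (hS : IsPGroup 2 S) :
    ∃ I, IsLagrangian D.omega I ∧ ∀ s ∈ S, ∀ v ∈ I, (D.redSp s).1 v ∈ I := by
  have : Finite (Red R W) := Module.finite_of_finite R
  let T : Set (Submodule R (Red R W)) :=
    {I | I ≤ D.omega.orthogonal I ∧ ∀ s ∈ S, ∀ v ∈ I, (D.redSp s).1 v ∈ I}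
  obtain ⟨I, ⟨hI, hIS⟩, hmax⟩ := (Set.toFinite T).exists_maximal
    ⟨⊥, bot_le, fun s _ v hv => by
      rw [(Submodule.mem_bot R).1 hv, map_zero]; exact Submodule.zero_mem _⟩
  refine ⟨I, ?_, hIS⟩
  rw [isLagrangian_iff D.omega_isAlt]
  refine le_antisymm ?_ hI
  by_contra h
  obtain ⟨v, hv, hvI, hfix⟩ := D.exists_fixed_mod hS hIS (D.redSp_orthogonal hIS) h
  refine hvI (hmax (y := I ⊔ R ∙ v) ⟨?_, ?_⟩ le_sup_left
    (Submodule.mem_sup_right (Submodule.mem_span_singleton_self v)))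
  · have h5 : ∀ n ∈ I, D.omega n v = 0 := fun n hn => hv n hn
    have h6 : ∀ n ∈ I, D.omega v n = 0 := fun n hn => D.omega_isAlt.isRefl _ _ (h5 n hn)
    have h7 : ∀ n ∈ I, ∀ m ∈ I, D.omega n m = 0 := fun n hn m hm => hI hm n hn
    intro a ha b hb
    obtain ⟨n, hn, y, hy, rfl⟩ := Submodule.mem_sup.1 ha
    obtain ⟨r, rfl⟩ := Submodule.mem_span_singleton.1 hy
    obtain ⟨m, hm, z, hz, rfl⟩ := Submodule.mem_sup.1 hb
    obtain ⟨s, rfl⟩ := Submodule.mem_span_singleton.1 hz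
    show D.omega _ _ = 0
    simp [h5 _ hm, h6 _ hn, h7 _ hm _ hn, D.omega_isAlt.self_eq_zero]
  · intro s hs a ha
    obtain ⟨n, hn, y, hy, rfl⟩ := Submodule.mem_sup.1 ha
    obtain ⟨r, rfl⟩ := Submodule.mem_span_singleton.1 hy
    rw [map_add, map_smul, ← sub_add_cancel ((D.redSp s).1 v) v]
    exact Submodule.add_mem _ (Submodule.mem_sup_left (hIS s hs n hn))
      (Submodule.smul_mem _ _ (Submodule.add_mem _ (Submodule.mem_sup_left (hfix s hs))
        (Submodule.mem_sup_right (Submodule.mem_span_singleton_self v))))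

theorem eq_of_isLagrangian_of_le {L M : Submodule R (Red R W)} (hL : IsLagrangian D.omega L)
    (hM : IsLagrangian D.omega M) (h : L ≤ M) : L = M := by
  refine le_antisymm h fun v hv => ?_
  rw [hL]
  exact fun l hl => (hM v).1 hv l (h hl)

variable [Module.Free R W] (hR : IsDyadic R)

include hR in
/-- The reduction of `L₀` is the only Lagrangian which is fixed by the transvections of `L₀`. -/
theorem eq_red_L₀_of_transvection {I : Submodule R (Red R W)} (hI : IsLagrangian D.omega I)
    (h : ∀ u ∈ D.L₀, ∀ v ∈ I, (D.redSp (D.transvection u)).1 v ∈ I) : I = D.L₀.map red := by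
  have := hR.isLocalRing
  have h1 : ∀ u ∈ D.L₀, ∀ w, red w ∈ I → D.ω u w • (red u : Red R W) ∈ I := by
    intro u hu w hw
    have h2 := I.sub_mem (h u hu _ hw) hw
    have h3 : (D.redSp (D.transvection u)).1 (red w) = red w + D.ω u w • red u := by
      rw [redSp_red, transvection_apply, map_add, map_smul]
    rwa [h3, add_sub_cancel_left] at h2
  have h1' : ∀ u ∈ D.L₀, ∀ w, red w ∈ I → IsUnit (D.ω u w) → (red u : Red R W) ∈ I := by
    rintro u hu w hw ⟨c, hc⟩
    have h2 := I.smul_mem (↑c⁻¹ : R) (h1 u hu w hw)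
    rwa [← hc, smul_smul, Units.inv_mul, one_smul] at h2
  by_cases hex : ∃ u ∈ D.L₀, ∃ w, red w ∈ I ∧ IsUnit (D.ω u w)
  · obtain ⟨u, hu, w, hw, hc⟩ := hex
    refine (D.eq_of_isLagrangian_of_le (D.isLagrangian_red_L₀ hR) hI ?_).symm
    rintro _ ⟨u', hu', rfl⟩
    by_cases hc' : IsUnit (D.ω u' w)
    · exact h1' u' hu' w hw hc'
    · have h2 : IsUnit (D.ω (u' + u) w) := by
        by_contra h3
        rw [map_add, LinearMap.add_apply] at h3
        refine (IsLocalRing.nonunits_add (a := D.ω u' w + D.ω u w) (b := -D.ω u' w) h3 ?_) ?_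
        · rwa [mem_nonunits_iff, IsUnit.neg_iff]
        · rwa [add_neg_cancel_comm]
      have h3 := I.sub_mem (h1' _ (D.L₀.add_mem hu' hu) w hw h2) (h1' u hu w hw hc)
      rwa [← map_sub, add_sub_cancel_right] at h3
  · push Not at hex
    refine D.eq_of_isLagrangian_of_le hI (D.isLagrangian_red_L₀ hR) fun v hv => ?_
    rw [D.isLagrangian_red_L₀ hR]
    rintro _ ⟨u, hu, rfl⟩
    obtain ⟨w, rfl⟩ := Submodule.mkQ_surjective _ v
    obtain ⟨s, hs⟩ := (hR.isUnit_or _).resolve_left (hex u hu w hv)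
    show 2 * D.ω w u = 0
    rw [D.ω_swap, hs]
    linear_combination -s * four_eq_zero R

include hR in
theorem not_two_dvd_index_stabL₀ : ¬ 2 ∣ D.stabL₀.index := by
  have := D.finite_spW
  have : Fact (Nat.Prime 2) := ⟨Nat.prime_two⟩
  obtain ⟨S, hS⟩ := D.isPGroup_unipotentL₀.exists_le_sylow
  obtain ⟨I, hI, hIS⟩ := D.exists_invariant_isLagrangian S.isPGroup'
  have hI' := D.eq_red_L₀_of_transvection hR hI fun u hu => hIS _ (hS (D.transvection_mem hu))
  have hle : (S : Subgroup D.SpW) ≤ D.stabL₀ := by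
    intro s hs v
    rw [← hI']
    refine ⟨fun h => ?_, hIS s hs v⟩
    have h1 := hIS _ (S.inv_mem hs) _ h
    rwa [← redSp_mul_apply, inv_mul_cancel, redSp_one_apply] at h1
  exact fun h => S.not_dvd_index (h.trans (Subgroup.index_dvd_of_le hle))

end SplitSymplectic

end

end WeilTwo

namespace WeilTwo

noncomputable section

open SplitSymplectic

section Sign

variable {R : Type u} [CommRing R] [Algebra (ZMod 4) R]

theorem one_add_two_mul_pow (x : R) (k : ℕ) : (1 + 2 * x) ^ k = 1 + 2 * (k * x) := by
  induction k with
  | zero => simp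
  | succ k ih =>
    rw [pow_succ, ih]
    push_cast
    linear_combination (k * x * x) * four_eq_zero R

variable [Finite R] (hR : IsDyadic R)

include hR in
/-- There is an odd `N` such that the `N`-th power of every unit is `1` modulo `2`. -/
theorem IsDyadic.exists_odd_pow :
    ∃ N : ℕ, Odd N ∧ ∀ u : R, IsUnit u → ∃ y, u ^ N = 1 + 2 * y := by
  have := hR.nontrivial
  obtain ⟨k, N, hN, h⟩ := Nat.exists_eq_two_pow_mul_odd (n := Nat.card Rˣ) Nat.card_pos.ne'
  refine ⟨N, hN, fun u hu => ?_⟩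
  obtain ⟨u, rfl⟩ := hu
  have h1 : ((u : R) ^ N) ^ 2 ^ k = 1 := by
    rw [← pow_mul, mul_comm, ← h, ← Units.val_pow_eq_pow_val, pow_card_eq_one', Units.val_one]
  have h2 : ∀ (j : ℕ) (w : R), IsUnit (w - 1) → IsUnit (w ^ 2 ^ j - 1) := by
    intro j
    induction j with
    | zero => intro w hw; simpa using hw
    | succ j ih =>
      intro w hw
      rw [pow_succ', pow_mul]
      refine ih _ ?_
      have h3 : IsUnit (w + 1) := by
        rcases hR.isUnit_or (w + 1) with h | ⟨s, hs⟩
        · exact h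
        · rw [show w - 1 = 2 * (s - 1) by linear_combination hs] at hw
          exact (hR.not_isUnit_two_mul _ hw).elim
      rw [show w ^ 2 - 1 = (w - 1) * (w + 1) by ring]
      exact hw.mul h3
  rcases hR.isUnit_or ((u : R) ^ N - 1) with h3 | ⟨y, hy⟩
  · have := h2 k _ h3
    rw [h1, sub_self] at this
    exact (not_isUnit_zero this).elim
  · exact ⟨y, by rw [← hy]; ring⟩

/-- An odd exponent which kills the units modulo `2`. -/
def oddExp : ℕ := hR.exists_odd_pow.choose

theorem odd_oddExp : Odd (oddExp hR) := hR.exists_odd_pow.choose_spec.1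

theorem exists_pow_oddExp (u : R) (hu : IsUnit u) : ∃ y, u ^ oddExp hR = 1 + 2 * y :=
  hR.exists_odd_pow.choose_spec.2 u hu

/-- The quadratic character of `Rˣ` with `1 + 2 x ↦ ψ(2 x)`. -/
def unitSign (u : R) : ℂ := psi R (u ^ oddExp hR - 1)

theorem unitSign_mul {u w : R} (hu : IsUnit u) (hw : IsUnit w) :
    unitSign hR (u * w) = unitSign hR u * unitSign hR w := by
  obtain ⟨y, hy⟩ := exists_pow_oddExp hR u hu
  obtain ⟨z, hz⟩ := exists_pow_oddExp hR w hw
  rw [unitSign, unitSign, unitSign, ← psi_add, mul_pow, hy, hz]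
  congr 1
  linear_combination y * z * four_eq_zero R

theorem unitSign_one_add (x : R) : unitSign hR (1 + 2 * x) = psi R (2 * x) := by
  rw [unitSign, one_add_two_mul_pow]
  obtain ⟨m, hm⟩ := odd_oddExp hR
  rw [hm]
  push_cast
  congr 1
  linear_combination (m * x) * four_eq_zero R

theorem unitSign_sq {u : R} (hu : IsUnit u) : unitSign hR u ^ 2 = 1 := by
  obtain ⟨y, hy⟩ := exists_pow_oddExp hR u hu
  rw [unitSign, hy, psi_sq, add_sub_cancel_left, ← mul_assoc,
    show (2 : R) * 2 = 0 by linear_combination four_eq_zero R, zero_mul, psi_zero]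

include hR in
theorem two_mul_eq_zero_of_psi {x : R} (h : ∀ s, psi R (2 * (s ^ 2 * x)) = 1) : 2 * x = 0 := by
  rcases hR.isUnit_or x with hx | ⟨y, rfl⟩
  · obtain ⟨t, ht⟩ := hR.exists_psi_ne_one
    refine (ht ?_).elim
    obtain ⟨m, hm⟩ := odd_oddExp hR
    obtain ⟨y, hy⟩ := exists_pow_oddExp hR x hx
    rw [← hR.psi_two_mul_sq, ← h (t * x ^ m)]
    congr 1
    rw [hm] at hy
    linear_combination (-2 * t ^ 2) * hy - (t ^ 2 * y) * four_eq_zero R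
  · linear_combination y * four_eq_zero R

variable {ι : Type*} [Fintype ι] [DecidableEq ι]

omit [Algebra (ZMod 4) R] [Finite R] in
/-- Off-diagonal terms of a symmetric sum cancel in characteristic two. -/
theorem sum_sum_eq_sum_diag (F : ι → ι → R) (hF : ∀ i j, F i j = F j i)
    (h2 : ∀ i j, F i j + F i j = 0) : ∑ i, ∑ j, F i j = ∑ i, F i i := by
  have h : ∑ p ∈ (Finset.univ : Finset ι).offDiag, F p.1 p.2 = 0 := by
    refine Finset.sum_involution (fun p _ => p.swap) ?_ ?_ ?_ ?_
    · intro p _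
      show F p.1 p.2 + F p.2 p.1 = 0
      rw [hF p.2, h2]
    · intro p hp _ h
      rw [Finset.mem_offDiag] at hp
      exact hp.2.2 (congrArg Prod.snd h)
    · intro p hp
      rw [Finset.mem_offDiag] at hp ⊢
      exact ⟨hp.2.1, hp.1, hp.2.2.symm⟩
    · intro p _
      exact Prod.swap_swap p
  have h1 := Finset.sum_product' Finset.univ Finset.univ F
  rw [← h1, ← Finset.diag_union_offDiag, Finset.sum_union (Finset.disjoint_diag_offDiag _), h,
    add_zero, Finset.sum_diag]

open Matrix

theorem two_smul_eq_iff {X Y : Matrix ι ι R} :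
    (2 : R) • X = (2 : R) • Y ↔ ∀ i j, 2 * X i j = 2 * Y i j := by
  rw [← Matrix.ext_iff]
  rfl

theorem det_one_add_two_smul (X : Matrix ι ι R) : (1 + (2 : R) • X).det = 1 + 2 * X.trace := by
  rw [Matrix.det_one_add_smul]
  rw [show (2 : R) ^ 2 = 0 by linear_combination four_eq_zero R, mul_zero, add_zero, mul_comm]

theorem unitSign_det_cocycle {A B D A' C' : Matrix ι ι R} (hA : IsUnit A.det)
    (hA' : IsUnit A'.det) (hD : (2 : R) • (Dᵀ * A) = (2 : R) • 1)
    (hT : (Bᵀ * D)ᵀ = Bᵀ * D) (hC : (2 : R) • (A'ᵀ * C') = (2 : R) • (C'ᵀ * A')) {v : ι → R}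
    (hv : ∀ y, psi R (2 * (A' *ᵥ y ⬝ᵥ C' *ᵥ y + A' *ᵥ y ⬝ᵥ v)) = 1) :
    unitSign hR (A * A' + (2 : R) • (B * C')).det =
      unitSign hR A.det * unitSign hR A'.det * psi R (2 * (B *ᵥ v ⬝ᵥ D *ᵥ v)) := by
  let Z := C' * A'⁻¹
  have h2 : ∀ r : R, 2 * r + 2 * r = 0 := fun r => by linear_combination r * four_eq_zero R
  have hZ : ∀ i j, 2 * Z i j = 2 * Z j i := by
    have h1 : (2 : R) • Z = (2 : R) • Zᵀ := by
      have h3 := congrArg (fun M => (A'⁻¹)ᵀ * M * A'⁻¹) hC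
      simp only [Matrix.mul_smul, Matrix.smul_mul] at h3
      have h4 : (A'⁻¹)ᵀ * A'ᵀ = 1 := by
        rw [← Matrix.transpose_mul, Matrix.mul_nonsing_inv _ hA', Matrix.transpose_one]
      rw [← Matrix.mul_assoc, h4, Matrix.one_mul, Matrix.mul_assoc, Matrix.mul_assoc,
        Matrix.mul_nonsing_inv _ hA', Matrix.mul_one] at h3
      rw [Matrix.transpose_mul]
      exact h3
    exact two_smul_eq_iff.1 h1
  have hvZ : ∀ i, 2 * Z i i = 2 * v i ^ 2 := by
    intro i
    have h3 : 2 * (Z i i + v i ^ 2) = 0 := by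
      refine two_mul_eq_zero_of_psi hR fun s => ?_
      have h4 := hv (A'⁻¹ *ᵥ Pi.single i s)
      rw [Matrix.mulVec_mulVec, Matrix.mulVec_mulVec, Matrix.mul_nonsing_inv _ hA',
        Matrix.one_mulVec, single_dotProduct, single_dotProduct, Matrix.mulVec_single] at h4
      have h5 : psi R (2 * (s * v i)) = psi R (2 * (s * v i) ^ 2) := (hR.psi_two_mul_sq _).symm
      rw [mul_add, psi_add, h5, ← psi_add] at h4
      rw [← h4]
      congr 1
      simp [Z]
      ring
    linear_combination h3 - v i ^ 2 * four_eq_zero R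
  have hA2 : (2 : R) • A⁻¹ = (2 : R) • Dᵀ := by
    have := congrArg (· * A⁻¹) hD
    simp only [Matrix.smul_mul] at this
    rw [Matrix.mul_assoc, Matrix.mul_nonsing_inv _ hA, Matrix.mul_one, Matrix.one_mul] at this
    exact this.symm
  have hdet : (A * A' + (2 : R) • (B * C')).det =
      A.det * A'.det * (1 + 2 * (A⁻¹ * B * Z).trace) := by
    have h3 : A * A' + (2 : R) • (B * C') = A * (1 + (2 : R) • (A⁻¹ * B * Z)) * A' := by
      rw [Matrix.mul_add, Matrix.add_mul, Matrix.mul_one, Matrix.mul_smul, Matrix.smul_mul]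
      congr 2
      rw [Matrix.mul_assoc A⁻¹, ← Matrix.mul_assoc A, Matrix.mul_nonsing_inv _ hA, Matrix.one_mul,
        Matrix.mul_assoc B, Matrix.mul_assoc C', Matrix.nonsing_inv_mul _ hA', Matrix.mul_one]
    rw [h3, Matrix.det_mul, Matrix.det_mul, det_one_add_two_smul]
    ring
  have htr : 2 * (A⁻¹ * B * Z).trace = 2 * (B *ᵥ v ⬝ᵥ D *ᵥ v) := by
    let T := Bᵀ * D
    have hTs : ∀ i j, T i j = T j i := fun i j => (congrFun (congrFun hT i) j).symm
    have h3 : 2 * (A⁻¹ * B * Z).trace = 2 * (T * Z).trace := by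
      have h4 : (2 : R) • (A⁻¹ * B * Z) = (2 : R) • (T * Z) := by
        have hT' : T = Dᵀ * B := hT.symm.trans (by
          rw [Matrix.transpose_mul, Matrix.transpose_transpose])
        rw [← Matrix.smul_mul, ← Matrix.smul_mul, hA2, Matrix.smul_mul, hT', Matrix.smul_mul]
      have := congrArg Matrix.trace h4
      simpa only [Matrix.trace_smul, smul_eq_mul] using this
    have h4 : 2 * (T * Z).trace = ∑ i, 2 * (T i i * Z i i) := by
      rw [← sum_sum_eq_sum_diag (fun i j => 2 * (T i j * Z j i)), Matrix.trace, Finset.mul_sum]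
      · refine Finset.sum_congr rfl fun i _ => ?_
        rw [Matrix.diag_apply, Matrix.mul_apply, Finset.mul_sum]
      · intro i j
        rw [hTs j i]
        linear_combination T i j * hZ j i
      · exact fun i j => h2 _
    have h5 : 2 * (B *ᵥ v ⬝ᵥ D *ᵥ v) = ∑ i, 2 * (T i i * v i ^ 2) := by
      have h6 : B *ᵥ v ⬝ᵥ D *ᵥ v = v ⬝ᵥ T *ᵥ v := by
        rw [← Matrix.mulVec_mulVec, Matrix.dotProduct_mulVec v, Matrix.vecMul_transpose]
      rw [h6, dotProduct, Finset.mul_sum]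
      have h7 := sum_sum_eq_sum_diag (fun i j => 2 * (v i * (T i j * v j)))
        (fun i j => by rw [hTs j i]; ring) (fun i j => h2 _)
      refine Eq.trans (Finset.sum_congr rfl fun i _ => ?_) (h7.trans
        (Finset.sum_congr rfl fun i _ => by ring))
      rw [Matrix.mulVec, dotProduct, Finset.mul_sum, Finset.mul_sum]
    rw [h3, h4, h5]
    refine Finset.sum_congr rfl fun i _ => ?_
    linear_combination T i i * hvZ i
  have hu : IsUnit (1 + 2 * (A⁻¹ * B * Z).trace) :=
    IsUnit.of_mul_eq_one (1 - 2 * (A⁻¹ * B * Z).trace)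
      (by linear_combination (-(A⁻¹ * B * Z).trace ^ 2) * four_eq_zero R)
  rw [hdet, unitSign_mul hR (hA.mul hA') hu, unitSign_mul hR hA hA', unitSign_one_add, htr]

end Sign

end

end WeilTwo

namespace WeilTwo

noncomputable section

namespace SplitSymplectic

variable {R W : Type u} [CommRing R] [Algebra (ZMod 4) R] [AddCommGroup W] [Module R W]
variable {D : SplitSymplectic R W}

namespace AdaptedBasis

open Matrix

variable {n : ℕ} (B : D.AdaptedBasis n)

/-- The coordinates along the first Lagrangian. -/
def coordE : W →ₗ[R] Fin n → R := LinearMap.pi fun i => D.ω.flip (B.f i)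

/-- The coordinates along the second Lagrangian. -/
def coordF : W →ₗ[R] Fin n → R := LinearMap.pi fun i => D.ω (B.e i)

theorem coordE_apply (w : W) (i : Fin n) : B.coordE w i = D.ω w (B.f i) := rfl

theorem coordF_apply (w : W) (i : Fin n) : B.coordF w i = D.ω (B.e i) w := rfl

/-- The vector with given coordinates along the first Lagrangian. -/
def vecE (y : Fin n → R) : W := ∑ i, y i • B.e i

/-- The vector with given coordinates along the second Lagrangian. -/
def vecF (y : Fin n → R) : W := ∑ i, y i • B.f i

theorem vecE_mem (y : Fin n → R) : B.vecE y ∈ D.L₀ :=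
  Submodule.sum_mem _ fun i _ => D.L₀.smul_mem _ (B.e_mem i)

theorem vecF_mem (y : Fin n → R) : B.vecF y ∈ D.M₀ :=
  Submodule.sum_mem _ fun i _ => D.M₀.smul_mem _ (B.f_mem i)

theorem vecE_add_vecF (w : W) : B.vecE (B.coordE w) + B.vecF (B.coordF w) = w := by
  obtain ⟨l, hl, m, hm, rfl⟩ := Submodule.mem_sup.1
    (D.isCompl.sup_eq_top.ge (Submodule.mem_top (x := w)))
  have h1 : B.coordE (l + m) = fun i => D.ω l (B.f i) := funext fun i => by
    rw [coordE_apply, map_add, LinearMap.add_apply,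
      (D.isLagrangian_M₀ m).1 hm _ (B.f_mem i), add_zero]
  have h2 : B.coordF (l + m) = fun i => D.ω (B.e i) m := funext fun i => by
    rw [coordF_apply, map_add, (D.isLagrangian_L₀ _).1 (B.e_mem i) l hl, zero_add]
  rw [h1, h2]
  exact congrArg₂ (· + ·) (B.eq_sum_e l hl).symm (B.eq_sum_f m hm).symm

theorem ω_eq (v w : W) :
    D.ω v w = B.coordE v ⬝ᵥ B.coordF w - B.coordF v ⬝ᵥ B.coordE w := by
  conv_lhs => rw [← B.vecE_add_vecF w]
  simp only [vecE, vecF, map_add, map_sum, map_smul, smul_eq_mul]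
  have h : ∀ i, D.ω v (B.e i) = -B.coordF v i := fun i => (D.isAlt.neg_eq _ _).symm
  simp only [h, dotProduct]
  rw [add_comm, sub_eq_add_neg, ← Finset.sum_neg_distrib]
  exact congrArg₂ _ (Finset.sum_congr rfl fun i _ => mul_comm _ _)
    (Finset.sum_congr rfl fun i _ => by ring)

theorem betaTilde_eq (v w : W) : D.betaTilde v w = B.coordE v ⬝ᵥ B.coordF w := by
  conv_lhs => rw [← B.vecE_add_vecF w]
  rw [map_add, D.betaTilde_of_mem_L₀_right v (B.vecE_mem _), zero_add,
    D.betaTilde_of_mem_M₀_right v (B.vecF_mem _), vecF, map_sum]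
  refine Finset.sum_congr rfl fun i _ => ?_
  rw [map_smul, smul_eq_mul, mul_comm]
  rfl

/-- The block of `g ∈ Sp(W)` from the first to the first Lagrangian. -/
def blockA (g : D.SpW) : Matrix (Fin n) (Fin n) R := of fun i j => B.coordE (g.1 (B.e j)) i

/-- The block of `g ∈ Sp(W)` from the second to the first Lagrangian. -/
def blockB (g : D.SpW) : Matrix (Fin n) (Fin n) R := of fun i j => B.coordE (g.1 (B.f j)) i

/-- The block of `g ∈ Sp(W)` from the first to the second Lagrangian. -/
def blockC (g : D.SpW) : Matrix (Fin n) (Fin n) R := of fun i j => B.coordF (g.1 (B.e j)) i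

/-- The block of `g ∈ Sp(W)` from the second to the second Lagrangian. -/
def blockD (g : D.SpW) : Matrix (Fin n) (Fin n) R := of fun i j => B.coordF (g.1 (B.f j)) i

theorem map_sum_smul (φ : W →ₗ[R] Fin n → R) (x : Fin n → W) (y : Fin n → R) :
    φ (∑ j, y j • x j) = (of fun i j => φ (x j) i) *ᵥ y := by
  rw [map_sum]
  funext i
  simp only [map_smul, Finset.sum_apply, Pi.smul_apply, smul_eq_mul, mulVec, dotProduct, of_apply]
  exact Finset.sum_congr rfl fun j _ => mul_comm _ _

theorem coordE_vecE (g : D.SpW) (y : Fin n → R) :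
    B.coordE (g.1 (B.vecE y)) = B.blockA g *ᵥ y :=
  map_sum_smul (B.coordE ∘ₗ (g.1 : W →ₗ[R] W)) B.e y

theorem coordE_vecF (g : D.SpW) (y : Fin n → R) :
    B.coordE (g.1 (B.vecF y)) = B.blockB g *ᵥ y :=
  map_sum_smul (B.coordE ∘ₗ (g.1 : W →ₗ[R] W)) B.f y

theorem coordF_vecE (g : D.SpW) (y : Fin n → R) :
    B.coordF (g.1 (B.vecE y)) = B.blockC g *ᵥ y :=
  map_sum_smul (B.coordF ∘ₗ (g.1 : W →ₗ[R] W)) B.e y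

theorem coordF_vecF (g : D.SpW) (y : Fin n → R) :
    B.coordF (g.1 (B.vecF y)) = B.blockD g *ᵥ y :=
  map_sum_smul (B.coordF ∘ₗ (g.1 : W →ₗ[R] W)) B.f y

theorem blockA_mul (g h : D.SpW) :
    B.blockA (g * h) = B.blockA g * B.blockA h + B.blockB g * B.blockC h := by
  ext i j
  have h1 : B.coordE (g.1 (h.1 (B.e j))) =
      B.blockA g *ᵥ B.coordE (h.1 (B.e j)) + B.blockB g *ᵥ B.coordF (h.1 (B.e j)) := by
    conv_lhs => rw [← B.vecE_add_vecF (h.1 (B.e j))]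
    rw [map_add, map_add, coordE_vecE, coordE_vecF]
  exact congrFun h1 i

theorem blockA_one : B.blockA 1 = 1 := by
  ext i j
  show D.ω (B.e j) (B.f i) = _
  rw [B.dual, one_apply]
  simp only [eq_comm]

theorem transpose_blockA_mul_blockD (g : D.SpW) :
    (B.blockA g)ᵀ * B.blockD g - (B.blockC g)ᵀ * B.blockB g = 1 := by
  ext i j
  refine (B.ω_eq (g.1 (B.e i)) (g.1 (B.f j))).symm.trans ?_
  rw [g.2, B.dual, one_apply]

theorem transpose_blockA_mul_blockC (g : D.SpW) :
    (B.blockA g)ᵀ * B.blockC g = (B.blockC g)ᵀ * B.blockA g := by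
  rw [← sub_eq_zero]
  ext i j
  refine (B.ω_eq (g.1 (B.e i)) (g.1 (B.e j))).symm.trans ?_
  rw [g.2]
  exact (D.isLagrangian_L₀ _).1 (B.e_mem i) _ (B.e_mem j)

theorem transpose_blockB_mul_blockD (g : D.SpW) :
    (B.blockB g)ᵀ * B.blockD g = (B.blockD g)ᵀ * B.blockB g := by
  rw [← sub_eq_zero]
  ext i j
  refine (B.ω_eq (g.1 (B.f i)) (g.1 (B.f j))).symm.trans ?_
  rw [g.2]
  exact (D.isLagrangian_M₀ _).1 (B.f_mem i) _ (B.f_mem j)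

theorem exists_blockC_eq [Finite R] [Module.Finite R W] {g : D.SpW} (hg : g ∈ D.stabL₀) :
    ∃ C, B.blockC g = (2 : R) • C := by
  have h : ∀ i j, ∃ c, B.blockC g i j = 2 * c := by
    intro i j
    obtain ⟨l, hl, h⟩ := (hg (red (B.e j))).2 ⟨_, B.e_mem j, rfl⟩
    have h1 : g.1 (B.e j) - l ∈ Ideal.span {(2 : R)} • (⊤ : Submodule R W) :=
      (Submodule.Quotient.eq _).1 h.symm
    obtain ⟨y, hy⟩ := mem_two_smul_top h1
    refine ⟨D.ω (B.e i) y, ?_⟩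
    show D.ω (B.e i) (g.1 (B.e j)) = _
    rw [eq_add_of_sub_eq hy, map_add, map_smul, (D.isLagrangian_L₀ _).1 (B.e_mem i) _ hl, add_zero,
      smul_eq_mul]
  choose C hC using h
  exact ⟨of C, Matrix.ext hC⟩

theorem isUnit_det_blockA [Finite R] [Module.Finite R W] {g : D.SpW} (hg : g ∈ D.stabL₀) :
    IsUnit (B.blockA g).det := by
  obtain ⟨C, hC⟩ := B.exists_blockC_eq hg
  have h := B.transpose_blockA_mul_blockD g
  rw [hC, transpose_smul, Matrix.smul_mul, sub_eq_iff_eq_add] at h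
  have h1 := congrArg Matrix.det h
  rw [det_mul, det_transpose, det_one_add_two_smul] at h1
  refine isUnit_of_mul_isUnit_left (y := (B.blockD g).det) ?_
  rw [h1]
  exact IsUnit.of_mul_eq_one (1 - 2 * (Cᵀ * B.blockB g).trace)
    (by linear_combination (-(Cᵀ * B.blockB g).trace ^ 2) * four_eq_zero R)

theorem alphaTilde_vecF (g : D.SpW) (y : Fin n → R) :
    D.alphaTilde g (B.vecF y) = B.blockB g *ᵥ y ⬝ᵥ B.blockD g *ᵥ y := by
  rw [alphaTilde, D.betaTilde_of_mem_M₀_left (B.vecF_mem y), sub_zero, B.betaTilde_eq,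
    coordE_vecF, coordF_vecF]

theorem alphaTilde_vecE (g : D.SpW) (y : Fin n → R) :
    D.alphaTilde g (B.vecE y) = B.blockA g *ᵥ y ⬝ᵥ B.blockC g *ᵥ y := by
  rw [alphaTilde, D.betaTilde_of_mem_L₀_right _ (B.vecE_mem y), sub_zero, B.betaTilde_eq,
    coordE_vecE, coordF_vecE]

theorem ω_vecF_vecE (g : D.SpW) (x y : Fin n → R) :
    D.ω (B.vecF x) (g.1 (B.vecE y)) = -(B.blockA g *ᵥ y ⬝ᵥ x) := by
  rw [← D.isAlt.neg_eq, vecF, map_sum, ← coordE_vecE]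
  simp only [map_smul, dotProduct, smul_eq_mul, coordE_apply]
  simp only [mul_comm]

theorem red_vecF_of_mem {v : Red R W} (hv : v ∈ D.M₀.map red) : ∃ y, v = red (B.vecF y) := by
  obtain ⟨m, hm, rfl⟩ := hv
  exact ⟨B.coordF m, congrArg red (B.eq_sum_f m hm)⟩

/-- The sign of the determinant of the first block is a coboundary on the stabilizer of `L₀` in
`Sp(W)`, up to the function `α`. -/
theorem unitSign_det_blockA_mul [Finite R] [Module.Finite R W] (hR : IsDyadic R) {g h : D.SpW}
    (hg : g ∈ D.stabL₀) (hh : h ∈ D.stabL₀) {v : Red R W} (hv : v ∈ D.M₀.map red)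
    (hα : ∀ l ∈ D.L₀.map red,
      psi R ((D.toASp h).α l + D.omega v ((D.toASp h).g.1 l)) = 1) :
    unitSign hR (B.blockA (g * h)).det = unitSign hR (B.blockA g).det *
      unitSign hR (B.blockA h).det * psi R (2 * (D.toASp g).α v) := by
  obtain ⟨x, rfl⟩ := B.red_vecF_of_mem hv
  obtain ⟨C, hC⟩ := B.exists_blockC_eq hg
  obtain ⟨C', hC'⟩ := B.exists_blockC_eq hh
  have h1 : (D.toASp g).α (red (B.vecF x)) = B.blockB g *ᵥ x ⬝ᵥ B.blockD g *ᵥ x :=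
    B.alphaTilde_vecF g x
  rw [blockA_mul, hC', Matrix.mul_smul, h1]
  refine unitSign_det_cocycle hR (B.isUnit_det_blockA hg) (B.isUnit_det_blockA hh) ?_ ?_ ?_ ?_
  · have h2 := congrArg Matrix.transpose (B.transpose_blockA_mul_blockD g)
    rw [transpose_sub, transpose_mul, transpose_mul, transpose_transpose, transpose_transpose,
      hC, transpose_one, sub_eq_iff_eq_add] at h2
    rw [h2, Matrix.mul_smul, smul_add, smul_smul,
      show (2 : R) * 2 = 0 by linear_combination four_eq_zero R, zero_smul, add_zero]
  · rw [transpose_mul, transpose_transpose, transpose_blockB_mul_blockD]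
  · have h2 := B.transpose_blockA_mul_blockC h
    rwa [hC', transpose_smul, Matrix.mul_smul, Matrix.smul_mul] at h2
  · intro y
    have h2 := hα (red (B.vecE y)) ⟨_, B.vecE_mem y, rfl⟩
    have h3 : (D.toASp h).α (red (B.vecE y)) = 2 * (B.blockA h *ᵥ y ⬝ᵥ C' *ᵥ y) := by
      refine (B.alphaTilde_vecE h y).trans ?_
      rw [hC', smul_mulVec, dotProduct_smul, smul_eq_mul]
    have h4 : D.omega (red (B.vecF x)) ((D.toASp h).g.1 (red (B.vecE y))) =
        2 * -(B.blockA h *ᵥ y ⬝ᵥ x) := by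
      rw [← ω_vecF_vecE]
      rfl
    rw [h3, h4] at h2
    rw [← h2]
    congr 1
    linear_combination (B.blockA h *ᵥ y ⬝ᵥ x) * four_eq_zero R

end AdaptedBasis

end SplitSymplectic

end

end WeilTwo

namespace WeilTwo

noncomputable section

namespace SplitSymplectic

variable {R W : Type u} [CommRing R] [Algebra (ZMod 4) R] [AddCommGroup W] [Module R W]
variable {D : SplitSymplectic R W}
variable [Finite R] [Module.Finite R W] [Module.Free R W] (hR : IsDyadic R)

theorem omega_of_mem_red_L₀ {v w : Red R W} (hv : v ∈ D.L₀.map red) (hw : w ∈ D.L₀.map red) :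
    D.omega v w = 0 := by
  obtain ⟨v, hv, rfl⟩ := hv
  obtain ⟨w, hw, rfl⟩ := hw
  show 2 * D.ω v w = 0
  rw [(D.isLagrangian_L₀ v).1 hv _ hw, mul_zero]

theorem omega_of_mem_red_M₀ {v w : Red R W} (hv : v ∈ D.M₀.map red) (hw : w ∈ D.M₀.map red) :
    D.omega v w = 0 := by
  obtain ⟨v, hv, rfl⟩ := hv
  obtain ⟨w, hw, rfl⟩ := hw
  show 2 * D.ω v w = 0
  rw [(D.isLagrangian_M₀ v).1 hv _ hw, mul_zero]

theorem exists_add_eq (v : Red R W) :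
    ∃ l ∈ D.L₀.map red, ∃ m ∈ D.M₀.map red, l + m = v := by
  obtain ⟨w, rfl⟩ := Submodule.mkQ_surjective _ v
  obtain ⟨l, hl, m, hm, rfl⟩ := Submodule.mem_sup.1
    (D.isCompl.sup_eq_top.ge (Submodule.mem_top (x := w)))
  exact ⟨red l, ⟨l, hl, rfl⟩, red m, ⟨m, hm, rfl⟩, (map_add red l m).symm⟩

include hR in
theorem eq_zero_of_mem_of_mem {v : Red R W} (hL : v ∈ D.L₀.map red) (hM : v ∈ D.M₀.map red) :
    v = 0 := by
  refine D.omega_nondegenerate hR v (LinearMap.ext fun w => ?_)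
  obtain ⟨l, hl, m, hm, rfl⟩ := D.exists_add_eq w
  rw [map_add, omega_of_mem_red_L₀ hL hl, omega_of_mem_red_M₀ hM hm, add_zero]
  rfl

include hR in
/-- The function `α` of an element stabilizing the reduction of `L₀` is, on `L₀`, the character
given by a vector in the reduction of `M₀`. -/
theorem exists_psi_α_eq_one {g : D.ASp} (hg : ∀ v, g.g.1 v ∈ D.L₀.map red ↔ v ∈ D.L₀.map red) :
    ∃ v ∈ D.M₀.map red, ∀ l ∈ D.L₀.map red, psi R (g.α l + D.omega v (g.g.1 l)) = 1 := by
  classical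
  have := finite_red (R := R) (W := W)
  have := Fintype.ofFinite (Red R W)
  let L : Submodule R (Red R W) := D.L₀.map red
  have := Fintype.ofFinite L
  let φ : Red R W → L →+ R := fun v => AddMonoidHom.mk'
    (fun l => g.α l + D.omega v (g.g.1 l)) fun l m => by
      have h1 := g.quad l m
      rw [D.beta_red_L₀_right _ ((hg _).2 m.2), D.beta_red_L₀_right _ m.2, sub_zero] at h1
      rw [Submodule.coe_add, map_add, map_add]
      linear_combination h1
  have h0 : ∑ v, ∑ l : L, psi R (φ v l) = Nat.card (Red R W) := by
    rw [Finset.sum_comm, Finset.sum_eq_single (0 : L)]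
    · simp [φ, ASp.α_zero, Nat.card_eq_fintype_card]
    · intro l _ hl
      have h1 : ∀ v, psi R (φ v l) = psi R (g.α l) * psi R (D.omega.flip (g.g.1 l) v) :=
        fun v => psi_add _ _
      simp only [h1, ← Finset.mul_sum]
      rw [sum_addChar_linearMap hR.psi_primitive, if_neg, mul_zero]
      intro h2
      refine hl (Subtype.ext (g.g.1.injective ?_))
      refine (D.omega_nondegenerate hR _ (LinearMap.ext fun w => ?_)).trans (map_zero _).symm
      have h3 : D.omega w (g.g.1 l) = 0 := LinearMap.congr_fun h2 w
      rw [← (D.omega_isAlt).neg_eq, h3, neg_zero]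
      rfl
    · exact fun h => (h (Finset.mem_univ _)).elim
  have h1 : ∃ v, ∀ l, psi R (φ v l) = 1 := by
    by_contra! h
    have h2 : ∀ v, ∑ l : L, psi R (φ v l) = 0 := fun v => by
      rw [sum_addChar_addMonoidHom, if_neg]
      push Not
      exact h v
    simp only [h2, Finset.sum_const_zero] at h0
    exact Nat.cast_ne_zero.2 Nat.card_pos.ne' h0.symm
  obtain ⟨v, hv⟩ := h1
  obtain ⟨l, hl, m, hm, rfl⟩ := D.exists_add_eq v
  refine ⟨m, hm, fun x hx => ?_⟩
  rw [← hv ⟨x, hx⟩]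
  show _ = psi R (g.α x + D.omega (l + m) (g.g.1 x))
  rw [map_add D.omega, LinearMap.add_apply, omega_of_mem_red_L₀ hl ((hg x).2 hx), zero_add]

/-- Left translation by `k`, as a map between models. -/
def leftTranslation {A B : D.ELag} (k : D.Heis)
    (hk : ∀ (f : D.model A) (l : B.L) (h : D.Heis), f.1 (k * (B.τ l * h)) = f.1 (k * h)) :
    D.model A →ₗ[ℂ] D.model B where
  toFun f := ⟨fun h => f.1 (k * h), fun z l h => by
    beta_reduce
    rw [mul_assoc, ← mul_assoc k, ← Heis.central_comm, mul_assoc, model_central, hk]⟩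
  map_add' _ _ := rfl
  map_smul' _ _ := rfl

theorem isUnitaryIntegral_leftTranslation {A B : D.ELag} (k : D.Heis)
    (hk : ∀ (f : D.model A) (l : B.L) (h : D.Heis), f.1 (k * (B.τ l * h)) = f.1 (k * h)) :
    IsUnitaryIntegral (leftTranslation k hk) where
  intertwines h f := Subtype.ext (funext fun x => congrArg f.1 (mul_assoc k x h))
  herm_eq f := herm_comp_mul_left k f.1 f.1
  integral := ⟨0, fun f hf h => by
    rw [pow_zero, one_mul]
    exact hf _⟩

theorem leftTranslation_condition {g : D.ASp}
    (hg : ∀ v, g.g.1 v ∈ D.L₀.map red ↔ v ∈ D.L₀.map red) {v : Red R W}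
    (hα : ∀ l ∈ D.L₀.map red, psi R (g.α l + D.omega v (g.g.1 l)) = 1)
    (f : D.model (D.baseELag hR)) (l : (g • D.baseELag hR).L) (h : D.Heis) :
    f.1 (⟨v, 0⟩ * ((g • D.baseELag hR).τ l * h)) = f.1 (⟨v, 0⟩ * h) := by
  obtain ⟨_, l, hl, rfl⟩ := l
  have h1 : (g • D.baseELag hR).τ ⟨g.g.1 l, l, hl, rfl⟩ = ⟨g.g.1 l, g.α l⟩ := by
    refine (ELag.toMulAut_τ g (D.baseELag hR) ⟨l, hl⟩).symm.trans ?_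
    ext
    · rfl
    · exact zero_add _
  have h2 : (⟨v, 0⟩ : D.Heis) * (⟨g.g.1 l, g.α l⟩ * h) =
      Heis.central (g.α l + D.omega v (g.g.1 l)) *
        (D.baseELag hR).τ ⟨g.g.1 l, (hg l).2 hl⟩ * (⟨v, 0⟩ * h) := by
    rw [← mul_assoc, ← mul_assoc]
    congr 1
    rw [Heis.mul_comm_central]
    congr 1
    ext
    · simp [baseELag]
    · simp only [baseELag, Heis.mul_z, Heis.central_z, Heis.central_v, map_zero,
        LinearMap.zero_apply]
      ring
  refine (congrArg f.1 ((congrArg (fun t => ⟨v, 0⟩ * (t * h)) h1).trans h2)).trans ?_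
  rw [f.2, hα l hl, one_mul]

/-- The components of an element of `AMp(V)` at the object `𝔥` are multiples of `θ_g`. -/
theorem AMp.exists_app_base_eq (a : D.AMp) (L : D.ELag) :
    ∃ ζ : ℂ, ζ ^ 4 = 1 ∧ ∀ f, a.app (WeilGerbe.base D hR) L f = ζ • D.theta a.g L f := by
  let k : WeilGerbe.Hom (WeilGerbe.pullObj a.g (WeilGerbe.base D hR)) (WeilGerbe.base D hR) :=
    a.ι.hom.app _
  let t : D.model (a.g • L) ≃ₗ[ℂ] D.model L := k.map L
  have ht : ∀ (h : D.Heis) (f : D.model (a.g • L)),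
      t (D.modelRep (a.g • L) (ASp.toMulAut a.g h) f) = D.modelRep L h (t f) :=
    fun h f => k.intertwines L h f
  obtain ⟨ζ, hζ⟩ := exists_eq_smul hR L (t.toLinearMap ∘ₗ (D.theta a.g L).symm.toLinearMap)
    (fun h f => by
      obtain ⟨f, rfl⟩ := (D.theta a.g L).surjective f
      simp only [← theta_intertwines, LinearEquiv.symm_apply_apply, LinearMap.comp_apply,
        LinearEquiv.coe_coe, ht])
  have h1 : ∀ f, t f = ζ • D.theta a.g L f := fun f => by
    have := hζ (D.theta a.g L f)
    simpa only [LinearEquiv.symm_apply_apply, LinearMap.comp_apply, LinearEquiv.coe_coe] using this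
  refine ⟨ζ, ?_, h1⟩
  refine pow_four_eq_one_of_tpow (f := (D.theta a.g L).toLinearMap) (g := t.toLinearMap)
    (D.theta a.g L).surjective h1 ?_
  have h2 : tpow 4 (LinearMap.id : D.model L →ₗ[ℂ] D.model L) ∘ₗ tpow 4 t.toLinearMap =
    tpow 4 (D.theta a.g L).toLinearMap := k.map_tpow L
  rwa [tpow_id, LinearMap.id_comp] at h2

/-- `(v, c)` describes the operator of `a ∈ AMp(V)` on the horizontal sections of `𝔥`, composed
with the evaluation at `1` in the fibre at the base point. -/
structure IsMark (a : D.AMp) (v : Red R W) (c : ℂ) : Prop where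
  mem : v ∈ D.M₀.map red
  pow_four : c ^ 4 = 1
  psi_eq : ∀ l ∈ D.L₀.map red, psi R (a.g.α l + D.omega v (a.g.g.1 l)) = 1
  transport_eq : ∀ f : (WeilGerbe.base D hR).Gam,
    (show D.model (D.baseELag hR) from
      ((WeilGerbe.base D hR).transport a f).1 (D.baseELag hR)).1 1 =
    c * (show D.model (D.baseELag hR) from f.1 (D.baseELag hR)).1 ⟨v, 0⟩

theorem exists_isMark (a : D.AMp)
    (hg : ∀ v, a.g.g.1 v ∈ D.L₀.map red ↔ v ∈ D.L₀.map red) : ∃ v c, IsMark hR a v c := by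
  obtain ⟨v, hv, hα⟩ := exists_psi_α_eq_one hR hg
  let Λ := D.baseELag hR
  obtain ⟨ζ, hζ, h1⟩ := a.exists_app_base_eq hR Λ
  obtain ⟨ξ, hξ, h2⟩ := (isUnitaryIntegral_leftTranslation _
    (leftTranslation_condition hR hg hα)).exists_eq_smul hR
      (isUnitaryIntegralEquiv_unitaryTriv hR (a.g • Λ) Λ)
  have hξ0 : ξ ≠ 0 := fun h => by rw [h] at hξ; norm_num at hξ
  refine ⟨v, ζ * ξ⁻¹, hv, by rw [mul_pow, inv_pow, hζ, hξ, inv_one, one_mul], hα, fun f => ?_⟩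
  let fΛ : D.model Λ := f.1 Λ
  let fg : D.model (a.g • Λ) := f.1 (a.g • Λ)
  have h3 : (D.unitaryTriv hR).map (a.g • Λ) Λ fΛ = fg := f.2 (a.g • Λ) Λ
  have h4 := congrArg (fun x : D.model (a.g • Λ) => x.1 1) (h2 fΛ)
  rw [h3] at h4
  have h5 : fΛ.1 ⟨v, 0⟩ = ξ * fg.1 1 := (congrArg fΛ.1 (mul_one _).symm).trans h4
  have h6 := congrArg (fun x : D.model Λ => x.1 1) (h1 fg)
  refine h6.trans ?_
  show ζ * fg.1 (ASp.toMulAut a.g 1) = ζ * ξ⁻¹ * fΛ.1 ⟨v, 0⟩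
  rw [h5, map_one, mul_assoc, inv_mul_cancel_left₀ hξ0]

theorem IsMark.transport_apply {a : D.AMp} {v : Red R W} {c : ℂ} (h : IsMark hR a v c)
    (f : (WeilGerbe.base D hR).Gam) (k : D.Heis) :
    (show D.model (D.baseELag hR) from
      ((WeilGerbe.base D hR).transport a f).1 (D.baseELag hR)).1 k =
    c * (show D.model (D.baseELag hR) from f.1 (D.baseELag hR)).1
      (⟨v, 0⟩ * ASp.toMulAut a.g k) := by
  have h1 := h.transport_eq ((WeilGerbe.base D hR).heisRep (ASp.toMulAut a.g k) f)
  rw [WeilGerbe.transport_heisRep] at h1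
  refine Eq.trans ?_ h1
  exact congrArg (show D.model (D.baseELag hR) from
      ((WeilGerbe.base D hR).transport a f).1 (D.baseELag hR)).1 (one_mul k).symm

/-- The horizontal section with a given value at the base point. -/
def sectionOf (f : D.model (D.baseELag hR)) : (WeilGerbe.base D hR).Gam :=
  ⟨fun L => (D.unitaryTriv hR).map L (D.baseELag hR) f, fun M L =>
    (D.unitaryTriv hR).mul M L (D.baseELag hR) f⟩

theorem sectionOf_base (f : D.model (D.baseELag hR)) :
    (sectionOf hR f).1 (D.baseELag hR) = f := (D.unitaryTriv hR).map_self _ _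

theorem eq_of_forall_apply {v v' : Red R W} (hv : v ∈ D.M₀.map red) (hv' : v' ∈ D.M₀.map red)
    {c c' : ℂ} (hc : c ≠ 0)
    (h : ∀ f : D.model (D.baseELag hR), c * f.1 ⟨v, 0⟩ = c' * f.1 ⟨v', 0⟩) :
    v = v' ∧ c = c' := by
  have h1 := h (D.modelRep _ (⟨v, 0⟩ : D.Heis)⁻¹ (delta _))
  rw [modelRep_apply, modelRep_apply, mul_inv_cancel, delta_one, mul_one] at h1
  have h2 : v = v' := by
    by_contra hne
    rw [delta_of_notMem, mul_zero] at h1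
    · exact hc h1
    · intro h3
      have h4 : v' + -v ∈ D.L₀.map red := h3
      refine hne (neg_add_eq_zero.1 ?_)
      rw [add_comm]
      exact eq_zero_of_mem_of_mem hR h4 (Submodule.add_mem _ hv' (Submodule.neg_mem _ hv))
  subst h2
  rw [mul_inv_cancel, delta_one, mul_one] at h1
  exact ⟨rfl, h1⟩

/-- Marks are multiplicative up to the function `α`. -/
theorem IsMark.sq_mul {a b : D.AMp} {v w x : Red R W} {c d e : ℂ} (ha : IsMark hR a v c)
    (hb : IsMark hR b w d) (hab : IsMark hR (a * b) x e) :
    e ^ 2 = c ^ 2 * d ^ 2 * psi R (2 * a.g.α w) := by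
  obtain ⟨l, hl, m, hm, hlm⟩ := D.exists_add_eq (a.g.g.1 w)
  have hvm : v + m ∈ D.M₀.map red := Submodule.add_mem _ ha.mem hm
  have he : e ≠ 0 := fun h => by
    have := hab.pow_four
    rw [h] at this
    norm_num at this
  have key : (⟨v, 0⟩ : D.Heis) * ASp.toMulAut a.g ⟨w, 0⟩ =
      Heis.central (a.g.α w - D.beta l (v + m)) * (D.baseELag hR).τ ⟨l, hl⟩ * ⟨v + m, 0⟩ := by
    ext
    · simp only [Heis.mul_v, ASp.toMulAut_v, Heis.central_v, baseELag, ← hlm]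
      abel
    · simp only [Heis.mul_z, Heis.mul_v, ASp.toMulAut_v, ASp.toMulAut_z, Heis.central_v,
        Heis.central_z, baseELag, D.beta_red_M₀_left ha.mem, map_zero, LinearMap.zero_apply]
      rw [zero_add l]
      ring
  have h1 : ∀ f : D.model (D.baseELag hR), e * f.1 ⟨x, 0⟩ =
      d * c * psi R (a.g.α w - D.beta l (v + m)) * f.1 ⟨v + m, 0⟩ := by
    intro f
    have h2 := hab.transport_eq (sectionOf hR f)
    rw [WeilGerbe.transport_mul] at h2
    have h3 := hb.transport_eq ((WeilGerbe.base D hR).transport a (sectionOf hR f))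
    have h4 := ha.transport_apply hR (sectionOf hR f) ⟨w, 0⟩
    have h5 := (h2.symm.trans h3).trans (congrArg (d * ·) h4)
    rw [sectionOf_base] at h5
    refine h5.trans ?_
    show d * (c * f.1 (⟨v, 0⟩ * ASp.toMulAut a.g ⟨w, 0⟩)) = _
    rw [key, f.2]
    ring
  obtain ⟨-, h2⟩ := eq_of_forall_apply hR hab.mem hvm he h1
  rw [h2, mul_pow, psi_sq, mul_sub, D.two_mul_beta, sub_zero]
  ring

theorem IsMark.eq_of_incl {ζ : rootsOfUnity 4 ℂ} {v : Red R W} {c : ℂ}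
    (h : IsMark hR (AMp.incl (D := D) ζ) v c) : c = ((ζ : ℂˣ) : ℂ) := by
  refine ((eq_of_forall_apply hR (Submodule.zero_mem _) h.mem (Units.ne_zero _)
    fun f => ?_).2).symm
  have h1 := h.transport_eq (sectionOf hR f)
  rw [WeilGerbe.transport_incl] at h1
  have h2 := h1.symm
  rw [sectionOf_base] at h2
  refine Eq.trans ?_ h2.symm
  exact congrArg (fun x : D.model (D.baseELag hR) => ((ζ : ℂˣ) : ℂ) * x.1 1)
    (sectionOf_base hR f).symm

end SplitSymplectic

end

end WeilTwo

namespace WeilTwo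

noncomputable section

theorem IsCentralExtension.finite {A G Q : Type*} [Group A] [Group G] [Group Q] {i : A →* G}
    {p : G →* Q} (h : IsCentralExtension i p) [Finite A] [Finite Q] : Finite G := by
  choose t ht using h.surjective
  refine Finite.of_surjective (fun x : Q × A => t x.1 * i x.2) fun g => ?_
  obtain ⟨a, ha⟩ : (t (p g))⁻¹ * g ∈ i.range := by
    rw [h.exact, MonoidHom.mem_ker, map_mul, map_inv, ht, inv_mul_cancel]
  exact ⟨(p g, a), (congrArg _ ha).trans (mul_inv_cancel_left _ _)⟩

theorem IsCentralExtension.of_mulEquiv {A G G' Q : Type*} [Group A] [Group G] [Group G'] [Group Q]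
    {i : A →* G} {p : G →* Q} (h : IsCentralExtension i p) (e : G' ≃* G) :
    IsCentralExtension (e.symm.toMonoidHom.comp i) (p.comp e.toMonoidHom) where
  injective := e.symm.injective.comp h.injective
  surjective := h.surjective.comp e.surjective
  exact := by
    ext x
    have h1 : e x ∈ i.range ↔ p (e x) = 1 := by rw [h.exact]; rfl
    refine Iff.trans ?_ h1
    exact exists_congr fun a => e.symm_apply_eq
  central := by
    rintro _ ⟨a, rfl⟩
    rw [Subgroup.mem_center_iff]
    intro g
    apply e.injective
    have h1 := Subgroup.mem_center_iff.1 (h.central ⟨a, rfl⟩) (e g)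
    simpa using h1

namespace SplitSymplectic

variable {R W : Type u} [CommRing R] [Algebra (ZMod 4) R] [AddCommGroup W] [Module R W]
variable [Finite R] [Module.Finite R W]
variable (D : SplitSymplectic R W)

/-- The pull-back of `AMp(V)` to `Sp(W)`. -/
def cover : Subgroup (D.SpW × D.AMp) :=
  (D.toASp.comp (MonoidHom.fst D.SpW D.AMp)).eqLocus (AMp.proj.comp (MonoidHom.snd D.SpW D.AMp))

/-- The projection of the pull-back of `AMp(V)` to `Sp(W)`. -/
def coverFst : D.cover →* D.SpW := (MonoidHom.fst _ _).comp D.cover.subtype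

/-- The map of the pull-back of `AMp(V)` to `AMp(V)`. -/
def coverSnd : D.cover →* D.AMp := (MonoidHom.snd _ _).comp D.cover.subtype

theorem proj_coverSnd (x : D.cover) : (D.coverSnd x).g = D.toASp (D.coverFst x) := x.2.symm

/-- The inclusion of `μ₄` into the pull-back of `AMp(V)` to `Sp(W)`. -/
def coverIncl : rootsOfUnity 4 ℂ →* D.cover :=
  ((1 : rootsOfUnity 4 ℂ →* D.SpW).prod AMp.incl).codRestrict D.cover fun _ => map_one D.toASp

/-- The elements of the pull-back of `AMp(V)` which stabilize the reduction of `L₀`. -/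
def coverStab : Subgroup D.cover := D.stabL₀.comap D.coverFst

variable [Module.Free R W]

theorem coverIncl_mul_comm (ζ : rootsOfUnity 4 ℂ) (x : D.cover) :
    D.coverIncl ζ * x = x * D.coverIncl ζ :=
  Subtype.ext (Prod.ext ((one_mul _).trans (mul_one _).symm) (AMp.incl_mul_comm ζ x.1.2))

variable {D}
variable (hR : IsDyadic R)

include hR in
theorem coverIsCentralExtension : IsCentralExtension D.coverIncl D.coverFst where
  injective ζ ξ h := AMp.incl_injective hR (congrArg D.coverSnd h)
  surjective g := by
    obtain ⟨a, ha⟩ := AMp.proj_surjective hR (D.toASp g)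
    exact ⟨⟨(g, a), ha.symm⟩, rfl⟩
  exact := by
    ext x
    constructor
    · rintro ⟨ζ, rfl⟩
      rfl
    · intro h
      have h1 : (D.coverSnd x).g = 1 := by
        rw [proj_coverSnd, show D.coverFst x = 1 from h, map_one]
      obtain ⟨ζ, hζ⟩ := AMp.exists_incl_eq hR _ h1
      exact ⟨ζ, Subtype.ext (Prod.ext (Eq.symm h) hζ)⟩
  central := by
    rintro _ ⟨ζ, rfl⟩
    rw [Subgroup.mem_center_iff]
    exact fun x => (D.coverIncl_mul_comm ζ x).symm

theorem exists_isMark_coverStab (x : D.coverStab) :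
    ∃ v c, IsMark hR (D.coverSnd x) v c :=
  exists_isMark hR _ (by
    rw [proj_coverSnd]
    exact x.2)

/-- The vector describing the operator of an element of the stabilizer. -/
def markVec (x : D.coverStab) : Red R W := (exists_isMark_coverStab hR x).choose

/-- The scalar describing the operator of an element of the stabilizer. -/
def markScalar (x : D.coverStab) : ℂ := (exists_isMark_coverStab hR x).choose_spec.choose

theorem isMark (x : D.coverStab) : IsMark hR (D.coverSnd x) (markVec hR x) (markScalar hR x) :=
  (exists_isMark_coverStab hR x).choose_spec.choose_spec

/-- The value at `x` of the character of the stabilizer of `L₀`. -/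
def stabSign {n : ℕ} (B : D.AdaptedBasis n) (x : D.coverStab) : ℂ :=
  markScalar hR x ^ 2 * unitSign hR (B.blockA (D.coverFst x)).det

theorem stabSign_sq {n : ℕ} (B : D.AdaptedBasis n) (x : D.coverStab) :
    stabSign hR B x ^ 2 = 1 := by
  rw [stabSign, mul_pow, unitSign_sq hR (B.isUnit_det_blockA x.2), ← pow_mul,
    (isMark hR x).pow_four, one_mul]

theorem stabSign_mul {n : ℕ} (B : D.AdaptedBasis n) (x y : D.coverStab) :
    stabSign hR B (x * y) = stabSign hR B x * stabSign hR B y := by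
  have h1 := (isMark hR x).sq_mul hR (isMark hR y) (isMark hR (x * y))
  have h2 := B.unitSign_det_blockA_mul hR x.2 y.2 (isMark hR y).mem (by
    have := (isMark hR y).psi_eq
    rwa [proj_coverSnd] at this)
  have h3 : psi R (2 * (D.toASp (D.coverFst x)).α (markVec hR y)) ^ 2 = 1 := by
    rw [psi_sq, ← mul_assoc, show (2 : R) * 2 = 0 by linear_combination four_eq_zero R,
      zero_mul, psi_zero]
  rw [proj_coverSnd] at h1
  rw [stabSign, stabSign, stabSign, h1, Subgroup.coe_mul, map_mul D.coverFst, h2]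
  linear_combination (markScalar hR x ^ 2 * markScalar hR y ^ 2 *
    unitSign hR (B.blockA (D.coverFst x)).det * unitSign hR (B.blockA (D.coverFst y)).det) * h3

/-- The character of the stabilizer of `L₀` in the pull-back of `AMp(V)`, the square on `μ₄`. -/
def stabChar {n : ℕ} (B : D.AdaptedBasis n) : D.coverStab →* rootsOfUnity 2 ℂ :=
  MonoidHom.mk' (fun x => rootsOfUnity.mkOfPowEq (stabSign hR B x) (stabSign_sq hR B x))
    fun x y => Subtype.ext (Units.ext (stabSign_mul hR B x y))

theorem stabChar_coverIncl {n : ℕ} (B : D.AdaptedBasis n) (ζ : rootsOfUnity 4 ℂ)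
    (h : D.coverIncl ζ ∈ D.coverStab) :
    ((stabChar hR B ⟨D.coverIncl ζ, h⟩ : ℂˣ) : ℂ) = ((ζ : ℂˣ) : ℂ) ^ 2 := by
  show stabSign hR B _ = _
  rw [stabSign, IsMark.eq_of_incl hR (isMark hR ⟨D.coverIncl ζ, h⟩)]
  have h1 : B.blockA (D.coverFst (D.coverIncl ζ)) = 1 := B.blockA_one
  have h2 : unitSign hR (1 : R) = 1 := by
    have := unitSign_one_add hR 0
    rwa [mul_zero, add_zero, psi_zero] at this
  rw [h1, Matrix.det_one, h2, mul_one]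

include hR in
theorem not_two_dvd_index_coverStab : ¬ 2 ∣ D.coverStab.index := by
  rw [coverStab, Subgroup.index_comap_of_surjective _ (coverIsCentralExtension hR).surjective]
  exact not_two_dvd_index_stabL₀ D hR

include hR in
/-- A character of the pull-back of `AMp(V)` to `Sp(W)` which is the square on `μ₄`. -/
theorem exists_coverChar : ∃ χ : D.cover →* rootsOfUnity 2 ℂ,
    ∀ ζ : rootsOfUnity 4 ℂ, ((χ (D.coverIncl ζ) : ℂˣ) : ℂ) = ((ζ : ℂˣ) : ℂ) ^ 2 := by
  obtain ⟨B⟩ := D.exists_adaptedBasis hR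
  have hodd := not_two_dvd_index_coverStab (D := D) hR
  have : D.coverStab.FiniteIndex := ⟨fun h => hodd (by rw [h]; exact dvd_zero 2)⟩
  refine ⟨(stabChar hR B).transfer, fun ζ => ?_⟩
  have hmem : ∀ ξ, D.coverIncl ξ ∈ D.coverStab := fun ξ => D.stabL₀.one_mem
  rw [MonoidHom.transfer_eq_pow (stabChar hR B) (D.coverIncl ζ) fun k x _ => by
    rw [← map_pow, mul_assoc, coverIncl_mul_comm, inv_mul_cancel_left]]
  have h1 : (⟨D.coverIncl ζ ^ D.coverStab.index, pow_mem (hmem ζ) _⟩ : D.coverStab) =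
    ⟨D.coverIncl ζ, hmem ζ⟩ ^ D.coverStab.index := rfl
  rw [h1, map_pow]
  obtain ⟨m, hm⟩ := Nat.odd_iff.2 (Nat.two_dvd_ne_zero.1 hodd)
  have h2 : stabChar hR B ⟨D.coverIncl ζ, hmem ζ⟩ ^ 2 = 1 := Subtype.ext (stabChar hR B _).2
  rw [hm, pow_succ, pow_mul, h2, one_pow, one_mul, stabChar_coverIncl]

/-- The inclusion `μ₂ ⊆ μ₄`. -/
abbrev muTwoToMuFour : rootsOfUnity 2 ℂ →* rootsOfUnity 4 ℂ :=
  Subgroup.inclusion (rootsOfUnity_le_of_dvd (by norm_num : 2 ∣ 4))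

include hR in
/-- The pull-back of `AMp(V)` to `Sp(W)` reduces to `μ₂`. -/
theorem exists_isCentralExtension_mu_two :
    ∃ (Mp : Type u) (_ : Group Mp) (i : rootsOfUnity 2 ℂ →* Mp) (p : Mp →* D.SpW)
      (s : Mp →* D.AMp), IsCentralExtension i p ∧
      (∀ ζ, s (i ζ) = AMp.incl (muTwoToMuFour ζ)) ∧ ∀ m, AMp.proj (s m) = D.toASp (p m) := by
  obtain ⟨χ, hχ⟩ := exists_coverChar (D := D) hR
  have hext := coverIsCentralExtension (D := D) hR
  let i : rootsOfUnity 2 ℂ →* χ.ker := (D.coverIncl.comp muTwoToMuFour).codRestrict χ.ker fun ζ => by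
    refine Subtype.ext (Units.ext ((hχ _).trans ?_))
    exact congrArg Units.val ζ.2
  have h : IsCentralExtension i (D.coverFst.comp χ.ker.subtype) :=
    { injective := fun ζ ξ h => Subgroup.inclusion_injective _
        (hext.injective (congrArg Subtype.val h))
      surjective := fun g => by
        obtain ⟨x, rfl⟩ := hext.surjective g
        obtain ⟨z, hz⟩ := IsAlgClosed.exists_pow_nat_eq (((χ x)⁻¹ : ℂˣ) : ℂ) two_pos
        have h1 : z ^ 4 = 1 := by
          rw [show 4 = 2 * 2 from rfl, pow_mul, hz, ← Units.val_pow_eq_pow_val,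
            ← Units.val_one, inv_pow]
          congr 1
          exact inv_eq_one.2 (χ x).2
        refine ⟨⟨x * D.coverIncl (rootsOfUnity.mkOfPowEq z h1), ?_⟩, ?_⟩
        · refine Subtype.ext (Units.ext ?_)
          rw [map_mul, Subgroup.coe_mul, Units.val_mul, hχ, rootsOfUnity.coe_mkOfPowEq, hz,
            ← Units.val_mul, mul_inv_cancel]
          rfl
        · exact (map_mul D.coverFst _ _).trans (mul_one _)
      exact := by
        ext ⟨x, hx⟩
        constructor
        · rintro ⟨ζ, hζ⟩
          exact congrArg (fun y : χ.ker => D.coverFst y) hζ.symm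
        · intro h
          obtain ⟨ζ, rfl⟩ : x ∈ D.coverIncl.range := by
            rw [hext.exact]
            exact h
          have h1 : ((ζ : ℂˣ) : ℂ) ^ 2 = 1 := by
            rw [← hχ, show χ _ = 1 from hx]
            rfl
          exact ⟨⟨ζ, Units.ext h1⟩, rfl⟩
      central := by
        rintro _ ⟨ζ, rfl⟩
        rw [Subgroup.mem_center_iff]
        exact fun x => Subtype.ext (D.coverIncl_mul_comm _ x.1).symm }
  have := D.finite_spW
  have := h.finite
  let e : Shrink.{u} χ.ker ≃* χ.ker := Shrink.mulEquiv
  refine ⟨Shrink.{u} χ.ker, inferInstance, _, _,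
    (D.coverSnd.comp χ.ker.subtype).comp e.toMonoidHom, h.of_mulEquiv e, fun ζ => ?_, fun m => ?_⟩
  · exact congrArg (fun y : χ.ker => D.coverSnd y) (e.apply_symm_apply (i ζ))
  · exact D.proj_coverSnd _

end SplitSymplectic

end

end WeilTwo

theorem theorem2p4 (K : Type u) [Field K] [Algebra ℚ_[2] K] [FiniteDimensional ℚ_[2] K]
    [Algebra ℤ_[2] K] [IsScalarTower ℤ_[2] ℚ_[2] K]
    (hK : (Ideal.span {(2 : WeilTwo.RingOfInt K)}).IsMaximal)
    (W : Type u) [AddCommGroup W] [Module (WeilTwo.TruncRing K) W]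
    [Module.Free (WeilTwo.TruncRing K) W] [Module.Finite (WeilTwo.TruncRing K) W]
    (D : WeilTwo.SplitSymplectic (WeilTwo.TruncRing K) W) :
    -- the canonical trivialization of `𝔥^{⊗4}` exists and is unique
    (∃! T : WeilTwo.Trivialization (WeilTwo.tensorRep 4 D.modelRep), D.IsCanonical T) ∧
    -- the Weil gerbe is non-empty
    Nonempty D.WeilGerbe ∧
    -- `AMp(V)` is a central extension of `ASp(V)` by `μ₄`
    WeilTwo.IsCentralExtension (WeilTwo.SplitSymplectic.AMp.incl (D := D))
      (WeilTwo.SplitSymplectic.AMp.proj (D := D)) ∧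
    -- a central extension `Mp` of `Sp(W)` by `μ₂`, with a homomorphism of central extensions
    -- to `AMp(V)`, and the pulled back representation `ρ ∘ s`, which lies over the projective one
    ∃ (Mp : Type u) (_ : Group Mp) (i : rootsOfUnity 2 ℂ →* Mp) (p : Mp →* D.SpW)
      (s : Mp →* D.AMp),
      WeilTwo.IsCentralExtension i p ∧
      (∀ ζ : rootsOfUnity 2 ℂ, s (i ζ) = WeilTwo.SplitSymplectic.AMp.incl
        (Subgroup.inclusion (rootsOfUnity_le_of_dvd (by norm_num : 2 ∣ 4)) ζ)) ∧
      (∀ m : Mp, WeilTwo.SplitSymplectic.AMp.proj (s m) = D.toASp (p m)) ∧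
      ∀ (E : D.WeilGerbe),
        (∀ (ζ : rootsOfUnity 2 ℂ) (f : E.Gam),
          (E.weilRep.comp s) (i ζ) f = ((ζ : ℂˣ) : ℂ) • f) ∧
        ∀ (m : Mp) (h : D.Heis) (f : E.Gam),
          (E.weilRep.comp s) m (E.heisRep h f) =
            E.heisRep (WeilTwo.SplitSymplectic.ASp.toMulAut (D.toASp (p m)) h)
              ((E.weilRep.comp s) m f) := by
  have hR := WeilTwo.isDyadic_truncRing K hK
  obtain ⟨Mp, hMp, i, p, s, h, hi, hp⟩ :=
    WeilTwo.SplitSymplectic.exists_isCentralExtension_mu_two (D := D) hR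
  refine ⟨WeilTwo.SplitSymplectic.existsUnique_isCanonical hR,
    ⟨WeilTwo.SplitSymplectic.WeilGerbe.base D hR⟩,
    WeilTwo.SplitSymplectic.AMp.isCentralExtension hR, Mp, hMp, i, p, s, h, hi, hp,
    fun E => ⟨fun ζ f => ?_, fun m h f => ?_⟩⟩
  · refine (congrArg (fun a => E.weilRep a f) (hi ζ)).trans ((E.weilRep_incl _ f).trans ?_)
    have h1 : (ζ : ℂˣ)⁻¹ = ζ := inv_eq_of_mul_eq_one_left (by rw [← pow_two]; exact ζ.2)
    exact congrArg (fun u : ℂˣ => (u : ℂ) • f) h1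
  · exact (hp m) ▸ E.weilRep_heisRep (s m) h f
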